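/- Let $n\ge 2$ and let $\Omega\subset\mathbb{C}^n$ be a bounded domain (open, connected, non-empty) with $C^2$ boundary, $\Omega=\{z\in\mathbb{C}^n:\rho(z)<0\}$, where $\rho:\mathbb{C}^n\to\mathbb{R}$ is $C^2$ and $\nabla\rho\neq 0$ on $\partial\Omega$. For $\epsilon_0>0$ and $f$ holomorphic on $\Omega$ put $$\|f\|_{H^2,\epsilon_0}=\sup_{0<\epsilon<\epsilon_0}\Big(\int_{\{\rho=-\epsilon\}}|f|^2\,d\sigma_\epsilon\Big)^{1/2},$$ where $d\sigma_\epsilon$ is $(2n-1)$-dimensional Hausdorff measure, and let the Hardy space $H^2(\Omega)$ consist of the holomorphic $f$ on $\Omega$ with $\|f\|_{H^2,\epsilon_0}<\infty$ for some $\epsilon_0>0$. The Lumer Hardy space $\mathcal{L}H^2(\Omega)$ consists of the holomorphic $f$ on $\Omega$ for which there is a pluriharmonic $u$ on $\Omega$ with $|f|^2\le u$ on $\Omega$ (a pluriharmonic majorant of $|f|^2$). Fix $P_0\in\Omega$ and set $\|f\|_{\mathcal{L}H^2}=\inf_u u(P_0)^{1/2}$, the infimum being over all pluriharmonic majorants $u$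 of $|f|^2$. Then: 1. $\mathcal{L}H^2(\Omega)$ is a linear subspace of $H^2(\Omega)$, with continuous inclusion: there are $\epsilon_0>0$ and $C<\infty$ such that $\|f\|_{H^2,\epsilon_0}\le C\,\|f\|_{\mathcal{L}H^2}$ for all $f\in\mathcal{L}H^2(\Omega)$. 2. $\|\cdot\|_{\mathcal{L}H^2}$ is a norm, and $\mathcal{L}H^2(\Omega)$ with this norm is a Banach space. 3. $\mathcal{L}H^2(\Omega)$ contains a closed subspace that is isomorphic (linearly homeomorphic) to $\ell^\infty$. 4. $\mathcal{L}H^2(\Omega)$ is not a Hilbert space: it is not linearly homeomorphic to any complex Hilbert space. -/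

import Mathlib

open MeasureTheory Set
open scoped ENNReal NNReal

noncomputable section

namespace LumerHardy

variable {n : ℕ}

/-- `ρ` is a `C²` defining function of the bounded domain `Ω ⊆ ℂⁿ` (open and connected;
openness follows from `eq_setOf_neg`). So `Ω` is a bounded domain with `C²` boundary. -/
structure IsC2DefiningFunction (Ω : Set (EuclideanSpace ℂ (Fin n)))
    (ρ : EuclideanSpace ℂ (Fin n) → ℝ) : Prop where
  isConnected : IsConnected Ω
  isBounded : Bornology.IsBounded Ω
  contDiff : ContDiff ℝ 2 ρ
  eq_setOf_neg : Ω = {z | ρ z < 0}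
  fderiv_ne_zero : ∀ z ∈ frontier Ω, fderiv ℝ ρ z ≠ 0

/-- The extension by zero to `ℂⁿ` of a function on `Ω`. -/
def extZero {Ω : Set (EuclideanSpace ℂ (Fin n))} (f : Ω → ℂ) : EuclideanSpace ℂ (Fin n) → ℂ :=
  Function.extend Subtype.val f 0

theorem extZero_apply {Ω : Set (EuclideanSpace ℂ (Fin n))} (f : Ω → ℂ) (z : Ω) :
    extZero f z = f z :=
  Subtype.val_injective.extend_apply f 0 z

theorem extZero_zero {Ω : Set (EuclideanSpace ℂ (Fin n))} :
    extZero (0 : Ω → ℂ) = 0 :=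
  Function.extend_zero _

theorem extZero_add {Ω : Set (EuclideanSpace ℂ (Fin n))} (f g : Ω → ℂ) :
    extZero (f + g) = extZero f + extZero g := by
  simpa [extZero] using Function.extend_add (Subtype.val : Ω → _) f g 0 0

theorem extZero_smul {Ω : Set (EuclideanSpace ℂ (Fin n))} (c : ℂ) (f : Ω → ℂ) :
    extZero (c • f) = c • extZero f := by
  simpa [extZero] using Function.extend_smul c (Subtype.val : Ω → _) f 0

/-- The holomorphic functions on `Ω` (used for open `Ω`). -/
def holomorphic (Ω : Set (EuclideanSpace ℂ (Fin n))) : Submodule ℂ (Ω → ℂ) where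
  carrier := {f | DifferentiableOn ℂ (extZero f) Ω}
  zero_mem' := by
    simp only [mem_ofPred_eq, extZero_zero]
    exact differentiableOn_const 0
  add_mem' := by
    intro f g hf hg
    simp only [mem_ofPred_eq, extZero_add] at *
    exact hf.add hg
  smul_mem' := by
    intro c f hf
    simp only [mem_ofPred_eq, extZero_smul] at *
    exact hf.const_smul c

theorem norm_add_sq_le (a b : ℂ) : ‖a + b‖ ^ 2 ≤ 2 * ‖a‖ ^ 2 + 2 * ‖b‖ ^ 2 := by
  have h := norm_add_le a b
  nlinarith [sq_nonneg (‖a‖ - ‖b‖), norm_nonneg (a + b), norm_nonneg a, norm_nonneg b]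

/-- `u` is pluriharmonic on the open set `Ω`: it is `C²` there and it is harmonic along
every complex line. -/
def PluriharmonicOn (u : EuclideanSpace ℂ (Fin n) → ℝ) (Ω : Set (EuclideanSpace ℂ (Fin n))) :
    Prop :=
  ContDiffOn ℝ 2 u Ω ∧
    ∀ z ∈ Ω, ∀ v : EuclideanSpace ℂ (Fin n),
      InnerProductSpace.HarmonicAt (fun ζ : ℂ => u (z + ζ • v)) 0

theorem PluriharmonicOn.add {u v : EuclideanSpace ℂ (Fin n) → ℝ}
    {Ω : Set (EuclideanSpace ℂ (Fin n))} (hu : PluriharmonicOn u Ω) (hv : PluriharmonicOn v Ω) :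
    PluriharmonicOn (u + v) Ω :=
  ⟨hu.1.add hv.1, fun z hz w => (hu.2 z hz w).add (hv.2 z hz w)⟩

theorem PluriharmonicOn.const_smul {u : EuclideanSpace ℂ (Fin n) → ℝ}
    {Ω : Set (EuclideanSpace ℂ (Fin n))} (c : ℝ) (hu : PluriharmonicOn u Ω) :
    PluriharmonicOn (c • u) Ω :=
  ⟨contDiffOn_const.smul hu.1, fun z hz w => (hu.2 z hz w).const_smul⟩

theorem pluriharmonicOn_const (c : ℝ) (Ω : Set (EuclideanSpace ℂ (Fin n))) :
    PluriharmonicOn (fun _ => c) Ω :=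
  ⟨contDiffOn_const, fun _ _ _ => InnerProductSpace.harmonicAt_const c⟩

/-- `u` is a pluriharmonic majorant of `|f|²` on `Ω`. -/
def IsMajorant {Ω : Set (EuclideanSpace ℂ (Fin n))} (f : Ω → ℂ)
    (u : EuclideanSpace ℂ (Fin n) → ℝ) : Prop :=
  PluriharmonicOn u Ω ∧ ∀ z : Ω, ‖f z‖ ^ 2 ≤ u z

/-- The vector space `𝓛H²(Ω)` of the holomorphic functions `f` on `Ω` such that `|f|²` has a
pluriharmonic majorant. -/
def lumerHardy (Ω : Set (EuclideanSpace ℂ (Fin n))) : Submodule ℂ (Ω → ℂ) where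
  carrier := {f | f ∈ holomorphic Ω ∧ ∃ u, IsMajorant f u}
  zero_mem' := ⟨zero_mem _, fun _ => 0, pluriharmonicOn_const 0 Ω, by simp⟩
  add_mem' := by
    rintro f g ⟨hf, u, hu, hfu⟩ ⟨hg, v, hv, hgv⟩
    refine ⟨add_mem hf hg, (2 : ℝ) • u + (2 : ℝ) • v, (hu.const_smul 2).add (hv.const_smul 2),
      fun z => ?_⟩
    have h := norm_add_sq_le (f z) (g z)
    have h1 := hfu z
    have h2 := hgv z
    simp only [Pi.add_apply, Pi.smul_apply, smul_eq_mul]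
    linarith
  smul_mem' := by
    rintro c f ⟨hf, u, hu, hfu⟩
    refine ⟨Submodule.smul_mem _ c hf, (‖c‖ ^ 2 : ℝ) • u, hu.const_smul _, fun z => ?_⟩
    simp only [Pi.smul_apply, smul_eq_mul, norm_mul, mul_pow]
    exact mul_le_mul_of_nonneg_left (hfu z) (by positivity)

/-- The vector space `𝓛H²(Ω)` as a type of its own that remembers the base point `P₀`. It
carries no topology other than the one that its norm will induce. -/
def LumerSpace (Ω : Set (EuclideanSpace ℂ (Fin n))) (_P₀ : Ω) : Type := lumerHardy Ω

instance (Ω : Set (EuclideanSpace ℂ (Fin n))) (P₀ : Ω) : AddCommGroup (LumerSpace Ω P₀) :=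
  inferInstanceAs (AddCommGroup (lumerHardy Ω))

instance (Ω : Set (EuclideanSpace ℂ (Fin n))) (P₀ : Ω) : Module ℂ (LumerSpace Ω P₀) :=
  inferInstanceAs (Module ℂ (lumerHardy Ω))

/-- The element of `𝓛H²(Ω)`, read as a function on `Ω`. -/
def LumerSpace.toFun {Ω : Set (EuclideanSpace ℂ (Fin n))} {P₀ : Ω} (f : LumerSpace Ω P₀) :
    Ω → ℂ :=
  Subtype.val (p := fun g => g ∈ lumerHardy Ω) f

/-- The norm of `𝓛H²(Ω)` with base point `P₀`: the infimum of `u(P₀)^(1/2)` over all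
pluriharmonic majorants `u` of `|f|²`. -/
instance (Ω : Set (EuclideanSpace ℂ (Fin n))) (P₀ : Ω) : Norm (LumerSpace Ω P₀) where
  norm f := sInf {r : ℝ | ∃ u, IsMajorant f.toFun u ∧ r = √(u P₀)}

/-- The integral of `|f|²` over the level surface `{ρ = -ε}` with respect to the surface
measure, i.e. the `(2n-1)`-dimensional Hausdorff measure. -/
def levelIntegral {Ω : Set (EuclideanSpace ℂ (Fin n))} (ρ : EuclideanSpace ℂ (Fin n) → ℝ)
    (f : Ω → ℂ) (ε : ℝ) : ℝ≥0∞ :=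
  ∫⁻ z in {z | ρ z = -ε}, ‖extZero f z‖ₑ ^ 2 ∂(Measure.hausdorffMeasure (2 * n - 1 : ℝ))

/-- The Hardy norm `sup_{0 < ε < ε₀} (∫_{ρ = -ε} |f|² dσ_ε)^(1/2)`. -/
def hardyNorm {Ω : Set (EuclideanSpace ℂ (Fin n))} (ρ : EuclideanSpace ℂ (Fin n) → ℝ)
    (ε₀ : ℝ) (f : Ω → ℂ) : ℝ≥0∞ :=
  ⨆ ε ∈ Ioo (0 : ℝ) ε₀, (levelIntegral ρ f ε) ^ (1 / 2 : ℝ)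

theorem hardyNorm_lt_top_iff {Ω : Set (EuclideanSpace ℂ (Fin n))}
    {ρ : EuclideanSpace ℂ (Fin n) → ℝ} {ε₀ : ℝ} {f : Ω → ℂ} :
    hardyNorm ρ ε₀ f < ∞ ↔ ∃ C : ℝ≥0, ∀ ε ∈ Ioo (0 : ℝ) ε₀, levelIntegral ρ f ε ≤ C := by
  constructor
  · intro h
    refine ⟨(hardyNorm ρ ε₀ f).toNNReal ^ 2, fun ε hε => ?_⟩
    have h1 : (levelIntegral ρ f ε) ^ (1 / 2 : ℝ) ≤ hardyNorm ρ ε₀ f :=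
      le_iSup₂ (f := fun ε (_ : ε ∈ Ioo (0 : ℝ) ε₀) => (levelIntegral ρ f ε) ^ (1 / 2 : ℝ)) ε hε
    have h2 := ENNReal.rpow_le_rpow h1 (z := 2) (by norm_num)
    rw [← ENNReal.rpow_mul] at h2
    norm_num at h2
    rw [ENNReal.coe_pow, ENNReal.coe_toNNReal h.ne]
    exact h2
  · rintro ⟨C, hC⟩
    refine lt_of_le_of_lt (iSup₂_le fun ε hε => ENNReal.rpow_le_rpow (hC ε hε) (by norm_num)) ?_
    exact ENNReal.rpow_lt_top_of_nonneg (by norm_num) ENNReal.coe_ne_top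

theorem levelIntegral_add_le {Ω : Set (EuclideanSpace ℂ (Fin n))}
    {ρ : EuclideanSpace ℂ (Fin n) → ℝ} (h : IsC2DefiningFunction Ω ρ) {f g : Ω → ℂ}
    (hf : f ∈ holomorphic Ω) {ε : ℝ} (hε : 0 < ε) :
    levelIntegral ρ (f + g) ε ≤ 2 * levelIntegral ρ f ε + 2 * levelIntegral ρ g ε := by
  have hm : MeasurableSet {z | ρ z = -ε} :=
    (isClosed_eq h.contDiff.continuous continuous_const).measurableSet
  have hsub : {z | ρ z = -ε} ⊆ Ω := by
    intro z hz
    rw [h.eq_setOf_neg]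
    simp only [mem_ofPred_eq] at hz ⊢
    linarith
  have hmeas : AEMeasurable (fun z => 2 * ‖extZero f z‖ₑ ^ 2)
      ((Measure.hausdorffMeasure (2 * n - 1 : ℝ)).restrict {z | ρ z = -ε}) := by
    have hc : ContinuousOn (extZero f) {z | ρ z = -ε} :=
      (show DifferentiableOn ℂ (extZero f) Ω from hf).continuousOn.mono hsub
    exact ((hc.aemeasurable hm).enorm.pow_const 2).const_mul 2
  unfold levelIntegral
  rw [← lintegral_const_mul' _ _ (by norm_num), ← lintegral_const_mul' _ _ (by norm_num),
    ← lintegral_add_left' hmeas]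
  refine lintegral_mono fun z => ?_
  have h1 := norm_add_sq_le (extZero f z) (extZero g z)
  rw [extZero_add]
  simp only [Pi.add_apply, enorm_eq_nnnorm]
  exact_mod_cast h1

theorem levelIntegral_smul {Ω : Set (EuclideanSpace ℂ (Fin n))}
    {ρ : EuclideanSpace ℂ (Fin n) → ℝ} (c : ℂ) (f : Ω → ℂ) (ε : ℝ) :
    levelIntegral ρ (c • f) ε = ‖c‖ₑ ^ 2 * levelIntegral ρ f ε := by
  unfold levelIntegral
  rw [← lintegral_const_mul' _ _ (by simp)]
  refine lintegral_congr fun z => ?_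
  rw [extZero_smul, Pi.smul_apply, enorm_smul, mul_pow]

/-- The Hardy space `H²(Ω)`: the holomorphic functions with bounded integrals over the level
surfaces `{ρ = -ε}` near the boundary (the levels far from the boundary need not be
hypersurfaces). -/
def hardy {Ω : Set (EuclideanSpace ℂ (Fin n))} {ρ : EuclideanSpace ℂ (Fin n) → ℝ}
    (h : IsC2DefiningFunction Ω ρ) : Submodule ℂ (Ω → ℂ) where
  carrier := {f | f ∈ holomorphic Ω ∧ ∃ ε₀ > 0, hardyNorm ρ ε₀ f < ∞}
  zero_mem' := by
    refine ⟨zero_mem _, 1, one_pos, hardyNorm_lt_top_iff.2 ⟨0, fun ε _ => ?_⟩⟩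
    simp [levelIntegral, extZero_zero]
  add_mem' := by
    rintro f g ⟨hf, a, ha, hfa⟩ ⟨hg, b, hb, hgb⟩
    obtain ⟨C, hC⟩ := hardyNorm_lt_top_iff.1 hfa
    obtain ⟨D, hD⟩ := hardyNorm_lt_top_iff.1 hgb
    refine ⟨add_mem hf hg, min a b, lt_min ha hb,
      hardyNorm_lt_top_iff.2 ⟨2 * C + 2 * D, fun ε hε => ?_⟩⟩
    refine (levelIntegral_add_le h hf hε.1).trans ?_
    push_cast
    gcongr
    · exact hC ε ⟨hε.1, hε.2.trans_le (min_le_left _ _)⟩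
    · exact hD ε ⟨hε.1, hε.2.trans_le (min_le_right _ _)⟩
  smul_mem' := by
    rintro c f ⟨hf, a, ha, hfa⟩
    obtain ⟨C, hC⟩ := hardyNorm_lt_top_iff.1 hfa
    refine ⟨Submodule.smul_mem _ c hf, a, ha,
      hardyNorm_lt_top_iff.2 ⟨‖c‖₊ ^ 2 * C, fun ε hε => ?_⟩⟩
    rw [levelIntegral_smul, enorm_eq_nnnorm]
    push_cast
    gcongr
    exact hC ε hε

end LumerHardy

end

/-! Inclusion. A pluriharmonic majorant `u` is positive and has the mean value property, so
Harnack's inequality bounds it by a multiple of `u(P₀)` on compact sets. Near the boundary, Green's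
formula is applied to `u` and a compactly supported function of `ρ` that is subharmonic in a collar
and has Laplacian at least of order `1/ε` on the shell `ρ ≈ -ε`; this gives the shell mass at most
`C ε u(P₀)` (`exists_shell_estimate`). Level surfaces are Lipschitz graphs, of measure `O(s^(2n-1))`
in balls of radius `s`, so averaging `u` over balls of radius comparable to `ε` turns the shell
bound into `∫ u dσ_ε ≤ C u(P₀)`, and `|f|² ≤ u`.

Norm and completeness. The triangle inequality comes from a weighted combination of two majorants,
and definiteness from Harnack. For an absolutely convergent series, Cauchy–Schwarz majorizes the
tails by sums of positive pluriharmonic functions; such a sum is pluriharmonic as soon as it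
converges at `P₀` (`pluriharmonicOn_tsum`).

The copy of `ℓ^∞`. At a boundary point `ζ` farthest from the origin the boundary is strongly convex.
Complex lines through `(1 - t)ζ`, parallel to a complex tangent direction, cut small plane domains
out of `Ω`. Since `u` is harmonic on each of them, the shell estimate also holds on every slice,
uniformly in `t`: this is where pluriharmonic majorants are more restrictive than boundary
integrals.

On a slice take `N` boundary points `p_k`, equally spaced in one coordinate, and complex affine
functions `w_k` with `Re w_k ≥ c |z - p_k|²` on `Ω`. With `M` proportional to `N`, the sum `∑ (1 + M
w_k)⁻²` is bounded on `Ω`, is `O(1/N)` away from the boundary of the slice, and is at least `1/2` in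
modulus on `N` discs of radius of order `1/N`. Their total area is of order `1/N`, as is the shell
bound, so a majorant that is at least `β` on them satisfies `β ≤ C u(P₀)` (`SliceData.exists_peak`).

Infinitely many separated slices, with `N` growing fast, give functions `F_j` of which at most one
is not small at any given point. Then `x ↦ ∑ x_j F_j` is bounded by `2‖x‖` in the supremum norm,
while its norm is bounded below by a multiple of `‖x‖`. Finally `ℓ^∞` does not embed in a Hilbert
space, because signs can be chosen to make sums of the images of unit vectors long. -/

namespace LumerHardy

open Filter Topology Metric

/-! ### Second derivatives along affine maps -/

section Lines

variable {E F G : Type*} [NormedAddCommGroup E] [NormedSpace ℝ E] [NormedAddCommGroup F]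
  [NormedSpace ℝ F] [NormedAddCommGroup G] [NormedSpace ℝ G]

theorem fderiv_fderiv_comp_affine {f : E → G} (L : F →L[ℝ] E) (z : E) (x a b : F)
    (hf : ContDiffAt ℝ 2 f (z + L x)) :
    fderiv ℝ (fderiv ℝ fun y => f (z + L y)) x a b
      = fderiv ℝ (fderiv ℝ f) (z + L x) (L a) (L b) := by
  have hL : ∀ y, HasFDerivAt (fun y => z + L y) L y := fun y => L.hasFDerivAt.const_add z
  have hcont : ContinuousAt (fun y => z + L y) x := (hL x).continuousAt
  have hev : ∀ᶠ y in 𝓝 x, ContDiffAt ℝ 2 f (z + L y) :=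
    hcont.eventually (hf.eventually (by simp))
  have h1 : (fderiv ℝ fun y => f (z + L y)) =ᶠ[𝓝 x] fun y => (fderiv ℝ f (z + L y)).comp L := by
    filter_upwards [hev] with y hy
    exact ((hy.differentiableAt (by simp)).hasFDerivAt.comp y (hL y)).fderiv
  have h2 : HasFDerivAt (fderiv ℝ f) (fderiv ℝ (fderiv ℝ f) (z + L x)) (z + L x) :=
    ((hf.fderiv_right (m := 1) (by norm_num)).differentiableAt (by simp)).hasFDerivAt
  have h3 := (h2.comp x (hL x)).clm_comp (hasFDerivAt_const L x)
  rw [h1.fderiv_eq]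
  have h4 : fderiv ℝ (fun y => (fderiv ℝ f (z + L y)).comp L) x = _ := h3.fderiv
  rw [h4]
  simp

end Lines

/-! ### Pluriharmonic functions and the circle mean value property -/

section Pluriharmonic

variable {n : ℕ}

/-- The parametrization `ζ ↦ ζ • v` of a complex line, as a real linear map. -/
noncomputable def lineCLM (v : EuclideanSpace ℂ (Fin n)) : ℂ →L[ℝ] EuclideanSpace ℂ (Fin n) :=
  (ContinuousLinearMap.toSpanSingleton ℂ v).restrictScalars ℝ

@[simp] theorem lineCLM_apply (v : EuclideanSpace ℂ (Fin n)) (ζ : ℂ) : lineCLM v ζ = ζ • v := rfl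

/-- The Laplacian of `f` along the complex line spanned by `v`. -/
noncomputable def lineLaplacian (f : EuclideanSpace ℂ (Fin n) → ℝ)
    (v x : EuclideanSpace ℂ (Fin n)) : ℝ :=
  fderiv ℝ (fderiv ℝ f) x v v + fderiv ℝ (fderiv ℝ f) x (Complex.I • v) (Complex.I • v)

theorem laplacian_line {f : EuclideanSpace ℂ (Fin n) → ℝ} {z v : EuclideanSpace ℂ (Fin n)} {ζ : ℂ}
    (hf : ContDiffAt ℝ 2 f (z + ζ • v)) :
    Laplacian.laplacian (fun ζ : ℂ => f (z + ζ • v)) ζ = lineLaplacian f v (z + ζ • v) := by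
  rw [InnerProductSpace.laplacian_eq_iteratedFDeriv_complexPlane]
  have h := fderiv_fderiv_comp_affine (f := f) (lineCLM v) z ζ
  simp only [lineCLM_apply] at h
  simp only [iteratedFDeriv_two_apply, Matrix.cons_val_zero, Matrix.cons_val_one]
  rw [h 1 1 hf, h Complex.I Complex.I hf, one_smul, lineLaplacian]

theorem contDiffAt_line {f : EuclideanSpace ℂ (Fin n) → ℝ} {z v : EuclideanSpace ℂ (Fin n)} {ζ : ℂ}
    (hf : ContDiffAt ℝ 2 f (z + ζ • v)) : ContDiffAt ℝ 2 (fun ζ : ℂ => f (z + ζ • v)) ζ := by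
  refine ContDiffAt.comp (g := f) (f := fun ζ : ℂ => z + ζ • v) ζ hf ?_
  exact contDiffAt_const.add ((lineCLM v).contDiff.contDiffAt)

theorem continuous_line (z v : EuclideanSpace ℂ (Fin n)) :
    Continuous fun ζ : ℂ => z + ζ • v := by fun_prop

theorem PluriharmonicOn.contDiffAt {u : EuclideanSpace ℂ (Fin n) → ℝ}
    {Ω : Set (EuclideanSpace ℂ (Fin n))} (hu : PluriharmonicOn u Ω) (hΩ : IsOpen Ω)
    {z : EuclideanSpace ℂ (Fin n)} (hz : z ∈ Ω) : ContDiffAt ℝ 2 u z :=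
  hu.1.contDiffAt (hΩ.mem_nhds hz)

theorem PluriharmonicOn.lineLaplacian_eq_zero {u : EuclideanSpace ℂ (Fin n) → ℝ}
    {Ω : Set (EuclideanSpace ℂ (Fin n))} (hu : PluriharmonicOn u Ω) (hΩ : IsOpen Ω)
    {z : EuclideanSpace ℂ (Fin n)} (hz : z ∈ Ω) (v : EuclideanSpace ℂ (Fin n)) :
    lineLaplacian u v z = 0 := by
  have h := (hu.2 z hz v).2.self_of_nhds
  rw [laplacian_line (by simpa using hu.contDiffAt hΩ hz)] at h
  simpa using h

theorem PluriharmonicOn.harmonicAt_line {u : EuclideanSpace ℂ (Fin n) → ℝ}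
    {Ω : Set (EuclideanSpace ℂ (Fin n))} (hu : PluriharmonicOn u Ω) (hΩ : IsOpen Ω)
    {z v : EuclideanSpace ℂ (Fin n)} {ζ : ℂ} (hz : z + ζ • v ∈ Ω) :
    InnerProductSpace.HarmonicAt (fun ζ : ℂ => u (z + ζ • v)) ζ := by
  refine ⟨contDiffAt_line (hu.contDiffAt hΩ hz), ?_⟩
  have : ∀ᶠ ξ in 𝓝 ζ, z + ξ • v ∈ Ω := (continuous_line z v).continuousAt (hΩ.mem_nhds hz)
  filter_upwards [this] with ξ hξ
  rw [laplacian_line (hu.contDiffAt hΩ hξ), hu.lineLaplacian_eq_zero hΩ hξ]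
  rfl

theorem PluriharmonicOn.continuousOn {u : EuclideanSpace ℂ (Fin n) → ℝ}
    {Ω : Set (EuclideanSpace ℂ (Fin n))} (hu : PluriharmonicOn u Ω) : ContinuousOn u Ω :=
  hu.1.continuousOn

theorem PluriharmonicOn.circleAverage_eq {u : EuclideanSpace ℂ (Fin n) → ℝ}
    {Ω : Set (EuclideanSpace ℂ (Fin n))} (hu : PluriharmonicOn u Ω) (hΩ : IsOpen Ω)
    {z v : EuclideanSpace ℂ (Fin n)} {r : ℝ} (hr : closedBall z r ⊆ Ω) (hv : ‖v‖ ≤ r) :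
    Real.circleAverage (fun ζ : ℂ => u (z + ζ • v)) 0 1 = u z := by
  have := InnerProductSpace.HarmonicOnNhd.circleAverage_eq (f := fun ζ : ℂ => u (z + ζ • v))
    (c := 0) (R := 1) ?_
  · simpa using this
  · intro ζ hζ
    refine hu.harmonicAt_line hΩ (hr ?_)
    rw [mem_closedBall, dist_eq_norm, add_sub_cancel_left, norm_smul]
    have hζ1 : ‖ζ‖ ≤ 1 := by simpa using hζ
    nlinarith [norm_nonneg v, norm_nonneg ζ]

/-- The circle mean value property on `Ω`. -/
def MeanValueOn (u : EuclideanSpace ℂ (Fin n) → ℝ) (Ω : Set (EuclideanSpace ℂ (Fin n))) : Prop :=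
  ContinuousOn u Ω ∧ ∀ z v : EuclideanSpace ℂ (Fin n), closedBall z ‖v‖ ⊆ Ω →
    Real.circleAverage (fun ζ : ℂ => u (z + ζ • v)) 0 1 = u z

theorem PluriharmonicOn.meanValueOn {u : EuclideanSpace ℂ (Fin n) → ℝ}
    {Ω : Set (EuclideanSpace ℂ (Fin n))} (hu : PluriharmonicOn u Ω) (hΩ : IsOpen Ω) :
    MeanValueOn u Ω :=
  ⟨hu.continuousOn, fun _ _ h => hu.circleAverage_eq hΩ h le_rfl⟩

/-- Multiplication by `e^{iθ}` as a real linear isometry. -/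
noncomputable def rotation (n : ℕ) (θ : ℝ) :
    EuclideanSpace ℂ (Fin n) ≃ₗᵢ[ℝ] EuclideanSpace ℂ (Fin n) where
  toLinearEquiv := (LinearEquiv.smulOfUnit (Units.mk0 (Complex.exp (θ * Complex.I))
    (Complex.exp_ne_zero _)) : _ ≃ₗ[ℂ] EuclideanSpace ℂ (Fin n)).restrictScalars ℝ
  norm_map' x := by
    change ‖Complex.exp (θ * Complex.I) • x‖ = ‖x‖
    rw [norm_smul, Complex.norm_exp_ofReal_mul_I, one_mul]

theorem rotation_apply (θ : ℝ) (x : EuclideanSpace ℂ (Fin n)) :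
    rotation n θ x = circleMap 0 1 θ • x := by
  change Complex.exp (θ * Complex.I) • x = _
  simp [circleMap]

/-- A function with the circle mean value property is reproduced by the averages with a kernel
that is invariant under rotations. -/
theorem MeanValueOn.integral_kernel {u : EuclideanSpace ℂ (Fin n) → ℝ}
    {Ω : Set (EuclideanSpace ℂ (Fin n))} (hu : MeanValueOn u Ω)
    {z : EuclideanSpace ℂ (Fin n)} {r : ℝ} (hr : closedBall z r ⊆ Ω)
    {κ : EuclideanSpace ℂ (Fin n) → ℝ} (hκ : Integrable κ)
    (hκ0 : ∀ y, y ∉ closedBall (0 : EuclideanSpace ℂ (Fin n)) r → κ y = 0)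
    (hκr : ∀ θ y, κ (rotation n θ y) = κ y) :
    ∫ y, κ y * u (z + y) = u z * ∫ y, κ y := by
  set B := closedBall (0 : EuclideanSpace ℂ (Fin n)) r with hB
  set g : EuclideanSpace ℂ (Fin n) → ℝ := B.indicator fun y => u (z + y) with hg
  have hzB : ∀ y ∈ B, z + y ∈ closedBall z r := by
    intro y hy; simpa [hB, dist_eq_norm] using hy
  have hcont : ContinuousOn (fun y => u (z + y)) B :=
    hu.1.comp (by fun_prop) fun y hy => hr (hzB y hy)
  have hBm : MeasurableSet B := isClosed_closedBall.measurableSet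
  have hgm : Measurable g := by
    classical
    rw [hg, ← piecewise_eq_indicator]
    exact hcont.measurable_piecewise continuousOn_const hBm
  obtain ⟨C, hC⟩ : ∃ C, ∀ y, ‖g y‖ ≤ C := by
    obtain ⟨C, hC⟩ := (isCompact_closedBall (0 : EuclideanSpace ℂ (Fin n)) r).exists_bound_of_continuousOn hcont
    refine ⟨max C 0, fun y => ?_⟩
    by_cases hy : y ∈ B
    · rw [hg, indicator_of_mem hy]; exact (hC y hy).trans (le_max_left _ _)
    · rw [hg, indicator_of_notMem hy]; simp
  have h1 : ∀ y, κ y * u (z + y) = κ y * g y := by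
    intro y
    by_cases hy : y ∈ B
    · rw [hg, indicator_of_mem hy]
    · rw [hκ0 y hy]; simp
  -- The rotation by `θ` preserves both volume and `κ`, so the integral may be averaged over `θ`;
  -- after Fubini the inner integral is a circle average of `u`.
  have h2 : ∀ θ : ℝ, ∫ y, κ y * g y = ∫ y, κ y * g (circleMap 0 1 θ • y) := by
    intro θ
    have := (rotation n θ).measurePreserving.integral_comp
      (rotation n θ).toHomeomorph.measurableEmbedding (fun y => κ y * g y)
    rw [← this]
    refine integral_congr_ae (Eventually.of_forall fun y => ?_)
    simp only [hκr]
    rw [rotation_apply]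
  have h3 : ∀ y, κ y * ∫ θ in (0:ℝ)..2 * Real.pi, g (circleMap 0 1 θ • y)
      = (2 * Real.pi) * (κ y * u z) := by
    intro y
    by_cases hy : y ∈ B
    · have hyr : ‖y‖ ≤ r := by simpa [hB] using hy
      have := hu.2 z y ((closedBall_subset_closedBall hyr).trans hr)
      rw [Real.circleAverage_def] at this
      have hgg : ∀ θ : ℝ, g (circleMap 0 1 θ • y) = u (z + circleMap 0 1 θ • y) := by
        intro θ
        rw [hg, indicator_of_mem]
        rw [← rotation_apply, hB, mem_closedBall_zero_iff, LinearIsometryEquiv.norm_map]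
        exact hyr
      simp only [hgg]
      rw [← this, smul_eq_mul]
      field_simp
    · rw [hκ0 y hy]; simp
  have hint : Integrable (fun p : ℝ × EuclideanSpace ℂ (Fin n) => κ p.2 * g (circleMap 0 1 p.1 • p.2))
      ((volume.restrict (uIoc 0 (2 * Real.pi))).prod volume) := by
    have hfin : IsFiniteMeasure (volume.restrict (uIoc 0 (2 * Real.pi))) :=
      ⟨by simp [uIoc]⟩
    have ha : Integrable (fun p : ℝ × EuclideanSpace ℂ (Fin n) => κ p.2)
        ((volume.restrict (uIoc 0 (2 * Real.pi))).prod volume) := by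
      have := (integrable_const (1 : ℝ) (μ := volume.restrict (uIoc 0 (2 * Real.pi)))).mul_prod hκ
      simpa using this
    refine ha.mul_bdd (c := C) ?_ (Eventually.of_forall fun p => hC _)
    refine (hgm.comp ?_).aestronglyMeasurable
    have : Continuous fun p : ℝ × EuclideanSpace ℂ (Fin n) => circleMap 0 1 p.1 • p.2 :=
      ((continuous_circleMap 0 1).comp continuous_fst).smul continuous_snd
    exact this.measurable
  simp only [h1]
  have h4 : ∫ θ in (0:ℝ)..2 * Real.pi, ∫ y, κ y * g (circleMap 0 1 θ • y)
      = ∫ y, ∫ θ in (0:ℝ)..2 * Real.pi, κ y * g (circleMap 0 1 θ • y) :=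
    intervalIntegral_integral_swap hint
  simp only [← h2, intervalIntegral.integral_const, intervalIntegral.integral_const_mul, h3,
    integral_const_mul, integral_mul_const, smul_eq_mul, sub_zero] at h4
  have hpi : (2 * Real.pi) ≠ 0 := by positivity
  have := mul_left_cancel₀ hpi h4
  rw [this, mul_comm]

end Pluriharmonic

end LumerHardy

namespace LumerHardy

open Filter Topology Metric

/-! ### Harnack's inequality and smoothness from mean values -/

section Harnack

variable {n : ℕ} {Ω : Set (EuclideanSpace ℂ (Fin n))} {u : EuclideanSpace ℂ (Fin n) → ℝ}

theorem MeanValueOn.setIntegral_closedBall (hu : MeanValueOn u Ω)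
    {z : EuclideanSpace ℂ (Fin n)} {r : ℝ} (hr : closedBall z r ⊆ Ω) :
    ∫ y in closedBall z r, u y
      = u z * volume.real (closedBall (0 : EuclideanSpace ℂ (Fin n)) r) := by
  have hm : MeasurableSet (closedBall (0 : EuclideanSpace ℂ (Fin n)) r) :=
    isClosed_closedBall.measurableSet
  have h := hu.integral_kernel hr
    (κ := (closedBall (0 : EuclideanSpace ℂ (Fin n)) r).indicator fun _ => 1) ?_ ?_ ?_
  · rw [integral_indicator hm, setIntegral_const, smul_eq_mul, mul_one] at h
    rw [← h, ← integral_indicator isClosed_closedBall.measurableSet,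
      ← integral_add_left_eq_self _ z]
    refine integral_congr_ae (Eventually.of_forall fun y => ?_)
    by_cases hy : ‖y‖ ≤ r
    · simp [indicator, hy]
    · simp [indicator, hy]
  · rw [integrable_indicator_iff hm]
    exact integrableOn_const (isCompact_closedBall _ _).measure_lt_top.ne
  · intro y hy; exact indicator_of_notMem hy _
  · intro θ y
    simp [indicator]

theorem measureReal_closedBall_pos {r : ℝ} (hr : 0 < r) :
    0 < volume.real (closedBall (0 : EuclideanSpace ℂ (Fin n)) r) :=
  ENNReal.toReal_pos (measure_closedBall_pos _ _ hr).ne'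
    (isCompact_closedBall _ _).measure_lt_top.ne

/-- The ball of radius `r` about `w` lies in the ball of radius `2r` about `z`. For a nonnegative
function the integrals compare, and the constant is the ratio of the volumes. -/
theorem MeanValueOn.le_two_pow_mul (hu : MeanValueOn u Ω) (h0 : ∀ z ∈ Ω, 0 ≤ u z)
    {z w : EuclideanSpace ℂ (Fin n)} {r : ℝ} (hr0 : 0 < r) (hr : closedBall z (2 * r) ⊆ Ω)
    (hw : dist w z ≤ r) :
    u w ≤ 2 ^ Module.finrank ℝ (EuclideanSpace ℂ (Fin n)) * u z := by
  have hsub : closedBall w r ⊆ closedBall z (2 * r) :=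
    closedBall_subset_closedBall' (by linarith)
  have h1 := hu.setIntegral_closedBall (hsub.trans hr)
  have h2 := hu.setIntegral_closedBall hr
  have hint : IntegrableOn u (closedBall z (2 * r)) :=
    (hu.1.mono hr).integrableOn_compact (isCompact_closedBall _ _)
  have h3 : ∫ y in closedBall w r, u y ≤ ∫ y in closedBall z (2 * r), u y := by
    refine setIntegral_mono_set hint ?_ hsub.eventuallyLE
    exact (ae_restrict_mem isClosed_closedBall.measurableSet).mono fun y hy => h0 y (hr hy)
  have h4 : volume.real (closedBall (0 : EuclideanSpace ℂ (Fin n)) (2 * r))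
      = 2 ^ Module.finrank ℝ (EuclideanSpace ℂ (Fin n))
        * volume.real (closedBall (0 : EuclideanSpace ℂ (Fin n)) r) := by
    rw [Measure.real, Measure.real, Measure.addHaar_closedBall_mul _ _ (by norm_num) hr0.le,
      ENNReal.toReal_mul, ENNReal.toReal_ofReal (by positivity)]
  rw [h1, h2, h4] at h3
  have hp := measureReal_closedBall_pos (n := n) hr0
  refine le_of_mul_le_mul_right ?_ hp
  linarith

/-- Harnack's inequality on a connected open set. -/
theorem exists_harnack_pair (hΩ : IsOpen Ω) (hc : IsPreconnected Ω)
    {x y : EuclideanSpace ℂ (Fin n)} (hx : x ∈ Ω) (hy : y ∈ Ω) :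
    ∃ C > 0, ∀ u : EuclideanSpace ℂ (Fin n) → ℝ, MeanValueOn u Ω → (∀ z ∈ Ω, 0 ≤ u z) →
      u x ≤ C * u y ∧ u y ≤ C * u x := by
  refine hc.induction₂ (fun x y => ∃ C > 0, ∀ u : EuclideanSpace ℂ (Fin n) → ℝ, MeanValueOn u Ω →
    (∀ z ∈ Ω, 0 ≤ u z) → u x ≤ C * u y ∧ u y ≤ C * u x) ?_ ?_ ?_ hx hy
  · intro x hx
    obtain ⟨r, hr0, hr⟩ := Metric.isOpen_iff.1 hΩ x hx
    refine mem_nhdsWithin_of_mem_nhds ?_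
    filter_upwards [ball_mem_nhds x (show 0 < r / 4 by positivity)] with y hy
    rw [mem_ball] at hy
    refine ⟨_, show (0 : ℝ) < 2 ^ Module.finrank ℝ (EuclideanSpace ℂ (Fin n)) by positivity,
      fun u hu h0 => ⟨?_, ?_⟩⟩
    · refine hu.le_two_pow_mul h0 (r := r / 4) (by positivity) ?_ (by rw [dist_comm]; exact hy.le)
      exact (closedBall_subset_ball' (by linarith)).trans hr
    · refine hu.le_two_pow_mul h0 (r := r / 4) (by positivity) ?_ hy.le
      exact (closedBall_subset_ball (by linarith)).trans hr
  · rintro x y z - - - ⟨C, hC0, hC⟩ ⟨D, hD0, hD⟩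
    refine ⟨C * D, by positivity, fun u hu h0 => ⟨?_, ?_⟩⟩
    · have h1 := (hC u hu h0).1
      have h2 := (hD u hu h0).1
      nlinarith
    · have h1 := (hC u hu h0).2
      have h2 := (hD u hu h0).2
      nlinarith
  · rintro x y - - ⟨C, hC0, hC⟩
    exact ⟨C, hC0, fun u hu h0 => (hC u hu h0).symm⟩

/-- Finitely many small balls cover `K`. On each ball the local inequality compares with the centre,
and a chain in the connected set compares the centre with `P`. -/
theorem exists_harnack (hΩ : IsOpen Ω) (hc : IsPreconnected Ω)
    {K : Set (EuclideanSpace ℂ (Fin n))} (hK : IsCompact K) (hKΩ : K ⊆ Ω)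
    {P : EuclideanSpace ℂ (Fin n)} (hP : P ∈ Ω) :
    ∃ C > 0, ∀ u : EuclideanSpace ℂ (Fin n) → ℝ, MeanValueOn u Ω → (∀ z ∈ Ω, 0 ≤ u z) →
      ∀ z ∈ K, u z ≤ C * u P := by
  refine hK.induction_on (p := fun S => ∃ C > 0, ∀ u : EuclideanSpace ℂ (Fin n) → ℝ,
    MeanValueOn u Ω → (∀ z ∈ Ω, 0 ≤ u z) → ∀ z ∈ S, u z ≤ C * u P) ?_ ?_ ?_ ?_
  · exact ⟨1, one_pos, by simp⟩
  · rintro S T hST ⟨C, hC0, hC⟩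
    exact ⟨C, hC0, fun u hu h0 z hz => hC u hu h0 z (hST hz)⟩
  · rintro S T ⟨C, hC0, hC⟩ ⟨D, hD0, hD⟩
    refine ⟨C + D, by positivity, fun u hu h0 z hz => ?_⟩
    have hp := h0 P hP
    rcases hz with hz | hz
    · nlinarith [hC u hu h0 z hz]
    · nlinarith [hD u hu h0 z hz]
  · intro x hx
    obtain ⟨r, hr0, hr⟩ := Metric.isOpen_iff.1 hΩ x (hKΩ hx)
    obtain ⟨C, hC0, hC⟩ := exists_harnack_pair hΩ hc (hKΩ hx) hP
    refine ⟨ball x (r / 4), mem_nhdsWithin_of_mem_nhds (ball_mem_nhds x (by positivity)),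
      2 ^ Module.finrank ℝ (EuclideanSpace ℂ (Fin n)) * C, by positivity, fun u hu h0 z hz => ?_⟩
    have h1 := hu.le_two_pow_mul h0 (z := x) (w := z) (r := r / 4) (by positivity)
      ((closedBall_subset_ball (by linarith)).trans hr) (mem_ball.1 hz).le
    refine h1.trans ?_
    rw [mul_assoc]
    exact mul_le_mul_of_nonneg_left (hC u hu h0).1 (by positivity)

/-- Functions with the circle mean value property are smooth. -/
theorem MeanValueOn.contDiffOn (hΩ : IsOpen Ω) (hu : MeanValueOn u Ω) : ContDiffOn ℝ 2 u Ω := by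
  intro z₀ hz₀
  obtain ⟨R, hR0, hR⟩ := Metric.isOpen_iff.1 hΩ z₀ hz₀
  set r := R / 3 with hr
  have hr0 : 0 < r := by positivity
  have hK : closedBall z₀ (2 * r) ⊆ Ω := (closedBall_subset_ball (by linarith)).trans hR
  -- A smooth radial bump: being invariant under rotations it reproduces `u`, so near `z₀` the
  -- function `u` is a multiple of its convolution with a smooth kernel.
  set κ : EuclideanSpace ℂ (Fin n) → ℝ := fun y => Real.smoothTransition (r ^ 2 - ‖y‖ ^ 2) with hκ
  have hκs : ContDiff ℝ 2 κ :=
    Real.smoothTransition.contDiff.comp (contDiff_const.sub (contDiff_norm_sq ℝ))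
  have hκ0 : ∀ y, y ∉ closedBall (0 : EuclideanSpace ℂ (Fin n)) r → κ y = 0 := by
    intro y hy
    refine Real.smoothTransition.zero_of_nonpos ?_
    have : r < ‖y‖ := by simpa using hy
    nlinarith
  have hκc : HasCompactSupport κ :=
    HasCompactSupport.of_support_subset_isCompact (isCompact_closedBall 0 r) fun y hy => by
      by_contra h; exact hy (hκ0 y h)
  have hκi : Integrable κ := hκs.continuous.integrable_of_hasCompactSupport hκc
  have hκr : ∀ θ y, κ (rotation n θ y) = κ y := by
    intro θ y; simp [hκ]
  have hκn : ∀ y, κ (-y) = κ y := by intro y; simp [hκ]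
  have hκp : 0 < ∫ y, κ y := by
    refine hκs.continuous.integral_pos_of_hasCompactSupport_nonneg_nonzero hκc
      (fun y => Real.smoothTransition.nonneg _) (x := 0) ?_
    refine (Real.smoothTransition.pos_of_pos ?_).ne'
    simp; positivity
  set g := (closedBall z₀ (2 * r)).indicator u with hg
  have hgi : Integrable g := by
    rw [hg, integrable_indicator_iff isClosed_closedBall.measurableSet]
    exact (hu.1.mono hK).integrableOn_compact (isCompact_closedBall _ _)
  have hsm : ContDiff ℝ 2 (convolution κ g (ContinuousLinearMap.lsmul ℝ ℝ) volume) :=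
    hκc.contDiff_convolution_left (n := 2) _ hκs hgi.locallyIntegrable
  have heq : ∀ z ∈ ball z₀ r, u z
      = (∫ y, κ y)⁻¹ * convolution κ g (ContinuousLinearMap.lsmul ℝ ℝ) volume z := by
    intro z hz
    rw [mem_ball] at hz
    have h1 := hu.integral_kernel (z := z) (r := r)
      ((closedBall_subset_closedBall' (by linarith)).trans hK) hκi hκ0 hκr
    have h2 : convolution κ g (ContinuousLinearMap.lsmul ℝ ℝ) volume z
        = ∫ y, κ y * u (z + y) := by
      rw [convolution, ← integral_neg_eq_self]
      refine integral_congr_ae (Eventually.of_forall fun y => ?_)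
      simp only [hκn, ContinuousLinearMap.lsmul_apply, smul_eq_mul, sub_neg_eq_add]
      by_cases hy : y ∈ closedBall (0 : EuclideanSpace ℂ (Fin n)) r
      · rw [hg, indicator_of_mem]
        rw [mem_closedBall_zero_iff] at hy
        rw [mem_closedBall, dist_eq_norm] at *
        calc ‖z + y - z₀‖ = ‖(z - z₀) + y‖ := by congr 1; abel
          _ ≤ ‖z - z₀‖ + ‖y‖ := norm_add_le _ _
          _ ≤ 2 * r := by linarith
      · rw [hκ0 y hy]; simp
    rw [h2, h1]
    field_simp
  have : ContDiffAt ℝ 2 u z₀ := by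
    refine ContDiffAt.congr_of_eventuallyEq (f := fun z => (∫ y, κ y)⁻¹
      * convolution κ g (ContinuousLinearMap.lsmul ℝ ℝ) volume z)
      (contDiff_const.mul hsm).contDiffAt ?_
    filter_upwards [ball_mem_nhds z₀ hr0] with z hz using heq z hz
  exact this.contDiffWithinAt

end Harnack

/-! ### Sums of positive pluriharmonic and of holomorphic functions -/

section Sums

/-- Each `v k` is the real part of a holomorphic function whose value at `0` can be made real.
Positivity and Borel–Carathéodory bound that function on a smaller disc by its value at `0`, so
summability at one point makes the holomorphic series converge uniformly. -/
theorem harmonicAt_tsum {v : ℕ → ℂ → ℝ} {R : ℝ} (hR : 0 < R)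
    (hv : ∀ k, InnerProductSpace.HarmonicOnNhd (v k) (ball 0 R))
    (h0 : ∀ k, ∀ ζ ∈ ball (0 : ℂ) R, 0 ≤ v k ζ) (hs : Summable fun k => v k 0) :
    InnerProductSpace.HarmonicAt (fun ζ => ∑' k, v k ζ) 0 := by
  choose F hF hFv using fun k => (hv k).exists_analyticOnNhd_ball_re_eq
  set G : ℕ → ℂ → ℂ := fun k ζ => F k ζ - Complex.I * (F k 0).im with hG
  have hGd : ∀ k, DifferentiableOn ℂ (G k) (ball 0 R) := fun k =>
    ((hF k).differentiableOn).sub_const _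
  have hGre : ∀ k, ∀ ζ ∈ ball (0 : ℂ) R, (G k ζ).re = v k ζ := by
    intro k ζ hζ
    simpa [hG] using hFv k hζ
  have hG0 : ∀ k, G k 0 = v k 0 := by
    intro k
    apply Complex.ext
    · simpa using hGre k 0 (mem_ball_self hR)
    · simp [hG]
  have hb : ∀ k, ∀ ζ ∈ ball (0 : ℂ) (R / 2), ‖G k ζ‖ ≤ 2 * (1 / 2) ^ k + 3 * v k 0 := by
    intro k ζ hζ
    have hζ' : ‖ζ‖ < R / 2 := by simpa using hζ
    have hv0 := h0 k 0 (mem_ball_self hR)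
    -- The real part of `-G k` is at most `0`, so any positive bound will do; `(1 / 2) ^ k` is
    -- positive and summable. The factors `2` and `3` come from `‖ζ‖ < R / 2`.
    have h := Complex.borelCaratheodory (f := fun ζ => -G k ζ) (M := (1 / 2) ^ k) (R := R) (z := ζ)
      (by positivity) (hGd k).neg ?_ hR (ball_subset_ball (by linarith) hζ)
    · simp only [norm_neg, hG0, Complex.norm_real, Real.norm_of_nonneg hv0] at h
      refine h.trans (add_le_add ?_ ?_)
      · rw [div_le_iff₀ (by linarith), mul_assoc, mul_assoc]
        gcongr
        linarith
      · rw [div_le_iff₀ (by linarith)]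
        nlinarith
    · intro ξ hξ
      have := h0 k ξ hξ
      simp only [mem_ofPred_eq, Complex.neg_re, hGre k ξ hξ]
      have : (0 : ℝ) < (1 / 2) ^ k := by positivity
      linarith
  have hsum : Summable fun k => 2 * (1 / 2 : ℝ) ^ k + 3 * v k 0 :=
    (summable_geometric_two.mul_left 2).add (hs.mul_left 3)
  have hR2 : 0 < R / 2 := by positivity
  have hd : DifferentiableOn ℂ (fun ζ => ∑' k, G k ζ) (ball 0 (R / 2)) :=
    Complex.differentiableOn_tsum_of_summable_norm hsum
      (fun k => (hGd k).mono (ball_subset_ball (by linarith))) isOpen_ball hb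
  have han : AnalyticAt ℂ (fun ζ => ∑' k, G k ζ) 0 := hd.analyticAt (ball_mem_nhds 0 hR2)
  refine (InnerProductSpace.harmonicAt_congr_nhds ?_).1 han.harmonicAt_re
  filter_upwards [ball_mem_nhds 0 hR2] with ζ hζ
  have hsG : Summable fun k => G k ζ := Summable.of_norm_bounded hsum fun k => hb k ζ hζ
  rw [Complex.re_tsum hsG]
  exact tsum_congr fun k => hGre k ζ (ball_subset_ball (by linarith) hζ)

variable {n : ℕ} {Ω : Set (EuclideanSpace ℂ (Fin n))}

theorem meanValueOn_tsum (hΩ : IsOpen Ω) {u : ℕ → EuclideanSpace ℂ (Fin n) → ℝ}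
    (hu : ∀ k, MeanValueOn (u k) Ω) {b : ℕ → ℝ} (hb : Summable b)
    (hK : ∀ K ⊆ Ω, IsCompact K → ∃ C : ℝ, ∀ k, ∀ z ∈ K, |u k z| ≤ C * b k) :
    MeanValueOn (fun z => ∑' k, u k z) Ω := by
  constructor
  · intro z hz
    obtain ⟨K, hKn, hKΩ, hKc⟩ := local_compact_nhds (hΩ.mem_nhds hz)
    obtain ⟨C, hC⟩ := hK K hKΩ hKc
    have h := continuousOn_tsum (fun k => (hu k).1.mono hKΩ) (hb.mul_left C)
      fun k z hz => hC k z hz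
    exact (h.continuousAt hKn).continuousWithinAt
  · intro z v hzv
    obtain ⟨C, hC⟩ := hK _ hzv (isCompact_closedBall z ‖v‖)
    have hmem : ∀ θ : ℝ, z + circleMap 0 1 θ • v ∈ closedBall z ‖v‖ := by
      intro θ; simp [norm_smul]
    have hcont : ∀ k, Continuous fun θ : ℝ => u k (z + circleMap 0 1 θ • v) := by
      intro k
      refine ((hu k).1.mono hzv).comp_continuous ?_ hmem
      exact continuous_const.add ((continuous_circleMap 0 1).smul continuous_const)
    have hs := intervalIntegral.hasSum_intervalIntegral_of_summable_norm (a := 0) (b := 2 * Real.pi)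
      (f := fun k => (⟨_, hcont k⟩ : C(ℝ, ℝ))) ?_
    · have h2 : ∀ k, ∫ θ in (0:ℝ)..2 * Real.pi, u k (z + circleMap 0 1 θ • v)
          = (2 * Real.pi) * u k z := by
        intro k
        rw [← (hu k).2 z v hzv, Real.circleAverage_def, smul_eq_mul]
        field_simp
      simp only [ContinuousMap.coe_mk, h2] at hs
      have h3 := hs.tsum_eq
      rw [Real.circleAverage_def, ← h3, tsum_mul_left, smul_eq_mul]
      field_simp
    · refine Summable.of_nonneg_of_le (fun k => norm_nonneg _) (fun k => ?_) (hb.mul_left C)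
      have hCb : 0 ≤ C * b k := (abs_nonneg _).trans (hC k z (mem_closedBall_self (norm_nonneg _)))
      rw [ContinuousMap.norm_le _ hCb]
      intro θ
      exact hC k _ (hmem _)

/-- Harnack's inequality spreads summability at `P` to uniform summability on compact sets. The sum
keeps the circle mean value property, hence is `C²`; its harmonicity on complex lines is the
one-variable statement. -/
theorem pluriharmonicOn_tsum (hΩ : IsOpen Ω) (hc : IsPreconnected Ω)
    {P : EuclideanSpace ℂ (Fin n)} (hP : P ∈ Ω)
    {u : ℕ → EuclideanSpace ℂ (Fin n) → ℝ} (hu : ∀ k, PluriharmonicOn (u k) Ω)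
    (h0 : ∀ k, ∀ z ∈ Ω, 0 ≤ u k z) (hs : Summable fun k => u k P) :
    (∀ z ∈ Ω, Summable fun k => u k z) ∧ PluriharmonicOn (fun z => ∑' k, u k z) Ω := by
  have hH : ∀ K ⊆ Ω, IsCompact K → ∃ C : ℝ, ∀ k, ∀ z ∈ K, |u k z| ≤ C * u k P := by
    intro K hK hKc
    obtain ⟨C, -, hC⟩ := exists_harnack hΩ hc hKc hK hP
    refine ⟨C, fun k z hz => ?_⟩
    rw [abs_of_nonneg (h0 k z (hK hz))]
    exact hC _ ((hu k).meanValueOn hΩ) (h0 k) z hz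
  have hsum : ∀ z ∈ Ω, Summable fun k => u k z := by
    intro z hz
    obtain ⟨C, hC⟩ := hH {z} (by simpa using hz) isCompact_singleton
    exact Summable.of_norm_bounded (hs.mul_left C) fun k => hC k z rfl
  refine ⟨hsum, ?_, ?_⟩
  · exact (meanValueOn_tsum hΩ (fun k => (hu k).meanValueOn hΩ) hs hH).contDiffOn hΩ
  · intro z hz v
    have hopen : IsOpen {ζ : ℂ | z + ζ • v ∈ Ω} := hΩ.preimage (continuous_line z v)
    obtain ⟨R, hR0, hR⟩ := Metric.isOpen_iff.1 hopen 0 (by simpa using hz)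
    refine harmonicAt_tsum (v := fun k ζ => u k (z + ζ • v)) hR0 ?_ ?_ ?_
    · intro k ζ hζ
      exact (hu k).harmonicAt_line hΩ (hR hζ)
    · intro k ζ hζ
      exact h0 k _ (hR hζ)
    · simpa using hsum z hz

/-- Weierstrass' theorem in several variables: the Cauchy estimate on balls of half the radius makes
the series of derivatives summable too. -/
theorem differentiableOn_tsum_of_locally_bounded (hΩ : IsOpen Ω)
    {g : ℕ → EuclideanSpace ℂ (Fin n) → ℂ}
    (hg : ∀ k, DifferentiableOn ℂ (g k) Ω)
    (hb : ∀ z ∈ Ω, ∃ r > 0, ball z r ⊆ Ω ∧ ∃ b : ℕ → ℝ, Summable b ∧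
      ∀ k, ∀ w ∈ ball z r, ‖g k w‖ ≤ b k) :
    DifferentiableOn ℂ (fun z => ∑' k, g k z) Ω := by
  intro z hz
  obtain ⟨r, hr0, hr, b, hbs, hb⟩ := hb z hz
  have hb0 : ∀ k, 0 ≤ b k := fun k => (norm_nonneg _).trans (hb k z (mem_ball_self hr0))
  have hd : ∀ k, ∀ w ∈ ball z r, HasFDerivAt (g k) (fderiv ℂ (g k) w) w := fun k w hw =>
    ((hg k).differentiableAt (hΩ.mem_nhds (hr hw))).hasFDerivAt
  have hr2 : 0 < r / 2 := by positivity
  refine (hasFDerivAt_tsum_of_isPreconnected (u := fun k => (3 * (b k + (1 / 2) ^ k)) / (r / 2))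
    (f' := fun k w => fderiv ℂ (g k) w) (s := ball z (r / 2)) (x₀ := z)
    ?_ isOpen_ball (convex_ball _ _).isPreconnected
    ?_ ?_ (mem_ball_self hr2) ?_ (mem_ball_self hr2)).differentiableAt.differentiableWithinAt
  · exact ((hbs.add summable_geometric_two).mul_left 3).div_const _
  · exact fun k w hw => hd k w (ball_subset_ball (by linarith) hw)
  · intro k w hw
    have hsub : ball w (r / 2) ⊆ ball z r := ball_subset_ball' (by rw [mem_ball] at hw; linarith)
    refine Complex.norm_fderiv_le_div_of_mapsTo_ball ((hg k).mono (hsub.trans hr)) ?_ hr2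
    intro x hx
    have h1 := hb k x (hsub hx)
    have h2 := hb k w (hsub (mem_ball_self hr2))
    have h3 : (0 : ℝ) < (1 / 2) ^ k := by positivity
    rw [mem_closedBall, dist_eq_norm]
    have := norm_sub_le (g k x) (g k w)
    have := hb0 k
    linarith
  · exact Summable.of_norm_bounded hbs fun k => hb k z (mem_ball_self hr0)

end Sums

end LumerHardy

/-! ### The Lumer norm and its completeness -/

namespace LumerHardy

open Filter Topology Metric

variable {n : ℕ} {Ω : Set (EuclideanSpace ℂ (Fin n))} {P₀ : Ω}

theorem IsMajorant.nonneg {f : Ω → ℂ} {u : EuclideanSpace ℂ (Fin n) → ℝ} (h : IsMajorant f u) :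
    ∀ z ∈ Ω, 0 ≤ u z :=
  fun z hz => (sq_nonneg _).trans (h.2 ⟨z, hz⟩)

/-- An element of `𝓛H²(Ω)` from a function. -/
def LumerSpace.mk (P₀ : Ω) (f : Ω → ℂ) (hf : f ∈ lumerHardy Ω) : LumerSpace Ω P₀ :=
  (⟨f, hf⟩ : lumerHardy Ω)

namespace LumerSpace

@[simp] theorem toFun_mk (f : Ω → ℂ) (hf : f ∈ lumerHardy Ω) : (mk P₀ f hf).toFun = f := rfl

theorem toFun_mem (f : LumerSpace Ω P₀) : f.toFun ∈ lumerHardy Ω :=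
  Subtype.property (p := fun g => g ∈ lumerHardy Ω) f

theorem ext {f g : LumerSpace Ω P₀} (h : f.toFun = g.toFun) : f = g :=
  Subtype.ext (p := fun g => g ∈ lumerHardy Ω) h

@[simp] theorem toFun_zero : (0 : LumerSpace Ω P₀).toFun = 0 := rfl

@[simp] theorem toFun_add (f g : LumerSpace Ω P₀) : (f + g).toFun = f.toFun + g.toFun := rfl

@[simp] theorem toFun_sub (f g : LumerSpace Ω P₀) : (f - g).toFun = f.toFun - g.toFun := rfl

@[simp] theorem toFun_smul (c : ℂ) (f : LumerSpace Ω P₀) : (c • f).toFun = c • f.toFun := rfl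

@[simp] theorem toFun_sum {ι : Type*} (s : Finset ι) (f : ι → LumerSpace Ω P₀) :
    (∑ i ∈ s, f i).toFun = ∑ i ∈ s, (f i).toFun :=
  map_sum (⟨⟨toFun, toFun_zero⟩, toFun_add⟩ : LumerSpace Ω P₀ →+ (Ω → ℂ)) f s

theorem norm_def (f : LumerSpace Ω P₀) :
    ‖f‖ = sInf {r : ℝ | ∃ u, IsMajorant f.toFun u ∧ r = √(u P₀)} := rfl

theorem norm_nonneg' (f : LumerSpace Ω P₀) : 0 ≤ ‖f‖ := by
  refine Real.sInf_nonneg ?_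
  rintro r ⟨u, -, rfl⟩
  exact Real.sqrt_nonneg _

theorem norm_le_of_majorant {f : LumerSpace Ω P₀} {u : EuclideanSpace ℂ (Fin n) → ℝ}
    (hu : IsMajorant f.toFun u) : ‖f‖ ≤ √(u P₀) := by
  refine csInf_le ⟨0, ?_⟩ ⟨u, hu, rfl⟩
  rintro r ⟨u, -, rfl⟩
  exact Real.sqrt_nonneg _

theorem exists_majorant_lt {f : LumerSpace Ω P₀} {r : ℝ} (hr : ‖f‖ < r) :
    ∃ u, IsMajorant f.toFun u ∧ √(u P₀) < r := by
  obtain ⟨u, hu⟩ := f.toFun_mem.2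
  rw [norm_def] at hr
  obtain ⟨s, ⟨v, hv, rfl⟩, hs⟩ := exists_lt_of_csInf_lt
    (s := {r : ℝ | ∃ u, IsMajorant f.toFun u ∧ r = √(u P₀)}) ⟨_, u, hu, rfl⟩ hr
  exact ⟨v, hv, hs⟩

theorem exists_majorant_le_sq {f : LumerSpace Ω P₀} {r : ℝ} (hr : ‖f‖ < r) :
    ∃ u, IsMajorant f.toFun u ∧ u P₀ ≤ r ^ 2 := by
  obtain ⟨u, hu, h⟩ := exists_majorant_lt hr
  refine ⟨u, hu, ?_⟩
  have h0 := hu.nonneg P₀ P₀.2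
  rw [← Real.sq_sqrt h0]
  exact pow_le_pow_left₀ (Real.sqrt_nonneg _) h.le 2

theorem norm_le_of_majorant_sq {f : LumerSpace Ω P₀} {u : EuclideanSpace ℂ (Fin n) → ℝ}
    (hu : IsMajorant f.toFun u) {r : ℝ} (hr : 0 ≤ r) (h : u P₀ ≤ r ^ 2) : ‖f‖ ≤ r :=
  (norm_le_of_majorant hu).trans (Real.sqrt_le_iff.2 ⟨hr, h⟩)

theorem norm_smul_le' (c : ℂ) (f : LumerSpace Ω P₀) : ‖c • f‖ ≤ ‖c‖ * ‖f‖ := by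
  refine le_of_forall_pos_le_add fun ε hε => ?_
  obtain ⟨u, hu, h⟩ := exists_majorant_le_sq
    (show ‖f‖ < ‖f‖ + ε / (‖c‖ + 1) by have : 0 < ε / (‖c‖ + 1) := by positivity
                                       linarith)
  have hf := norm_nonneg' f
  have hm : IsMajorant (c • f).toFun ((‖c‖ ^ 2 : ℝ) • u) := by
    refine ⟨hu.1.const_smul _, fun z => ?_⟩
    simp only [toFun_smul, Pi.smul_apply, smul_eq_mul, norm_mul, mul_pow]
    exact mul_le_mul_of_nonneg_left (hu.2 z) (by positivity)
  have h1 : ‖c • f‖ ≤ ‖c‖ * (‖f‖ + ε / (‖c‖ + 1)) := by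
    refine norm_le_of_majorant_sq hm (by positivity) ?_
    rw [Pi.smul_apply, smul_eq_mul, mul_pow]
    gcongr
  have h2 : ‖c‖ * (ε / (‖c‖ + 1)) ≤ ε := by
    rw [mul_div_assoc', div_le_iff₀ (by positivity)]
    nlinarith [norm_nonneg c]
  linarith

theorem norm_smul' (c : ℂ) (f : LumerSpace Ω P₀) : ‖c • f‖ = ‖c‖ * ‖f‖ := by
  refine le_antisymm (norm_smul_le' c f) ?_
  rcases eq_or_ne c 0 with rfl | hc
  · simpa using norm_nonneg' _
  · have h := norm_smul_le' c⁻¹ (c • f)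
    rw [smul_smul, inv_mul_cancel₀ hc, one_smul, norm_inv] at h
    have hc' : 0 < ‖c‖ := norm_pos_iff.2 hc
    calc ‖c‖ * ‖f‖ ≤ ‖c‖ * (‖c‖⁻¹ * ‖c • f‖) := by gcongr
      _ = ‖c • f‖ := by field_simp

/-- For positive `a`, `b` one has `(x + y)² ≤ (1 + b/a) x² + (1 + a/b) y²`, so weighting two
majorants in this way majorizes the sum. If their values at the base point are at most `a²` and
`b²`, the combination has value at most `(a + b)²` there. -/
theorem norm_add_le' (f g : LumerSpace Ω P₀) : ‖f + g‖ ≤ ‖f‖ + ‖g‖ := by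
  refine le_of_forall_pos_le_add fun ε hε => ?_
  have hf := norm_nonneg' f
  have hg := norm_nonneg' g
  set a := ‖f‖ + ε / 2 with ha
  set b := ‖g‖ + ε / 2 with hb
  have ha0 : 0 < a := by positivity
  have hb0 : 0 < b := by positivity
  obtain ⟨u, hu, hua⟩ := exists_majorant_le_sq (show ‖f‖ < a by linarith)
  obtain ⟨v, hv, hvb⟩ := exists_majorant_le_sq (show ‖g‖ < b by linarith)
  have hm : IsMajorant (f + g).toFun ((1 + b / a) • u + (1 + a / b) • v) := by
    refine ⟨(hu.1.const_smul _).add (hv.1.const_smul _), fun z => ?_⟩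
    simp only [toFun_add, Pi.add_apply, Pi.smul_apply, smul_eq_mul]
    have h1 := hu.2 z
    have h2 := hv.2 z
    have h3 := norm_add_le (f.toFun z) (g.toFun z)
    set x := ‖f.toFun z‖
    set y := ‖g.toFun z‖
    have h4 : ‖f.toFun z + g.toFun z‖ ^ 2 ≤ (x + y) ^ 2 :=
      pow_le_pow_left₀ (norm_nonneg _) h3 2
    have h5 : (x + y) ^ 2 ≤ (1 + b / a) * x ^ 2 + (1 + a / b) * y ^ 2 := by
      have : (1 + b / a) * x ^ 2 + (1 + a / b) * y ^ 2 - (x + y) ^ 2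
          = (b * x - a * y) ^ 2 / (a * b) := by field_simp; ring
      have h6 : 0 ≤ (b * x - a * y) ^ 2 / (a * b) := by positivity
      linarith
    have h7 : (1 + b / a) * x ^ 2 ≤ (1 + b / a) * u z := by gcongr
    have h8 : (1 + a / b) * y ^ 2 ≤ (1 + a / b) * v z := by gcongr
    linarith
  have h : ‖f + g‖ ≤ a + b := by
    refine norm_le_of_majorant_sq hm (by positivity) ?_
    simp only [Pi.add_apply, Pi.smul_apply, smul_eq_mul]
    calc (1 + b / a) * u P₀ + (1 + a / b) * v P₀
        ≤ (1 + b / a) * a ^ 2 + (1 + a / b) * b ^ 2 := by gcongr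
      _ = (a + b) ^ 2 := by field_simp; ring
  linarith

/-- The point evaluations are locally uniformly bounded. -/
theorem exists_norm_apply_le (hΩ : IsOpen Ω) (hc : IsPreconnected Ω) (P₀ : Ω)
    {K : Set (EuclideanSpace ℂ (Fin n))} (hK : IsCompact K) (hKΩ : K ⊆ Ω) :
    ∃ C > 0, ∀ (f : LumerSpace Ω P₀) (z : Ω), (z : EuclideanSpace ℂ (Fin n)) ∈ K →
      ‖f.toFun z‖ ≤ C * ‖f‖ := by
  obtain ⟨C, hC0, hC⟩ := exists_harnack hΩ hc hK hKΩ P₀.2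
  refine ⟨√C, by positivity, fun f z hz => ?_⟩
  have hf := norm_nonneg' f
  refine le_of_forall_pos_le_add fun ε hε => ?_
  obtain ⟨u, hu, h⟩ := exists_majorant_le_sq (f := f) (show ‖f‖ < ‖f‖ + ε / √C by
    have : 0 < ε / √C := by positivity
    linarith)
  have h1 := hC u (hu.1.meanValueOn hΩ) hu.nonneg z hz
  have h2 := hu.2 z
  have h3 : ‖f.toFun z‖ ≤ √C * (‖f‖ + ε / √C) := by
    refine le_of_sq_le_sq ?_ (by positivity)
    rw [mul_pow, Real.sq_sqrt hC0.le]
    nlinarith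
  rwa [mul_add, mul_div_cancel₀ _ (by positivity)] at h3

theorem core (hΩ : IsOpen Ω) (hc : IsPreconnected Ω) (P₀ : Ω) :
    NormedSpace.Core ℂ (LumerSpace Ω P₀) where
  norm_nonneg := norm_nonneg'
  norm_smul := norm_smul'
  norm_triangle := norm_add_le'
  norm_eq_zero_iff f := by
    constructor
    · intro h
      refine LumerSpace.ext (funext fun z => ?_)
      obtain ⟨C, -, hC⟩ := exists_norm_apply_le hΩ hc P₀ (isCompact_singleton (x := z.1))
        (by simp)
      have := hC f z rfl
      rw [h, mul_zero] at this
      simpa using this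
    · rintro rfl
      refine le_antisymm (norm_le_of_majorant_sq (u := fun _ => 0)
        ⟨pluriharmonicOn_const 0 Ω, by simp⟩ le_rfl (by simp)) (norm_nonneg' _)

/-- Absolute convergence implies convergence. Cauchy–Schwarz with the weights `a k` bounds the
square of the `N`-th remainder by the product of the tail of `∑ a k` and a pluriharmonic function
whose value at `P₀` is at most the same tail, so its norm is at most that tail. -/
theorem exists_tendsto_sum (hΩ : IsOpen Ω) (hc : IsPreconnected Ω) (P₀ : Ω)
    (g : ℕ → LumerSpace Ω P₀) (hg : Summable fun k => ‖g k‖) :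
    ∃ f : LumerSpace Ω P₀,
      Tendsto (fun N => ‖f - ∑ k ∈ Finset.range N, g k‖) atTop (𝓝 0) := by
  -- The added summable term makes `a k` positive and strictly larger than the norm, so that a
  -- majorant with value at most `a k ^ 2` at `P₀` exists.
  set a : ℕ → ℝ := fun k => ‖g k‖ + (1 / 2) ^ k with ha
  have ha0 : ∀ k, 0 < a k := fun k => by
    have := norm_nonneg' (g k)
    positivity
  have has : Summable a := hg.add summable_geometric_two
  have hlt : ∀ k, ‖g k‖ < a k := fun k => by
    have : (0 : ℝ) < (1 / 2) ^ k := by positivity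
    linarith
  choose u hu hua using fun k => exists_majorant_le_sq (hlt k)
  -- Dividing by `a k` leaves a value of at most `a k` at `P₀`, which is summable, and gives the
  -- product form `‖g k‖² ≤ a k * v k` needed for Cauchy–Schwarz.
  set v : ℕ → EuclideanSpace ℂ (Fin n) → ℝ := fun k => (a k)⁻¹ • u k with hv
  have hvP : ∀ k, PluriharmonicOn (v k) Ω := fun k => (hu k).1.const_smul _
  have hv0 : ∀ k, ∀ z ∈ Ω, 0 ≤ v k z := fun k z hz =>
    mul_nonneg (inv_nonneg.2 (ha0 k).le) ((hu k).nonneg z hz)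
  have hva : ∀ k, v k P₀ ≤ a k := fun k => by
    simp only [hv, Pi.smul_apply, smul_eq_mul]
    rw [inv_mul_le_iff₀ (ha0 k), ← sq]
    exact hua k
  have hgv : ∀ k (z : Ω), ‖(g k).toFun z‖ ^ 2 ≤ a k * v k z := fun k z => by
    simp only [hv, Pi.smul_apply, smul_eq_mul]
    rw [mul_inv_cancel_left₀ (ha0 k).ne']
    exact (hu k).2 z
  have hvs : Summable fun k => v k P₀ :=
    Summable.of_nonneg_of_le (fun k => hv0 k P₀ P₀.2) hva has
  have htail : ∀ N, (∀ z ∈ Ω, Summable fun k => v (k + N) z) ∧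
      PluriharmonicOn (fun z => ∑' k, v (k + N) z) Ω := fun N =>
    pluriharmonicOn_tsum hΩ hc P₀.2 (fun k => hvP (k + N)) (fun k => hv0 (k + N))
      ((summable_nat_add_iff N).2 hvs)
  have hpt : ∀ z : Ω, Summable fun k => (g k).toFun z := by
    intro z
    obtain ⟨C, -, hC⟩ := exists_norm_apply_le hΩ hc P₀ (isCompact_singleton (x := z.1)) (by simp)
    exact Summable.of_norm_bounded (hg.mul_left C) fun k => hC (g k) z rfl
  have hmaj : ∀ N (z : Ω), ‖∑' k, (g k).toFun z - ∑ k ∈ Finset.range N, (g k).toFun z‖ ^ 2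
      ≤ (∑' k, a (k + N)) * ∑' k, v (k + N) z := by
    intro N z
    rw [← (hpt z).sum_add_tsum_nat_add N, add_sub_cancel_left]
    have hs := ((summable_nat_add_iff N).2 (hpt z)).hasSum
    refine le_of_tendsto (hs.norm.pow 2) (Eventually.of_forall fun s => ?_)
    have h1 : ‖∑ k ∈ s, (g (k + N)).toFun z‖ ≤ ∑ k ∈ s, ‖(g (k + N)).toFun z‖ := norm_sum_le _ _
    have h2 : (∑ k ∈ s, ‖(g (k + N)).toFun z‖) ^ 2
        ≤ (∑ k ∈ s, a (k + N)) * ∑ k ∈ s, v (k + N) z :=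
      Finset.sum_sq_le_sum_mul_sum_of_sq_le_mul s (fun k _ => (ha0 _).le)
        (fun k _ => hv0 _ z z.2) (fun k _ => hgv (k + N) z)
    have h3 : ∑ k ∈ s, a (k + N) ≤ ∑' k, a (k + N) :=
      ((summable_nat_add_iff N).2 has).sum_le_tsum s fun k _ => (ha0 _).le
    have h4 : ∑ k ∈ s, v (k + N) z ≤ ∑' k, v (k + N) z :=
      ((htail N).1 z z.2).sum_le_tsum s fun k _ => hv0 _ z z.2
    have h5 : 0 ≤ ∑ k ∈ s, v (k + N) z := Finset.sum_nonneg fun k _ => hv0 _ z z.2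
    have h6 : 0 ≤ ∑' k, a (k + N) := tsum_nonneg fun k => (ha0 _).le
    calc ‖∑ k ∈ s, (g (k + N)).toFun z‖ ^ 2 ≤ (∑ k ∈ s, ‖(g (k + N)).toFun z‖) ^ 2 := by gcongr
      _ ≤ _ := h2
      _ ≤ _ := by gcongr
  have hhol : (fun z : Ω => ∑' k, (g k).toFun z) ∈ holomorphic Ω := by
    change DifferentiableOn ℂ (extZero _) Ω
    have h := differentiableOn_tsum_of_locally_bounded hΩ (g := fun k => extZero (g k).toFun)
      (fun k => (g k).toFun_mem.1) ?_
    · refine h.congr fun z hz => ?_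
      have h1 := extZero_apply (fun z : Ω => ∑' k, (g k).toFun z) ⟨z, hz⟩
      rw [h1]
      exact tsum_congr fun k => (extZero_apply _ ⟨z, hz⟩).symm
    · intro z hz
      obtain ⟨r, hr0, hr⟩ := Metric.isOpen_iff.1 hΩ z hz
      have hK : closedBall z (r / 2) ⊆ Ω := (closedBall_subset_ball (by linarith)).trans hr
      obtain ⟨C, -, hC⟩ := exists_norm_apply_le hΩ hc P₀ (isCompact_closedBall z (r / 2)) hK
      refine ⟨r / 2, by positivity, ball_subset_closedBall.trans hK, fun k => C * ‖g k‖,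
        hg.mul_left C, fun k w hw => ?_⟩
      have hw' := ball_subset_closedBall hw
      have h1 := extZero_apply (g k).toFun ⟨w, hK hw'⟩
      rw [h1]
      exact hC (g k) ⟨w, hK hw'⟩ hw'
  have hmem : (fun z : Ω => ∑' k, (g k).toFun z) ∈ lumerHardy Ω := by
    refine ⟨hhol, (∑' k, a k) • fun z => ∑' k, v k z, ?_, fun z => ?_⟩
    · exact (by simpa using (htail 0).2 : PluriharmonicOn (fun z => ∑' k, v k z) Ω).const_smul _
    · simpa using hmaj 0 z
  refine ⟨mk P₀ _ hmem, ?_⟩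
  have hA := tendsto_sum_nat_add a
  refine squeeze_zero (fun N => norm_nonneg' _) (fun N => ?_) hA
  have hA0 : 0 ≤ ∑' k, a (k + N) := tsum_nonneg fun k => (ha0 _).le
  refine norm_le_of_majorant_sq (u := (∑' k, a (k + N)) • fun z => ∑' k, v (k + N) z)
    ⟨(htail N).2.const_smul _, fun z => ?_⟩ hA0 ?_
  · simpa using hmaj N z
  · simp only [Pi.smul_apply, smul_eq_mul, sq]
    refine mul_le_mul_of_nonneg_left ?_ hA0
    exact ((summable_nat_add_iff N).2 hvs).tsum_le_tsum (fun k => hva _)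
      ((summable_nat_add_iff N).2 has)

end LumerSpace

end LumerHardy

/-! ### Bounded sequences and Hilbert spaces -/

namespace LumerHardy

open Filter Topology Metric

/-- Each new term gets the sign that makes its real inner product with the previous partial sum
nonnegative. -/
theorem exists_signs_sum_sq_le {H : Type*} [NormedAddCommGroup H] [InnerProductSpace ℂ H]
    (x : ℕ → H) (N : ℕ) : ∃ s : ℕ → ℂ, (∀ k, ‖s k‖ = 1) ∧
      ∑ k ∈ Finset.range N, ‖x k‖ ^ 2 ≤ ‖∑ k ∈ Finset.range N, s k • x k‖ ^ 2 := by
  induction N with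
  | zero => exact ⟨fun _ => 1, by simp, by simp⟩
  | succ N ih =>
    obtain ⟨s, hs, h⟩ := ih
    set y := ∑ k ∈ Finset.range N, s k • x k with hy
    obtain ⟨t, ht, hty⟩ : ∃ t : ℂ, ‖t‖ = 1 ∧ 0 ≤ (inner ℂ y (t • x N)).re := by
      rcases le_total 0 (inner ℂ y (x N)).re with h0 | h0
      · exact ⟨1, by simp, by simpa using h0⟩
      · exact ⟨-1, by simp, by simpa using h0⟩
    refine ⟨Function.update s N t, fun k => ?_, ?_⟩
    · rcases eq_or_ne k N with rfl | hk
      · simpa using ht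
      · simpa [hk] using hs k
    · rw [Finset.sum_range_succ, Finset.sum_range_succ]
      have h1 : ∑ k ∈ Finset.range N, Function.update s N t k • x k = y := by
        refine Finset.sum_congr rfl fun k hk => ?_
        rw [Function.update_of_ne (Finset.mem_range.1 hk).ne]
      rw [h1, Function.update_self, @norm_add_sq ℂ]
      have h2 : ‖t • x N‖ = ‖x N‖ := by rw [norm_smul, ht, one_mul]
      rw [h2]
      have h3 : (0 : ℝ) ≤ 2 * RCLike.re (inner ℂ y (t • x N)) := by
        simpa using hty
      linarith

theorem norm_sum_single_le_one (s : ℕ → ℂ) (hs : ∀ k, ‖s k‖ = 1) (N : ℕ) :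
    ‖∑ k ∈ Finset.range N, s k • lp.single (E := fun _ : ℕ => ℂ) ∞ k (1 : ℂ)‖ ≤ 1 := by
  refine lp.norm_le_of_forall_le zero_le_one fun i => ?_
  rw [lp.coeFn_sum, Finset.sum_apply]
  simp only [lp.coeFn_smul, Pi.smul_apply, lp.single_apply, smul_eq_mul]
  by_cases hi : i ∈ Finset.range N
  · rw [Finset.sum_eq_single i]
    · simp [hs]
    · intro k _ hk
      simp [hk.symm]
    · exact fun h => absurd hi h
  · rw [Finset.sum_eq_zero]
    · simp
    · intro k hk
      have : i ≠ k := by rintro rfl; exact hi hk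
      simp [this]

/-- The space of bounded sequences does not embed into a Hilbert space. -/
theorem not_bounded_below_lp_infty {H : Type*} [NormedAddCommGroup H] [InnerProductSpace ℂ H]
    (T : lp (fun _ : ℕ => ℂ) ∞ →L[ℂ] H) {c : ℝ} (hc : 0 < c)
    (hT : ∀ x, c * ‖x‖ ≤ ‖T x‖) : False := by
  -- Signed sums of `N` unit coordinate vectors have norm at most one, so their images have norm at
  -- most `‖T‖`, whereas suitable signs give a squared norm of at least `N * c ^ 2`.
  obtain ⟨N, hN⟩ := exists_nat_gt (‖T‖ ^ 2 / c ^ 2)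
  obtain ⟨s, hs, h⟩ := exists_signs_sum_sq_le
    (fun k => T (lp.single (E := fun _ : ℕ => ℂ) ∞ k (1 : ℂ))) N
  have h1 : ∀ k, c ^ 2 ≤ ‖T (lp.single (E := fun _ : ℕ => ℂ) ∞ k (1 : ℂ))‖ ^ 2 := by
    intro k
    have := hT (lp.single (E := fun _ : ℕ => ℂ) ∞ k (1 : ℂ))
    rw [lp.norm_single (by simp), norm_one, mul_one] at this
    exact pow_le_pow_left₀ hc.le this 2
  have h2 : N * c ^ 2 ≤ ∑ k ∈ Finset.range N, ‖T (lp.single (E := fun _ : ℕ => ℂ) ∞ k (1 : ℂ))‖ ^ 2 := by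
    have := Finset.card_nsmul_le_sum (Finset.range N) _ (c ^ 2) fun k _ => h1 k
    simpa using this
  have h3 : ‖∑ k ∈ Finset.range N, s k • T (lp.single (E := fun _ : ℕ => ℂ) ∞ k (1 : ℂ))‖ ≤ ‖T‖ := by
    have h4 : ∑ k ∈ Finset.range N, s k • T (lp.single (E := fun _ : ℕ => ℂ) ∞ k (1 : ℂ))
        = T (∑ k ∈ Finset.range N, s k • lp.single (E := fun _ : ℕ => ℂ) ∞ k (1 : ℂ)) := by
      simp [map_sum]
    rw [h4]
    refine (T.le_opNorm _).trans ?_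
    exact mul_le_of_le_one_right (norm_nonneg _) (norm_sum_single_le_one s hs N)
  have h5 := pow_le_pow_left₀ (norm_nonneg _) h3 2
  rw [div_lt_iff₀ (by positivity)] at hN
  linarith

theorem isEmpty_equiv_hilbert {X : Type*} [NormedAddCommGroup X] [NormedSpace ℂ X]
    {S : Submodule ℂ X} (φ : lp (fun _ : ℕ => ℂ) ∞ ≃L[ℂ] S)
    (H : Type*) [NormedAddCommGroup H] [InnerProductSpace ℂ H] :
    IsEmpty (X ≃L[ℂ] H) := by
  refine ⟨fun e => ?_⟩
  set A := ‖(φ.symm : S →L[ℂ] lp (fun _ : ℕ => ℂ) ∞)‖ * ‖(e.symm : H →L[ℂ] X)‖ with hA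
  refine not_bounded_below_lp_infty
    ((e : X →L[ℂ] H).comp (S.subtypeL.comp (φ : lp (fun _ : ℕ => ℂ) ∞ →L[ℂ] S)))
    (c := 1 / (A + 1)) (by positivity) fun x => ?_
  have h1 : ‖x‖ ≤ ‖(φ.symm : S →L[ℂ] lp (fun _ : ℕ => ℂ) ∞)‖ * ‖φ x‖ := by
    simpa using (φ.symm : S →L[ℂ] lp (fun _ : ℕ => ℂ) ∞).le_opNorm (φ x)
  have h2 : ‖φ x‖ ≤ ‖(e.symm : H →L[ℂ] X)‖ * ‖e (φ x)‖ := by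
    simpa using (e.symm : H →L[ℂ] X).le_opNorm (e (φ x))
  have h3 : ‖x‖ ≤ A * ‖e (φ x)‖ := by
    refine h1.trans ?_
    rw [hA, mul_assoc]
    gcongr
  rw [one_div, inv_mul_le_iff₀ (by positivity)]
  simp only [ContinuousLinearMap.coe_comp, Function.comp_apply, Submodule.coe_subtypeL,
    Submodule.coe_subtype, ContinuousLinearEquiv.coe_coe]
  nlinarith [norm_nonneg (e (φ x))]

/-- A map that is bounded below is a homeomorphism onto its range, which inherits completeness from
`ℓ^∞` and is therefore closed. -/
theorem exists_closed_subspace_equiv {X : Type*} [NormedAddCommGroup X] [NormedSpace ℂ X]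
    (T : lp (fun _ : ℕ => ℂ) ∞ →ₗ[ℂ] X) {c C : ℝ} (hc : 0 < c)
    (h : ∀ x, c * ‖x‖ ≤ ‖T x‖ ∧ ‖T x‖ ≤ C * ‖x‖) :
    ∃ S : Submodule ℂ X, IsClosed (S : Set X) ∧ Nonempty (lp (fun _ : ℕ => ℂ) ∞ ≃L[ℂ] S) := by
  have hinj : Function.Injective T := by
    refine (injective_iff_map_eq_zero T).2 fun x hx => ?_
    have := (h x).1
    rw [hx, norm_zero] at this
    exact norm_le_zero_iff.1 (by nlinarith)
  set φ := (LinearEquiv.ofInjective T hinj).toContinuousLinearEquivOfBounds C c⁻¹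
    (fun x => (h x).2) (fun y => by
      obtain ⟨x, rfl⟩ := (LinearEquiv.ofInjective T hinj).surjective y
      rw [LinearEquiv.symm_apply_apply, ← div_eq_inv_mul, le_div_iff₀ hc, mul_comm]
      exact (h x).1) with hφ
  refine ⟨LinearMap.range T, ?_, ⟨φ⟩⟩
  have : CompleteSpace (LinearMap.range T) :=
    (completeSpace_congr (e := φ.toEquiv) φ.isUniformEmbedding).1 inferInstance
  exact (completeSpace_coe_iff_isComplete.1 this).isClosed

end LumerHardy

namespace LumerHardy

open Filter Topology Metric

/-! ### A convex profile that is flat on the negative axis -/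

section Profile

/-- A `C²` convex function on the line that vanishes on `(-∞, 0]` and has bounded slope. -/
noncomputable def profile (x : ℝ) : ℝ := max x 0 - Real.arctan (max x 0)

theorem profile_of_nonpos {x : ℝ} (hx : x ≤ 0) : profile x = 0 := by
  simp [profile, max_eq_right hx]

/-- Vanishing of value and slope at `0` makes the extension by zero differentiable there. Used for
the profile and again for its derivative, to obtain class `C²`. -/
theorem hasDerivAt_of_halves {f f' : ℝ → ℝ}
    (hf : ∀ x, 0 ≤ x → HasDerivAt f (f' x) x) (hf0 : f 0 = 0) (hf0' : f' 0 = 0) (x : ℝ) :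
    HasDerivAt (fun x => f (max x 0)) (f' (max x 0)) x := by
  rcases lt_trichotomy x 0 with hx | rfl | hx
  · rw [max_eq_right hx.le, hf0']
    refine (hasDerivAt_const x (0 : ℝ)).congr_of_eventuallyEq ?_
    filter_upwards [gt_mem_nhds hx] with y hy
    rw [max_eq_right hy.le, hf0]
  · rw [max_self, hf0']
    have h := hf 0 le_rfl
    rw [hf0'] at h
    rw [hasDerivAt_iff_isLittleO] at h ⊢
    simp only [max_self, hf0, sub_zero, smul_zero] at h ⊢
    have h2 : Tendsto (fun y : ℝ => max y 0) (𝓝 0) (𝓝 0) := by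
      have : Continuous fun y : ℝ => max y 0 := by fun_prop
      simpa using this.tendsto 0
    refine (h.comp_tendsto h2).trans_isBigO (Asymptotics.IsBigO.of_bound 1 ?_)
    refine Eventually.of_forall fun y => ?_
    simp only [Function.comp_apply, Real.norm_eq_abs, one_mul]
    rw [abs_of_nonneg (le_max_right _ _)]
    exact max_le (le_abs_self y) (abs_nonneg y)
  · rw [max_eq_left hx.le]
    refine (hf x hx.le).congr_of_eventuallyEq ?_
    filter_upwards [lt_mem_nhds hx] with y hy
    rw [max_eq_left hy.le]

theorem hasDerivAt_profile (x : ℝ) :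
    HasDerivAt profile ((max x 0) ^ 2 / (1 + (max x 0) ^ 2)) x := by
  refine hasDerivAt_of_halves (f := fun x => x - Real.arctan x)
    (f' := fun x => x ^ 2 / (1 + x ^ 2)) ?_ (by simp) (by simp) x
  intro x _
  have h := (hasDerivAt_id x).sub (Real.hasDerivAt_arctan x)
  refine h.congr_deriv ?_
  field_simp
  ring

theorem hasDerivAt_profile_deriv (x : ℝ) :
    HasDerivAt (fun x : ℝ => (max x 0) ^ 2 / (1 + (max x 0) ^ 2))
      (2 * max x 0 / (1 + (max x 0) ^ 2) ^ 2) x := by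
  refine hasDerivAt_of_halves (f := fun x => x ^ 2 / (1 + x ^ 2))
    (f' := fun x => 2 * x / (1 + x ^ 2) ^ 2) ?_ (by simp) (by simp) x
  intro x _
  have h1 : HasDerivAt (fun x : ℝ => x ^ 2) (2 * x) x := by simpa using hasDerivAt_pow 2 x
  have h := h1.div (h1.const_add 1) (by positivity)
  refine h.congr_deriv ?_
  ring

theorem deriv_profile : deriv profile = fun x : ℝ => (max x 0) ^ 2 / (1 + (max x 0) ^ 2) :=
  funext fun x => (hasDerivAt_profile x).deriv

theorem contDiff_profile : ContDiff ℝ 2 profile := by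
  rw [show (2 : WithTop ℕ∞) = 1 + 1 by norm_num, contDiff_succ_iff_deriv]
  refine ⟨fun x => (hasDerivAt_profile x).differentiableAt, by simp, ?_⟩
  rw [deriv_profile, contDiff_one_iff_deriv]
  refine ⟨fun x => (hasDerivAt_profile_deriv x).differentiableAt, ?_⟩
  rw [funext fun x => (hasDerivAt_profile_deriv x).deriv]
  refine Continuous.div (by fun_prop) (by fun_prop) fun x => by positivity

end Profile

/-! ### Mass of positive solutions in thin shells -/

section Shell

theorem integrable_mul_of_tsupport_subset {E : Type*} [NormedAddCommGroup E] [MeasurableSpace E]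
    [BorelSpace E] (μ : Measure E) [IsFiniteMeasureOnCompacts μ] {W : Set E} (hW : IsOpen W) {u g : E → ℝ}
    (hu : ContinuousOn u W) (hg : Continuous g) (hgc : HasCompactSupport g)
    (hgW : tsupport g ⊆ W) : Integrable (fun x => u x * g x) μ := by
  have hcont : Continuous fun x => u x * g x := by
    refine continuous_iff_continuousAt.2 fun x => ?_
    by_cases hx : x ∈ tsupport g
    · exact (hu.continuousAt (hW.mem_nhds (hgW hx))).mul hg.continuousAt
    · have : (fun x => u x * g x) =ᶠ[𝓝 x] fun _ => 0 := by
        filter_upwards [notMem_tsupport_iff_eventuallyEq.1 hx] with y hy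
        simp [hy]
      exact continuousAt_const.congr this.symm
  exact hcont.integrable_of_hasCompactSupport hgc.mul_left

variable {E : Type*} [NormedAddCommGroup E] [NormedSpace ℝ E]

theorem hess_comp {φ φ' φ'' : ℝ → ℝ} {r : E → ℝ} (hφ : ∀ t, HasDerivAt φ (φ' t) t)
    (hφ' : ∀ t, HasDerivAt φ' (φ'' t) t) (hr : ContDiff ℝ 2 r) (x w : E) :
    fderiv ℝ (fderiv ℝ fun y => φ (r y)) x w w
      = φ'' (r x) * (fderiv ℝ r x w) ^ 2 + φ' (r x) * fderiv ℝ (fderiv ℝ r) x w w := by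
  have hr1 : ∀ y, HasFDerivAt r (fderiv ℝ r y) y := fun y =>
    (hr.differentiable (by simp) y).hasFDerivAt
  have hr2 : HasFDerivAt (fderiv ℝ r) (fderiv ℝ (fderiv ℝ r) x) x :=
    ((hr.fderiv_right (m := 1) (by norm_num)).differentiable (by simp) x).hasFDerivAt
  have h1 : (fderiv ℝ fun y => φ (r y)) = fun y => φ' (r y) • fderiv ℝ r y :=
    funext fun y => ((hφ (r y)).comp_hasFDerivAt y (hr1 y)).fderiv
  have h2 := ((hφ' (r x)).comp_hasFDerivAt x (hr1 x)).fun_smul hr2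
  rw [h1]
  have h3 : fderiv ℝ (fun y => φ' (r y) • fderiv ℝ r y) x = _ := h2.fderiv
  rw [h3]
  simp only [add_apply, smul_apply, Function.comp_apply,
    ContinuousLinearMap.smulRight_apply, smul_eq_mul]
  ring

theorem fderiv_fderiv_apply {g : E → ℝ} {x : E} (hg : ContDiffAt ℝ 2 g x) (w : E) :
    fderiv ℝ (fun y => fderiv ℝ g y w) x w = fderiv ℝ (fderiv ℝ g) x w w := by
  have h : DifferentiableAt ℝ (fderiv ℝ g) x :=
    (hg.fderiv_right (m := 1) (by norm_num)).differentiableAt (by simp)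
  rw [fderiv_clm_apply h (differentiableAt_const w)]
  simp

variable [FiniteDimensional ℝ E] [MeasurableSpace E] [BorelSpace E]
  (μ : Measure E) [μ.IsAddHaarMeasure]

/-- Two integrations by parts; there are no boundary terms because `ψ` and its derivatives have
compact support in `W`, outside which nothing is known about `u`. -/
theorem integral_mul_hess {W : Set E} (hW : IsOpen W) {u ψ : E → ℝ} (hu : ContDiffOn ℝ 2 u W)
    (hψ : ContDiff ℝ 2 ψ) (hψc : HasCompactSupport ψ) (hψW : tsupport ψ ⊆ W) (w : E) :
    Integrable (fun x => u x * fderiv ℝ (fderiv ℝ ψ) x w w) μ ∧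
    Integrable (fun x => fderiv ℝ (fderiv ℝ u) x w w * ψ x) μ ∧
    ∫ x, u x * fderiv ℝ (fderiv ℝ ψ) x w w ∂μ = ∫ x, fderiv ℝ (fderiv ℝ u) x w w * ψ x ∂μ := by
  have hua : ∀ x ∈ W, ContDiffAt ℝ 2 u x := fun x hx => hu.contDiffAt (hW.mem_nhds hx)
  set ψ1 : E → ℝ := fun x => fderiv ℝ ψ x w with hψ1
  set u1 : E → ℝ := fun x => fderiv ℝ u x w with hu1
  have hψ1s : ContDiff ℝ 1 ψ1 := (hψ.fderiv_right (m := 1) (by norm_num)).clm_apply contDiff_const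
  have hψ1W : tsupport ψ1 ⊆ W := (tsupport_fderiv_apply_subset ℝ w).trans hψW
  have hψ1c : HasCompactSupport ψ1 := hψc.fderiv_apply (𝕜 := ℝ) w
  set ψ2 : E → ℝ := fun x => fderiv ℝ ψ1 x w with hψ2
  have hψ2s : Continuous ψ2 := (hψ1s.continuous_fderiv (by simp)).clm_apply continuous_const
  have hψ2W : tsupport ψ2 ⊆ W := (tsupport_fderiv_apply_subset ℝ w).trans hψ1W
  have hψ2c : HasCompactSupport ψ2 := hψ1c.fderiv_apply (𝕜 := ℝ) w
  have hu1d : ∀ x ∈ W, ContDiffAt ℝ 1 u1 x := fun x hx =>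
    ((hua x hx).fderiv_right (m := 1) (by norm_num)).clm_apply contDiffAt_const
  have hu1c : ContinuousOn u1 W := fun x hx => (hu1d x hx).continuousAt.continuousWithinAt
  set u2 : E → ℝ := fun x => fderiv ℝ u1 x w with hu2
  have hu2c : ContinuousOn u2 W := fun x hx =>
    (((hu1d x hx).fderiv_right (m := 0) (by norm_num)).clm_apply
      contDiffAt_const).continuousAt.continuousWithinAt
  have i1 : Integrable (fun x => u x * ψ2 x) μ :=
    integrable_mul_of_tsupport_subset μ hW hu.continuousOn hψ2s hψ2c hψ2W
  have i2 : Integrable (fun x => u1 x * ψ1 x) μ :=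
    integrable_mul_of_tsupport_subset μ hW hu1c hψ1s.continuous hψ1c hψ1W
  have i3 : Integrable (fun x => u x * ψ1 x) μ :=
    integrable_mul_of_tsupport_subset μ hW hu.continuousOn hψ1s.continuous hψ1c hψ1W
  have i4 : Integrable (fun x => u2 x * ψ x) μ :=
    integrable_mul_of_tsupport_subset μ hW hu2c hψ.continuous hψc hψW
  have i5 : Integrable (fun x => u1 x * ψ x) μ :=
    integrable_mul_of_tsupport_subset μ hW hu1c hψ.continuous hψc hψW
  have e1 : ∫ x, u x * ψ2 x ∂μ = -∫ x, u1 x * ψ1 x ∂μ :=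
    integral_mul_fderiv_eq_neg_fderiv_mul_of_integrable i2 i1 i3
      (fun x hx => (hua x (hψ1W hx)).differentiableAt (by simp))
      (fun x _ => hψ1s.differentiable (by simp) x)
  have e2 : ∫ x, u1 x * ψ1 x ∂μ = -∫ x, u2 x * ψ x ∂μ :=
    integral_mul_fderiv_eq_neg_fderiv_mul_of_integrable i4 i2 i5
      (fun x hx => (hu1d x (hψW hx)).differentiableAt (by simp))
      (fun x _ => hψ.differentiable (by simp) x)
  have g1 : ∀ x, ψ2 x = fderiv ℝ (fderiv ℝ ψ) x w w := fun x =>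
    fderiv_fderiv_apply hψ.contDiffAt w
  have g2 : ∀ x, u2 x * ψ x = fderiv ℝ (fderiv ℝ u) x w w * ψ x := by
    intro x
    by_cases hx : x ∈ tsupport ψ
    · rw [hu2, ← fderiv_fderiv_apply (hua x (hψW hx)) w]
    · rw [image_eq_zero_of_notMem_tsupport hx]; simp
  simp only [g1] at i1 e1
  simp only [g2] at i4 e2
  exact ⟨i1, i4, by rw [e1, e2, neg_neg]⟩

variable {ι : Type*} [Fintype ι] (v : ι → E)

set_option maxHeartbeats 1000000 in
/-- The mass of a positive solution `u` of `∑ D²u(vᵢ, vᵢ) = 0` on a shell near the boundary is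
controlled by its mass in the interior. -/
theorem exists_shell_estimate {c A η : ℝ} (hc : 0 < c) (hA : 0 < A) (hη : 0 < η) :
    ∃ C > 0, ∀ (W : Set E) (r : E → ℝ), IsOpen W → ContDiff ℝ 2 r → (∀ x ∈ W, r x < 0) →
      (∀ s > 0, IsCompact {x | x ∈ W ∧ r x ≤ -s}) →
      (∀ x ∈ W, -η < r x → c ≤ ∑ i, (fderiv ℝ r x (v i)) ^ 2) →
      (∀ x ∈ W, |∑ i, fderiv ℝ (fderiv ℝ r) x (v i) (v i)| ≤ A) →
      (∀ x ∈ W, -A ≤ r x) →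
      ∀ u : E → ℝ, ContDiffOn ℝ 2 u W → (∀ x ∈ W, 0 ≤ u x) →
      (∀ x ∈ W, ∑ i, fderiv ℝ (fderiv ℝ u) x (v i) (v i) = 0) →
      ∀ ε, 0 < ε → 2 * ε ≤ η →
      ∫ x in {x | x ∈ W ∧ -(3 / 2 * ε) ≤ r x ∧ r x ≤ -(ε / 2)}, u x ∂μ
        ≤ C * ε * ∫ x in {x | x ∈ W ∧ r x ≤ -η}, u x ∂μ := by
  -- With `Γ` the sum of the squared first derivatives of `r` and `Λ` that of the second
  -- derivatives, the operator sends `exp(-K r)` to `K exp(-K r) (K Γ - Λ)`. This is nonnegative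
  -- where `Γ ≥ c`, since `K * c = A ≥ Λ`.
  set K := A / c with hK
  have hK0 : 0 < K := by positivity
  -- `X2` bounds the argument of the profile on the shell, `k / ε` is the lower bound of the
  -- operator applied to the test function there, and `-C1` is its lower bound on `r ≤ -η`.
  set X2 := 3 / 2 * K * Real.exp (K * η) with hX2
  have hX20 : 0 < X2 := by positivity
  set k := (K / 2) / (1 + X2 ^ 2) ^ 2 * K ^ 2 * c with hk
  have hk0 : 0 < k := by positivity
  set C1 := K * A * Real.exp (K * A) with hC1
  have hC10 : 0 < C1 := by positivity
  refine ⟨C1 / k, by positivity, ?_⟩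
  intro W r hW hr hneg hcpt hlow hA1 hA2 u hu hu0 hLu ε hε hεη
  -- On the shell, `(exp(-K t) - 1) / ε` lies between `K / 2` and `X2`. Subtracting `K / 4` keeps
  -- `Y` at least `K / 4` there and makes it negative close to the boundary, where the profile
  -- vanishes; the scale `1/ε` in `Y` produces the second derivative of order `1/ε`.
  set Y : ℝ → ℝ := fun t => (Real.exp (-(K * t)) - 1) / ε - K / 4 with hY
  set φ : ℝ → ℝ := fun t => ε * profile (Y t) with hφ
  set q : ℝ → ℝ := fun x => (max x 0) ^ 2 / (1 + (max x 0) ^ 2) with hq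
  set q' : ℝ → ℝ := fun x => 2 * max x 0 / (1 + (max x 0) ^ 2) ^ 2 with hq'
  have hexpd : ∀ t, HasDerivAt (fun t => Real.exp (-(K * t))) (-(K * Real.exp (-(K * t)))) t := by
    intro t
    have := ((hasDerivAt_id t).const_mul K).neg.exp
    refine this.congr_deriv ?_
    simp; ring
  have hYd : ∀ t, HasDerivAt Y (-(K * Real.exp (-(K * t))) / ε) t := fun t =>
    (((hexpd t).sub_const 1).div_const ε).sub_const (K / 4)
  have hφd : ∀ t, HasDerivAt φ (q (Y t) * -(K * Real.exp (-(K * t)))) t := by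
    intro t
    refine (((hasDerivAt_profile (Y t)).comp t (hYd t)).const_mul ε).congr_deriv ?_
    simp only [hq]
    field_simp
  have hφd2 : ∀ t, HasDerivAt (fun t => q (Y t) * -(K * Real.exp (-(K * t))))
      (q' (Y t) * (K * Real.exp (-(K * t))) ^ 2 / ε + q (Y t) * (K ^ 2 * Real.exp (-(K * t)))) t := by
    intro t
    have h1 := (hasDerivAt_profile_deriv (Y t)).comp t (hYd t)
    have h2 := ((hexpd t).const_mul K).neg
    refine (h1.mul h2).congr_deriv ?_
    simp only [hq, hq', Function.comp_apply, Pi.neg_apply]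
    field_simp
  have hφs : ContDiff ℝ 2 φ := by
    refine contDiff_const.mul (contDiff_profile.comp ?_)
    fun_prop
  have hrs : ContDiff ℝ 2 fun x => φ (r x) := hφs.comp hr
  -- `-s` is the zero of `Y`; the test function vanishes for `r > -s`, so its support is compact in
  -- `W`.
  set s := Real.log (1 + K / 4 * ε) / K with hs
  have hs0 : 0 < s := div_pos (Real.log_pos (by have : 0 < K / 4 * ε := by positivity
                                                linarith)) hK0
  have hφ0 : ∀ t, -s < t → φ t = 0 := by
    intro t ht
    have h1 : -(K * t) ≤ Real.log (1 + K / 4 * ε) := by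
      have : -t < s := by linarith
      rw [hs, lt_div_iff₀ hK0] at this
      linarith
    have h2 : Real.exp (-(K * t)) ≤ 1 + K / 4 * ε := by
      rw [← Real.exp_log (show 0 < 1 + K / 4 * ε by positivity)]
      exact Real.exp_le_exp.2 h1
    have h3 : Y t ≤ 0 := by
      simp only [hY, sub_nonpos]
      rw [div_le_iff₀ hε]
      linarith
    simp only [hφ, profile_of_nonpos h3, mul_zero]
  set ψ : E → ℝ := W.indicator fun x => φ (r x) with hψ
  set Z := {x | x ∈ W ∧ r x ≤ -s} with hZ
  have hZc : IsCompact Z := hcpt s hs0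
  have hψ0 : ∀ x, x ∉ Z → ψ x = 0 := by
    intro x hx
    by_cases hxW : x ∈ W
    · rw [hψ, indicator_of_mem hxW]
      refine hφ0 _ ?_
      by_contra h
      exact hx ⟨hxW, not_lt.1 h⟩
    · rw [hψ, indicator_of_notMem hxW]
  have hψZ : tsupport ψ ⊆ Z := by
    refine closure_minimal (fun x hx => ?_) hZc.isClosed
    by_contra h
    exact hx (hψ0 x h)
  have hψW : tsupport ψ ⊆ W := hψZ.trans fun x hx => hx.1
  have hψc : HasCompactSupport ψ := hZc.of_isClosed_subset (isClosed_tsupport _) hψZ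
  have hψe : ∀ x ∈ W, ψ =ᶠ[𝓝 x] fun x => φ (r x) := by
    intro x hx
    filter_upwards [hW.mem_nhds hx] with y hy
    rw [hψ, indicator_of_mem hy]
  have hψs : ContDiff ℝ 2 ψ := by
    refine contDiff_iff_contDiffAt.2 fun x => ?_
    by_cases hx : x ∈ W
    · exact hrs.contDiffAt.congr_of_eventuallyEq (hψe x hx)
    · have : ψ =ᶠ[𝓝 x] fun _ => 0 := by
        filter_upwards [hZc.isClosed.isOpen_compl.mem_nhds (fun h : x ∈ Z => hx h.1)] with y hy
        exact hψ0 y hy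
      exact contDiffAt_const.congr_of_eventuallyEq this
  have hibp := fun i => integral_mul_hess μ hW hu hψs hψc hψW (v i)
  have hint : Integrable (fun x => u x * ∑ i, fderiv ℝ (fderiv ℝ ψ) x (v i) (v i)) μ := by
    simp only [Finset.mul_sum]
    exact integrable_finsetSum _ fun i _ => (hibp i).1
  have hzero : ∫ x, u x * ∑ i, fderiv ℝ (fderiv ℝ ψ) x (v i) (v i) ∂μ = 0 := by
    simp only [Finset.mul_sum]
    rw [integral_finsetSum _ fun i _ => (hibp i).1]
    rw [Finset.sum_congr rfl fun i _ => (hibp i).2.2,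
      ← integral_finsetSum _ fun i _ => (hibp i).2.1]
    refine integral_eq_zero_of_ae (Eventually.of_forall fun x => ?_)
    simp only [← Finset.sum_mul, Pi.zero_apply]
    by_cases hx : x ∈ tsupport ψ
    · rw [hLu x (hψW hx), zero_mul]
    · rw [image_eq_zero_of_notMem_tsupport hx, mul_zero]
  set S1 := {x | x ∈ W ∧ -(3 / 2 * ε) ≤ r x ∧ r x ≤ -(ε / 2)} with hS1
  set S2 := {x | x ∈ W ∧ r x ≤ -η} with hS2
  have hS2c : IsCompact S2 := hcpt η hη
  have hS1c : IsCompact S1 := by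
    have := (hcpt (ε / 2) (by positivity)).inter_right
      (isClosed_le continuous_const hr.continuous : IsClosed {x | -(3 / 2 * ε) ≤ r x})
    convert this using 1
    ext x
    simp only [hS1, mem_ofPred_eq, mem_inter_iff]
    tauto
  have hi1 : IntegrableOn u S1 μ :=
    (hu.continuousOn.mono fun x hx => hx.1).integrableOn_compact hS1c
  have hi2 : IntegrableOn u S2 μ :=
    (hu.continuousOn.mono fun x hx => hx.1).integrableOn_compact hS2c
  -- The operator applied to `ψ` is at least `k / ε` on the shell, nonnegative on the rest of the
  -- collar and at least `-C1` in the deep part; `2 * ε ≤ η` keeps the shell away from the deep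
  -- part. Since `u ≥ 0`, integration against `u` gives the claim.
  have hkey : ∀ x, k / ε * S1.indicator u x - C1 * S2.indicator u x
      ≤ u x * ∑ i, fderiv ℝ (fderiv ℝ ψ) x (v i) (v i) := by
    intro x
    by_cases hxW : x ∈ W
    swap
    · have h1 : ψ =ᶠ[𝓝 x] fun _ => 0 := by
        filter_upwards [hZc.isClosed.isOpen_compl.mem_nhds (fun h : x ∈ Z => hxW h.1)] with y hy
        exact hψ0 y hy
      have h2 : fderiv ℝ (fderiv ℝ ψ) x = 0 := by
        rw [h1.fderiv.fderiv_eq]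
        simp
      rw [indicator_of_notMem fun h : x ∈ S1 => hxW h.1,
        indicator_of_notMem fun h : x ∈ S2 => hxW h.1, h2]
      simp
    · have hux := hu0 x hxW
      set t := r x with ht
      have ht0 : t < 0 := hneg x hxW
      set e := Real.exp (-(K * t)) with he
      have he1 : 1 ≤ e := Real.one_le_exp (by nlinarith)
      set Γ := ∑ i, (fderiv ℝ r x (v i)) ^ 2 with hΓ
      set Λ := ∑ i, fderiv ℝ (fderiv ℝ r) x (v i) (v i) with hΛ
      have hΓ0 : 0 ≤ Γ := Finset.sum_nonneg fun i _ => sq_nonneg _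
      have hΛA := abs_le.1 (hA1 x hxW)
      have hL : ∑ i, fderiv ℝ (fderiv ℝ ψ) x (v i) (v i)
          = q' (Y t) * (K * e) ^ 2 / ε * Γ + q (Y t) * (K * e) * (K * Γ - Λ) := by
        have h1 : ∀ i, fderiv ℝ (fderiv ℝ ψ) x (v i) (v i)
            = (q' (Y t) * (K * e) ^ 2 / ε + q (Y t) * (K ^ 2 * e)) * (fderiv ℝ r x (v i)) ^ 2
              + (q (Y t) * -(K * e)) * fderiv ℝ (fderiv ℝ r) x (v i) (v i) := by
          intro i
          rw [(hψe x hxW).fderiv.fderiv_eq]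
          exact hess_comp hφd hφd2 hr x (v i)
        rw [Finset.sum_congr rfl fun i _ => h1 i, Finset.sum_add_distrib, ← Finset.mul_sum,
          ← Finset.mul_sum]
        ring
      have hq0 : 0 ≤ q (Y t) := by positivity
      have hq1 : q (Y t) ≤ 1 := by
        simp only [hq]
        rw [div_le_one (by positivity)]
        linarith
      have hq'0 : 0 ≤ q' (Y t) := by positivity
      rw [hL]
      by_cases hdeep : t ≤ -η
      · rw [indicator_of_notMem, indicator_of_mem (show x ∈ S2 from ⟨hxW, hdeep⟩)]
        · have heA : e ≤ Real.exp (K * A) := by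
            refine Real.exp_le_exp.2 ?_
            have := hA2 x hxW
            nlinarith
          have h1 : 0 ≤ q' (Y t) * (K * e) ^ 2 / ε * Γ := by positivity
          have h2 : q (Y t) * (K * e) ≤ K * Real.exp (K * A) := by
            calc q (Y t) * (K * e) ≤ 1 * (K * Real.exp (K * A)) := by gcongr
              _ = _ := one_mul _
          have h20 : 0 ≤ q (Y t) * (K * e) := by positivity
          have h3 : -A ≤ K * Γ - Λ := by
            have : 0 ≤ K * Γ := by positivity
            linarith [hΛA.2]
          have h4 : -C1 ≤ q (Y t) * (K * e) * (K * Γ - Λ) := by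
            have : q (Y t) * (K * e) * (-A) ≤ q (Y t) * (K * e) * (K * Γ - Λ) :=
              mul_le_mul_of_nonneg_left h3 h20
            have : q (Y t) * (K * e) * A ≤ K * Real.exp (K * A) * A :=
              mul_le_mul_of_nonneg_right h2 hA.le
            rw [hC1]
            linarith
          have h5 : u x * (-C1) ≤ u x * (q' (Y t) * (K * e) ^ 2 / ε * Γ
              + q (Y t) * (K * e) * (K * Γ - Λ)) :=
            mul_le_mul_of_nonneg_left (by linarith) hux
          linarith
        · rintro ⟨-, h1, -⟩
          linarith
      · rw [indicator_of_notMem (fun h : x ∈ S2 => hdeep h.2)]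
        have hΓc : c ≤ Γ := hlow x hxW (not_le.1 hdeep)
        have h2 : 0 ≤ K * Γ - Λ := by
          have : K * c = A := by rw [hK]; field_simp
          nlinarith [hΛA.2]
        have h3 : 0 ≤ q (Y t) * (K * e) * (K * Γ - Λ) := by positivity
        by_cases hsh : x ∈ S1
        · rw [indicator_of_mem hsh]
          have hYl : K / 4 ≤ Y t := by
            have h4 : -(K * t) + 1 ≤ e := Real.add_one_le_exp _
            have h5 : K / 2 ≤ (e - 1) / ε := by
              rw [le_div_iff₀ hε]
              nlinarith [hsh.2.2]
            simp only [hY]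
            linarith
          have hYu : Y t ≤ X2 := by
            have h4 : e - 1 ≤ -(K * t) * e := by
              have h5 := Real.add_one_le_exp (K * t)
              have h6 : Real.exp (K * t) * e = 1 := by
                rw [he, ← Real.exp_add]; simp
              nlinarith
            have h5 : e ≤ Real.exp (K * η) := by
              refine Real.exp_le_exp.2 ?_
              nlinarith
            have h7 : -(K * t) ≤ K * (3 / 2 * ε) := by nlinarith [hsh.2.1]
            have h6 : (e - 1) / ε ≤ X2 := by
              rw [div_le_iff₀ hε, hX2]
              calc e - 1 ≤ -(K * t) * e := h4
                _ ≤ K * (3 / 2 * ε) * Real.exp (K * η) := by gcongr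
                _ = _ := by ring
            simp only [hY]
            linarith
          have hY0 : 0 ≤ Y t := by linarith
          have h4 : (K / 2) / (1 + X2 ^ 2) ^ 2 ≤ q' (Y t) := by
            simp only [hq', max_eq_left hY0]
            gcongr
            linarith
          have h5 : k / ε ≤ q' (Y t) * (K * e) ^ 2 / ε * Γ := by
            have h6 : K ^ 2 ≤ (K * e) ^ 2 := by
              apply pow_le_pow_left₀ hK0.le
              nlinarith
            calc k / ε = (K / 2) / (1 + X2 ^ 2) ^ 2 * K ^ 2 / ε * c := by rw [hk]; ring
              _ ≤ _ := by gcongr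
          have h6 : k / ε * u x ≤ (q' (Y t) * (K * e) ^ 2 / ε * Γ) * u x :=
            mul_le_mul_of_nonneg_right h5 hux
          have h7 : 0 ≤ u x * (q (Y t) * (K * e) * (K * Γ - Λ)) := mul_nonneg hux h3
          linarith
        · rw [indicator_of_notMem hsh]
          have : 0 ≤ u x * (q' (Y t) * (K * e) ^ 2 / ε * Γ
            + q (Y t) * (K * e) * (K * Γ - Λ)) := by positivity
          linarith
  have hii1 : Integrable (S1.indicator u) μ := (integrable_indicator_iff hS1c.measurableSet).2 hi1
  have hii2 : Integrable (S2.indicator u) μ := (integrable_indicator_iff hS2c.measurableSet).2 hi2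
  have hfin := integral_mono ((hii1.const_mul (k / ε)).sub (hii2.const_mul C1)) hint hkey
  rw [hzero] at hfin
  simp only [Pi.sub_apply] at hfin
  rw [integral_sub (hii1.const_mul _) (hii2.const_mul _), integral_const_mul, integral_const_mul,
    integral_indicator hS1c.measurableSet, integral_indicator hS2c.measurableSet] at hfin
  have h8 : k / ε * ∫ x in S1, u x ∂μ ≤ C1 * ∫ x in S2, u x ∂μ := by linarith
  rw [div_mul_eq_mul_div, div_le_iff₀ hε] at h8
  rw [div_mul_eq_mul_div, div_mul_eq_mul_div, le_div_iff₀ hk0]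
  linarith

end Shell

end LumerHardy

namespace LumerHardy

open Filter Topology Metric

/-! ### Level surfaces and averaging against their measure -/

section LevelSets

variable {n : ℕ}

theorem finrank_real_euclidean (n : ℕ) : Module.finrank ℝ (EuclideanSpace ℂ (Fin n)) = 2 * n := by
  rw [finrank_real_of_complex, finrank_euclideanSpace_fin]

/-- Near a regular point the level sets of a `C¹` function are Lipschitz graphs, so that they are
upper Ahlfors regular. -/
theorem exists_hausdorffMeasure_level_le (hn : 1 ≤ n) {ρ : EuclideanSpace ℂ (Fin n) → ℝ}
    {p : EuclideanSpace ℂ (Fin n)} (hρ : ContDiffAt ℝ 1 ρ p) (hp : fderiv ℝ ρ p ≠ 0) :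
    ∃ V, IsOpen V ∧ p ∈ V ∧ ∃ C : ℝ≥0, ∀ (t : ℝ) (w : EuclideanSpace ℂ (Fin n)) (s : ℝ), 0 ≤ s →
      Measure.hausdorffMeasure (2 * n - 1 : ℝ) ({z | ρ z = t} ∩ V ∩ closedBall w s)
        ≤ C * ENNReal.ofReal (s ^ (2 * n - 1)) := by
  set l := fderiv ℝ ρ p with hl
  obtain ⟨N, hN⟩ : ∃ N, l N = 1 := by
    obtain ⟨x, hx⟩ : ∃ x, l x ≠ 0 := by
      by_contra! h
      exact hp (ContinuousLinearMap.ext h)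
    exact ⟨(l x)⁻¹ • x, by simp [hx]⟩
  set K := LinearMap.ker l.toLinearMap with hK
  have hKr : Module.finrank ℝ K = Module.finrank ℝ (Fin (2 * n - 1) → ℝ) := by
    have h1 : Module.finrank ℝ K + 1 = Module.finrank ℝ (EuclideanSpace ℂ (Fin n)) := by
      refine Module.Dual.finrank_ker_add_one_of_ne_zero (f := l.toLinearMap) fun h => ?_
      have : l N = 0 := LinearMap.congr_fun h N
      rw [hN] at this
      exact one_ne_zero this
    rw [finrank_real_euclidean] at h1
    rw [Module.finrank_fin_fun]
    omega
  let e : K ≃L[ℝ] (Fin (2 * n - 1) → ℝ) := ContinuousLinearEquiv.ofFinrankEq hKr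
  let Pr : EuclideanSpace ℂ (Fin n) →L[ℝ] K :=
    (ContinuousLinearMap.id ℝ _ - l.smulRight N).codRestrict K (by
      intro x
      change l (x - l x • N) = 0
      simp [hN])
  have hPr : ∀ x, x = (Pr x : EuclideanSpace ℂ (Fin n)) + l x • N := by
    intro x
    change x = (x - l x • N) + l x • N
    abel
  let Q : EuclideanSpace ℂ (Fin n) →L[ℝ] (Fin (2 * n - 1) → ℝ) := (e : K →L[ℝ] _).comp Pr
  set B := ‖(e.symm : (Fin (2 * n - 1) → ℝ) →L[ℝ] K)‖ with hB
  have hnorm : ∀ x, ‖x‖ ≤ B * ‖Q x‖ + |l x| * ‖N‖ := by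
    intro x
    have h1 : ‖Pr x‖ ≤ B * ‖Q x‖ := by
      have := (e.symm : (Fin (2 * n - 1) → ℝ) →L[ℝ] K).le_opNorm (Q x)
      simpa [Q] using this
    calc ‖x‖ = ‖(Pr x : EuclideanSpace ℂ (Fin n)) + l x • N‖ := by rw [← hPr x]
      _ ≤ ‖(Pr x : EuclideanSpace ℂ (Fin n))‖ + ‖l x • N‖ := norm_add_le _ _
      _ ≤ _ := by
        rw [norm_smul, Real.norm_eq_abs]
        exact add_le_add h1 le_rfl
  -- Chosen so that `δ * ‖N‖ ≤ 1 / 2`, which lets the component along `N` be absorbed into the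
  -- left-hand side below.
  set δ : ℝ≥0 := 1 / (2 * (‖N‖₊ + 1)) with hδ
  have hδ0 : 0 < δ := by positivity
  obtain ⟨V', hV', happ⟩ := (hρ.hasStrictFDerivAt (by simp)).approximates_deriv_on_nhds
    (Or.inr hδ0)
  obtain ⟨V, hVV', hVo, hpV⟩ := _root_.mem_nhds_iff.1 hV'
  have hδN : (δ : ℝ) * ‖N‖ ≤ 1 / 2 := by
    rw [hδ]
    push_cast
    rw [div_mul_eq_mul_div, div_le_div_iff₀ (by positivity) (by norm_num)]
    nlinarith [norm_nonneg N]
  -- Two points of one level have the same value of `ρ`, so strict differentiability gives `|l (x -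
  -- y)| ≤ δ * ‖x - y‖`: the level set is a graph over the kernel of `l`, and `Q` has a Lipschitz
  -- inverse on it.
  have hanti : ∀ t, ∀ x ∈ {z | ρ z = t} ∩ V, ∀ y ∈ {z | ρ z = t} ∩ V,
      ‖x - y‖ ≤ 2 * B * ‖Q x - Q y‖ := by
    intro t x hx y hy
    have h1 := happ x (hVV' hx.2) y (hVV' hy.2)
    rw [show ρ x = t from hx.1, show ρ y = t from hy.1, sub_self, zero_sub, norm_neg,
      Real.norm_eq_abs, ← hl] at h1
    have h2 := hnorm (x - y)
    rw [map_sub Q] at h2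
    have h3 : |l (x - y)| * ‖N‖ ≤ 1 / 2 * ‖x - y‖ := by
      calc |l (x - y)| * ‖N‖ ≤ (δ * ‖x - y‖) * ‖N‖ := by gcongr
        _ = (δ * ‖N‖) * ‖x - y‖ := by ring
        _ ≤ _ := by gcongr
    linarith
  set D : ℝ≥0 := 2 * ‖(e.symm : (Fin (2 * n - 1) → ℝ) →L[ℝ] K)‖₊ with hD
  refine ⟨V, hVo, hpV, D ^ (2 * n - 1) * (2 * ‖Q‖₊) ^ (2 * n - 1), fun t w s hs => ?_⟩
  set S := {z | ρ z = t} ∩ V ∩ closedBall w s with hS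
  have hdim : (2 * n - 1 : ℝ) = ((2 * n - 1 : ℕ) : ℝ) := by
    rw [Nat.cast_sub (by omega)]
    push_cast
    ring
  have hinj : InjOn Q S := by
    intro x hx y hy hxy
    have := hanti t x hx.1 y hy.1
    rw [hxy, sub_self, norm_zero, mul_zero] at this
    exact sub_eq_zero.1 (norm_le_zero_iff.1 this)
  have hleft : ∀ x ∈ S, Function.invFunOn Q S (Q x) = x := fun x hx =>
    hinj.leftInvOn_invFunOn hx
  have hlip : LipschitzOnWith D (Function.invFunOn Q S) (Q '' S) := by
    refine LipschitzOnWith.of_dist_le_mul ?_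
    rintro _ ⟨x, hx, rfl⟩ _ ⟨y, hy, rfl⟩
    rw [hleft x hx, hleft y hy, dist_eq_norm, dist_eq_norm]
    simpa [hD, hB] using hanti t x hx.1 y hy.1
  have himg : Function.invFunOn Q S '' (Q '' S) = S := by
    rw [image_image]
    ext x
    constructor
    · rintro ⟨y, hy, rfl⟩
      simpa only [hleft y hy] using hy
    · intro hx
      exact ⟨x, hx, hleft x hx⟩
  have h1 := hlip.hausdorffMeasure_image_le (d := ((2 * n - 1 : ℕ) : ℝ)) (by positivity)
  rw [himg] at h1
  have h2 : Q '' S ⊆ closedBall (Q w) (‖Q‖ * s) := by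
    rintro _ ⟨x, hx, rfl⟩
    rw [mem_closedBall, dist_eq_norm, ← map_sub]
    refine (Q.le_opNorm _).trans ?_
    gcongr
    simpa [dist_eq_norm] using hx.2
  have h3 : Measure.hausdorffMeasure ((2 * n - 1 : ℕ) : ℝ) (Q '' S)
      ≤ ENNReal.ofReal ((2 * (‖Q‖ * s)) ^ (2 * n - 1)) := by
    refine (measure_mono h2).trans ?_
    have h4 : (Measure.hausdorffMeasure ((2 * n - 1 : ℕ) : ℝ) : Measure (Fin (2 * n - 1) → ℝ))
        = volume := by
      have := hausdorffMeasure_pi_real (ι := Fin (2 * n - 1))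
      rwa [Fintype.card_fin] at this
    rw [h4, Real.volume_pi_closedBall _ (by positivity), Fintype.card_fin]
  rw [hdim]
  refine h1.trans ?_
  calc (D : ℝ≥0∞) ^ ((2 * n - 1 : ℕ) : ℝ) * Measure.hausdorffMeasure ((2 * n - 1 : ℕ) : ℝ) (Q '' S)
      ≤ (D : ℝ≥0∞) ^ ((2 * n - 1 : ℕ) : ℝ) * ENNReal.ofReal ((2 * (‖Q‖ * s)) ^ (2 * n - 1)) := by
        gcongr
    _ = _ := by
      rw [ENNReal.rpow_natCast, show (2 * (‖Q‖ * s)) ^ (2 * n - 1)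
        = (2 * ‖Q‖) ^ (2 * n - 1) * s ^ (2 * n - 1) by rw [← mul_pow]; ring,
        ENNReal.ofReal_mul (by positivity)]
      push_cast
      rw [mul_assoc]
      congr 2
      rw [ENNReal.ofReal_pow (by positivity), ENNReal.ofReal_mul (by norm_num),
        ENNReal.ofReal_ofNat, ofReal_norm, enorm_eq_nnnorm]

variable {Ω : Set (EuclideanSpace ℂ (Fin n))} {u : EuclideanSpace ℂ (Fin n) → ℝ}

/-- A positive function with the mean value property is integrated against a measure `σ` with
small balls by means of its volume averages. -/
theorem MeanValueOn.lintegral_le (hu : MeanValueOn u Ω) (h0 : ∀ z ∈ Ω, 0 ≤ u z)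
    (σ : Measure (EuclideanSpace ℂ (Fin n))) [IsFiniteMeasure σ] {s : ℝ}
    {T : Set (EuclideanSpace ℂ (Fin n))} (hT : IsCompact T) (hTΩ : T ⊆ Ω)
    (hσT : ∀ᵐ z ∂σ, closedBall z s ⊆ T) {B : ℝ≥0∞} (hB : ∀ w, σ (closedBall w s) ≤ B) :
    volume (closedBall (0 : EuclideanSpace ℂ (Fin n)) s) * ∫⁻ z, ENNReal.ofReal (u z) ∂σ
      ≤ B * ENNReal.ofReal (∫ w in T, u w) := by
  classical
  have hTm : MeasurableSet T := hT.isClosed.measurableSet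
  set g : EuclideanSpace ℂ (Fin n) → ℝ := T.indicator u with hg
  have hgm : Measurable g := by
    rw [hg, ← piecewise_eq_indicator]
    exact (hu.1.mono hTΩ).measurable_piecewise continuousOn_const hTm
  have hTi : IntegrableOn u T := (hu.1.mono hTΩ).integrableOn_compact hT
  -- Integrating in `w` first gives the volume average of `u` near `z`; integrating in `z` first
  -- gives `u w` times the `σ`-measure of a ball, which is at most `B`.
  set F : EuclideanSpace ℂ (Fin n) → EuclideanSpace ℂ (Fin n) → ℝ≥0∞ := fun z w =>
    (closedBall w s).indicator (fun _ => ENNReal.ofReal (g w)) z with hF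
  have hFm : Measurable (Function.uncurry F) := by
    have : Function.uncurry F = {q : EuclideanSpace ℂ (Fin n) × EuclideanSpace ℂ (Fin n) |
        dist q.1 q.2 ≤ s}.indicator fun q => ENNReal.ofReal (g q.2) := by
      ext ⟨z, w⟩
      simp [hF, indicator, mem_closedBall]
    rw [this]
    refine Measurable.indicator ?_ ?_
    · exact (hgm.comp measurable_snd).ennreal_ofReal
    · exact (isClosed_le (continuous_fst.dist continuous_snd) continuous_const).measurableSet
  have h1 : ∀ᵐ z ∂σ, volume (closedBall (0 : EuclideanSpace ℂ (Fin n)) s) * ENNReal.ofReal (u z)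
      = ∫⁻ w, F z w := by
    filter_upwards [hσT] with z hz
    have h2 := hu.setIntegral_closedBall (hz.trans hTΩ)
    have h3 : ∫⁻ w, F z w = ∫⁻ w in closedBall z s, ENNReal.ofReal (u w) := by
      rw [← lintegral_indicator isClosed_closedBall.measurableSet]
      refine lintegral_congr fun w => ?_
      by_cases hw : dist z w ≤ s
      · have hw' : w ∈ closedBall z s := by rwa [mem_closedBall, dist_comm]
        rw [hF, indicator_of_mem hw']
        simp only
        rw [indicator_of_mem (mem_closedBall.2 hw), hg, indicator_of_mem (hz hw')]
      · have hw' : w ∉ closedBall z s := by rwa [mem_closedBall, dist_comm]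
        rw [hF, indicator_of_notMem hw']
        simp only
        rw [indicator_of_notMem (fun h => hw (mem_closedBall.1 h))]
    rw [h3, ← ofReal_integral_eq_lintegral_ofReal (hTi.mono_set hz), h2,
      mul_comm (u z), ENNReal.ofReal_mul measureReal_nonneg, measureReal_def,
      ENNReal.ofReal_toReal (isCompact_closedBall _ _).measure_lt_top.ne]
    exact (ae_restrict_mem isClosed_closedBall.measurableSet).mono fun w hw => h0 w (hTΩ (hz hw))
  rw [← lintegral_const_mul' _ _ (isCompact_closedBall _ _).measure_lt_top.ne,
    lintegral_congr_ae h1, lintegral_lintegral_swap hFm.aemeasurable]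
  have h4 : ∀ w, ∫⁻ z, F z w ∂σ ≤ B * ENNReal.ofReal (g w) := by
    intro w
    simp only [hF]
    rw [lintegral_indicator isClosed_closedBall.measurableSet, setLIntegral_const, mul_comm]
    gcongr
    exact hB w
  refine (lintegral_mono h4).trans ?_
  rw [lintegral_const_mul _ hgm.ennreal_ofReal]
  gcongr
  have h5 : 0 ≤ᵐ[volume] g := Eventually.of_forall fun w => by
    by_cases hw : w ∈ T
    · simp [hg, hw, h0 w (hTΩ hw)]
    · simp [hg, hw]
  rw [← ofReal_integral_eq_lintegral_ofReal ((integrable_indicator_iff hTm).2 hTi) h5,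
    integral_indicator hTm]

end LevelSets

/-! ### Compactness near the boundary and real coordinates -/

section Collar

variable {n : ℕ} {Ω : Set (EuclideanSpace ℂ (Fin n))} {ρ : EuclideanSpace ℂ (Fin n) → ℝ}

theorem IsC2DefiningFunction.isOpen (hρ : IsC2DefiningFunction Ω ρ) : IsOpen Ω := by
  rw [hρ.eq_setOf_neg]
  exact isOpen_lt hρ.contDiff.continuous continuous_const

theorem IsC2DefiningFunction.mem_iff (hρ : IsC2DefiningFunction Ω ρ)
    {z : EuclideanSpace ℂ (Fin n)} : z ∈ Ω ↔ ρ z < 0 := by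
  have h := hρ.eq_setOf_neg
  constructor
  · intro hz; rw [h] at hz; exact hz
  · intro hz; rw [h]; exact hz

theorem IsC2DefiningFunction.isCompact_le (hρ : IsC2DefiningFunction Ω ρ) {s : ℝ} (hs : 0 < s) :
    IsCompact {z | z ∈ Ω ∧ ρ z ≤ -s} := by
  have h : {z | z ∈ Ω ∧ ρ z ≤ -s} = {z | ρ z ≤ -s} := by
    ext z
    simp only [mem_ofPred_eq, and_iff_right_iff_imp]
    intro hz
    exact hρ.mem_iff.2 (by linarith)
  refine isCompact_of_isClosed_isBounded ?_ (hρ.isBounded.subset fun z hz => hz.1)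
  rw [h]
  exact isClosed_le hρ.contDiff.continuous continuous_const

theorem IsC2DefiningFunction.isCompact_closure (hρ : IsC2DefiningFunction Ω ρ) :
    IsCompact (closure Ω) :=
  hρ.isBounded.isCompact_closure

theorem IsC2DefiningFunction.isCompact_frontier (hρ : IsC2DefiningFunction Ω ρ) :
    IsCompact (frontier Ω) :=
  hρ.isCompact_closure.of_isClosed_subset isClosed_frontier frontier_subset_closure

/-- What remains of the closure outside `U` is a compact subset of `Ω`, on which `-ρ` has a positive
lower bound. -/
theorem IsC2DefiningFunction.exists_collar (hρ : IsC2DefiningFunction Ω ρ)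
    {U : Set (EuclideanSpace ℂ (Fin n))} (hU : IsOpen U) (hfU : frontier Ω ⊆ U) :
    ∃ η > 0, ∀ z ∈ Ω, -η < ρ z → z ∈ U := by
  have hK : IsCompact (closure Ω \ U) := hρ.isCompact_closure.diff hU
  have hpos : ∀ z ∈ closure Ω \ U, 0 < -ρ z := by
    rintro z ⟨hz, hzU⟩
    have : z ∈ Ω := by
      by_contra h
      exact hzU (hfU ⟨hz, fun h' => h (interior_subset h')⟩)
    have := hρ.mem_iff.1 this
    linarith
  obtain ⟨a, ha0, ha⟩ := hK.exists_forall_le' hρ.contDiff.continuous.neg.continuousOn hpos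
  refine ⟨a, ha0, fun z hz hza => ?_⟩
  by_contra h
  have : a ≤ -ρ z := ha z ⟨subset_closure hz, h⟩
  linarith

theorem IsC2DefiningFunction.eq_zero_of_mem_frontier (hρ : IsC2DefiningFunction Ω ρ)
    {z : EuclideanSpace ℂ (Fin n)} (hz : z ∈ frontier Ω) : ρ z = 0 := by
  have h1 : ρ z ≤ 0 := by
    have : closure Ω ⊆ {z | ρ z ≤ 0} := closure_minimal
      (fun z hz => (hρ.mem_iff.1 hz).le) (isClosed_le hρ.contDiff.continuous continuous_const)
    exact this hz.1
  have h2 : ¬ ρ z < 0 := fun h => by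
    have := hz.2
    rw [hρ.isOpen.interior_eq] at this
    exact this (hρ.mem_iff.2 h)
  linarith

/-- The standard real basis of `ℂⁿ`. -/
noncomputable def realBasis (n : ℕ) (i : Fin n × Fin 2) : EuclideanSpace ℂ (Fin n) :=
  (![1, Complex.I] i.2) • EuclideanSpace.single i.1 1

theorem eq_zero_of_realBasis {l : EuclideanSpace ℂ (Fin n) →L[ℝ] ℝ}
    (hl : ∀ i, l (realBasis n i) = 0) : l = 0 := by
  ext x
  have hx : x = ∑ j, ((x j).re • realBasis n (j, 0) + (x j).im • realBasis n (j, 1)) := by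
    ext k
    simp only [realBasis, WithLp.ofLp_sum, Finset.sum_apply, PiLp.add_apply, PiLp.smul_apply]
    rw [Finset.sum_eq_single k]
    · simp
    · intro j _ hj
      simp [hj.symm]
    · simp
  rw [hx]
  simp [hl]

theorem sum_hess_realBasis (f : EuclideanSpace ℂ (Fin n) → ℝ) (x : EuclideanSpace ℂ (Fin n)) :
    ∑ i, fderiv ℝ (fderiv ℝ f) x (realBasis n i) (realBasis n i)
      = ∑ j, lineLaplacian f (EuclideanSpace.single j 1) x := by
  rw [Fintype.sum_prod_type]
  refine Finset.sum_congr rfl fun j _ => ?_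
  simp [Fin.sum_univ_two, realBasis, lineLaplacian]

end Collar

end LumerHardy

namespace LumerHardy

open Filter Topology Metric

/-! ### Continuous inclusion into the Hardy space -/

section Inclusion

variable {n : ℕ} {Ω : Set (EuclideanSpace ℂ (Fin n))} {ρ : EuclideanSpace ℂ (Fin n) → ℝ}

theorem continuous_hess (hρ : ContDiff ℝ 2 ρ) (w : EuclideanSpace ℂ (Fin n)) :
    Continuous fun z => fderiv ℝ (fderiv ℝ ρ) z w w := by
  have h1 : ContDiff ℝ 1 (fderiv ℝ ρ) := hρ.fderiv_right (by norm_num)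
  exact ((h1.continuous_fderiv (by simp)).clm_apply continuous_const).clm_apply continuous_const

theorem continuous_fderiv_of_contDiff_two (hρ : ContDiff ℝ 2 ρ) : Continuous (fderiv ℝ ρ) :=
  hρ.continuous_fderiv (by simp)

/-- The mass of a positive pluriharmonic function on thin shells near the boundary. -/
theorem IsC2DefiningFunction.exists_shell_le (hρ : IsC2DefiningFunction Ω ρ)
    {P₀ : EuclideanSpace ℂ (Fin n)} (hP₀ : P₀ ∈ Ω) :
    ∃ ε₀ > 0, ∃ C > 0, ∀ u, PluriharmonicOn u Ω → (∀ z ∈ Ω, 0 ≤ u z) → ∀ ε, 0 < ε → ε < ε₀ →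
      ∫ z in {z | z ∈ Ω ∧ -(3 / 2 * ε) ≤ ρ z ∧ ρ z ≤ -(ε / 2)}, u z ≤ C * ε * u P₀ := by
  have hG : Continuous fun z => ∑ i, (fderiv ℝ ρ z (realBasis n i)) ^ 2 :=
    continuous_finsetSum _ fun i _ =>
      ((continuous_fderiv_of_contDiff_two hρ.contDiff).clm_apply continuous_const).pow 2
  obtain ⟨c, hc0, hc⟩ := hρ.isCompact_frontier.exists_forall_le' hG.continuousOn (a := 0) (by
    intro z hz
    by_contra h
    refine hρ.fderiv_ne_zero z hz (eq_zero_of_realBasis fun i => ?_)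
    have h0 : ∑ i, (fderiv ℝ ρ z (realBasis n i)) ^ 2 = 0 :=
      le_antisymm (not_lt.1 h) (Finset.sum_nonneg fun i _ => sq_nonneg _)
    rw [Finset.sum_eq_zero_iff_of_nonneg fun i _ => sq_nonneg _] at h0
    exact pow_eq_zero_iff two_ne_zero |>.1 (h0 i (Finset.mem_univ i)))
  obtain ⟨η, hη0, hη⟩ := hρ.exists_collar (isOpen_lt continuous_const hG)
    (fun z hz => show c / 2 < _ from lt_of_lt_of_le (by linarith) (hc z hz))
  have hL : Continuous fun z => ∑ i, fderiv ℝ (fderiv ℝ ρ) z (realBasis n i) (realBasis n i) :=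
    continuous_finsetSum _ fun i _ => continuous_hess hρ.contDiff _
  obtain ⟨A1, hA1⟩ := hρ.isCompact_closure.exists_bound_of_continuousOn hL.continuousOn
  obtain ⟨A2, hA2⟩ := hρ.isCompact_closure.exists_bound_of_continuousOn
    hρ.contDiff.continuous.continuousOn
  obtain ⟨C, hC0, hC⟩ := exists_shell_estimate (volume : Measure (EuclideanSpace ℂ (Fin n)))
    (realBasis n) (c := c / 2) (A := max (max A1 A2) 1) (η := η) (by linarith) (by positivity) hη0
  obtain ⟨H, hH0, hH⟩ := exists_harnack hρ.isOpen hρ.isConnected.isPreconnected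
    (hρ.isCompact_le hη0) (fun z hz => hz.1) hP₀
  set V := volume.real {z | z ∈ Ω ∧ ρ z ≤ -η} with hV
  refine ⟨η / 2, by positivity, C * (H * V + 1), by positivity, fun u hu h0 ε hε hεη => ?_⟩
  have h1 := hC Ω ρ hρ.isOpen hρ.contDiff (fun z hz => hρ.mem_iff.1 hz)
    (fun s hs => hρ.isCompact_le hs) (fun z hz hzη => (hη z hz hzη).le)
    (fun z hz => (hA1 z (subset_closure hz)).trans ((le_max_left _ _).trans (le_max_left _ _)))
    (fun z hz => (neg_le_of_abs_le ((hA2 z (subset_closure hz)).trans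
      ((le_max_right _ _).trans (le_max_left _ _))))) u hu.1 h0
    (fun z hz => by
      rw [sum_hess_realBasis]
      exact Finset.sum_eq_zero fun j _ => hu.lineLaplacian_eq_zero hρ.isOpen hz _)
    ε hε (by linarith)
  have hK := hρ.isCompact_le hη0
  have h2 : ∫ z in {z | z ∈ Ω ∧ ρ z ≤ -η}, u z ≤ H * V * u P₀ := by
    have hi : IntegrableOn u {z | z ∈ Ω ∧ ρ z ≤ -η} :=
      (hu.continuousOn.mono fun z hz => hz.1).integrableOn_compact hK
    have hi2 : IntegrableOn (fun _ => H * u P₀) {z | z ∈ Ω ∧ ρ z ≤ -η} :=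
      integrableOn_const hK.measure_lt_top.ne
    refine (setIntegral_mono_on hi hi2 hK.measurableSet
      (hH u (hu.meanValueOn hρ.isOpen) h0)).trans ?_
    rw [setIntegral_const, smul_eq_mul]
    exact le_of_eq (by ring)
  have h3 := h0 P₀ hP₀
  calc _ ≤ C * ε * ∫ z in {z | z ∈ Ω ∧ ρ z ≤ -η}, u z := h1
    _ ≤ C * ε * (H * V * u P₀) := by gcongr
    _ ≤ C * ε * ((H * V + 1) * u P₀) := by
      gcongr
      linarith
    _ = _ := by ring

/-- Balls around the points of a level surface stay in a shell. -/
theorem IsC2DefiningFunction.exists_ball_subset_shell (hρ : IsC2DefiningFunction Ω ρ) :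
    ∃ κ > 0, ∀ ε, 0 < ε → ε < 1 → ∀ z, ρ z = -ε →
      closedBall z (κ * ε) ⊆ {z | z ∈ Ω ∧ -(3 / 2 * ε) ≤ ρ z ∧ ρ z ≤ -(ε / 2)} := by
  obtain ⟨R, hR⟩ := hρ.isBounded.subset_closedBall (0 : EuclideanSpace ℂ (Fin n))
  obtain ⟨L, hL⟩ := (isCompact_closedBall (0 : EuclideanSpace ℂ (Fin n)) (R + 1)
    ).exists_bound_of_continuousOn (continuous_fderiv_of_contDiff_two hρ.contDiff).continuousOn
  set L' := max L 1 with hL'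
  have hL0 : 0 < L' := by positivity
  -- `L'` is a Lipschitz constant of `ρ` on a ball containing the unit neighbourhood of `Ω`, so `ρ`
  -- changes by at most `ε / 2` over the distance `ε / (2 * L')`.
  refine ⟨1 / (2 * L'), by positivity, fun ε hε hε1 z hz w hw => ?_⟩
  have hκ : 1 / (2 * L') * ε ≤ 1 := by
    have : 1 / (2 * L') ≤ 1 := by
      rw [div_le_one (by positivity)]
      linarith [le_max_right L 1]
    nlinarith
  have hzΩ : z ∈ Ω := hρ.mem_iff.2 (by linarith)
  have hzR : ‖z‖ ≤ R := by simpa using hR hzΩ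
  have hz' : z ∈ closedBall (0 : EuclideanSpace ℂ (Fin n)) (R + 1) := by
    rw [mem_closedBall_zero_iff]; linarith
  rw [mem_closedBall, dist_eq_norm] at hw
  have hw' : w ∈ closedBall (0 : EuclideanSpace ℂ (Fin n)) (R + 1) := by
    rw [mem_closedBall_zero_iff]
    have := norm_add_le (w - z) z
    rw [sub_add_cancel] at this
    linarith
  have h := (convex_closedBall (0 : EuclideanSpace ℂ (Fin n)) (R + 1)).norm_image_sub_le_of_norm_fderiv_le
    (𝕜 := ℝ) (f := ρ) (C := L') (fun x _ => hρ.contDiff.differentiable (by simp) x)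
    (fun x hx => (hL x hx).trans (le_max_left _ _)) hz' hw'
  have h2 : |ρ w - ρ z| ≤ ε / 2 := by
    refine h.trans ?_
    calc L' * ‖w - z‖ ≤ L' * (1 / (2 * L') * ε) := by gcongr
      _ = ε / 2 := by field_simp
  rw [hz] at h2
  have h3 := abs_le.1 h2
  exact ⟨hρ.mem_iff.2 (by linarith), by linarith, by linarith⟩

theorem IsC2DefiningFunction.isCompact_shell (hρ : IsC2DefiningFunction Ω ρ) {ε : ℝ} (hε : 0 < ε) :
    IsCompact {z | z ∈ Ω ∧ -(3 / 2 * ε) ≤ ρ z ∧ ρ z ≤ -(ε / 2)} := by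
  have := (hρ.isCompact_le (half_pos hε)).inter_right
    (isClosed_le continuous_const hρ.contDiff.continuous : IsClosed {z | -(3 / 2 * ε) ≤ ρ z})
  convert this using 1
  ext z
  simp only [mem_ofPred_eq, mem_inter_iff]
  tauto

/-- The surface integrals of positive pluriharmonic functions over the level surfaces near the
boundary. -/
theorem IsC2DefiningFunction.exists_lintegral_level_le (hn : 1 ≤ n)
    (hρ : IsC2DefiningFunction Ω ρ) {P₀ : EuclideanSpace ℂ (Fin n)} (hP₀ : P₀ ∈ Ω) :
    ∃ ε₀ > 0, ∃ C : ℝ≥0, ∀ u, PluriharmonicOn u Ω → (∀ z ∈ Ω, 0 ≤ u z) → ∀ ε, 0 < ε → ε < ε₀ →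
      ∫⁻ z in {z | ρ z = -ε}, ENNReal.ofReal (u z) ∂(Measure.hausdorffMeasure (2 * n - 1 : ℝ))
        ≤ C * ENNReal.ofReal (u P₀) := by
  obtain ⟨ε₁, hε₁, C₁, hC₁0, hC₁⟩ := hρ.exists_shell_le hP₀
  obtain ⟨κ, hκ0, hκ⟩ := hρ.exists_ball_subset_shell
  set σ : Measure (EuclideanSpace ℂ (Fin n)) := Measure.hausdorffMeasure (2 * n - 1 : ℝ) with hσ
  -- Regularity of level sets is only local, so compactness of the boundary is used to add up
  -- finitely many local estimates; levels close to zero lie in the union of the patches.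
  have hlocal : ∃ U, IsOpen U ∧ frontier Ω ⊆ U ∧ ∃ C : ℝ≥0, ∀ u, PluriharmonicOn u Ω →
      (∀ z ∈ Ω, 0 ≤ u z) → ∀ ε, 0 < ε → ε < min ε₁ 1 →
      ∫⁻ z in {z | ρ z = -ε} ∩ U, ENNReal.ofReal (u z) ∂σ ≤ C * ENNReal.ofReal (u P₀) := by
    refine hρ.isCompact_frontier.induction_on (p := fun S => ∃ U, IsOpen U ∧ S ⊆ U ∧
      ∃ C : ℝ≥0, ∀ u, PluriharmonicOn u Ω →
      (∀ z ∈ Ω, 0 ≤ u z) → ∀ ε, 0 < ε → ε < min ε₁ 1 →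
      ∫⁻ z in {z | ρ z = -ε} ∩ U, ENNReal.ofReal (u z) ∂σ ≤ C * ENNReal.ofReal (u P₀)) ?_ ?_ ?_ ?_
    · exact ⟨∅, isOpen_empty, Subset.rfl, 0, by simp⟩
    · rintro S T hST ⟨U, hU, hTU, C, hC⟩
      exact ⟨U, hU, hST.trans hTU, C, hC⟩
    · rintro S T ⟨U, hU, hSU, C, hC⟩ ⟨U', hU', hTU', C', hC'⟩
      refine ⟨U ∪ U', hU.union hU', union_subset_union hSU hTU', C + C', ?_⟩
      intro u hu h0 ε hε hε1
      rw [inter_union_distrib_left]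
      refine (lintegral_union_le _ _ _).trans ?_
      rw [ENNReal.coe_add, add_mul]
      exact add_le_add (hC u hu h0 ε hε hε1) (hC' u hu h0 ε hε hε1)
    · intro p hp
      obtain ⟨V, hVo, hpV, C, hC⟩ := exists_hausdorffMeasure_level_le hn
        (hρ.contDiff.contDiffAt.of_le (by norm_num)) (hρ.fderiv_ne_zero p hp)
      set v1 := volume.real (closedBall (0 : EuclideanSpace ℂ (Fin n)) 1) with hv1
      have hv10 : 0 < v1 := measureReal_closedBall_pos one_pos
      refine ⟨V, mem_nhdsWithin_of_mem_nhds (hVo.mem_nhds hpV), V, hVo, Subset.rfl,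
        C * Real.toNNReal (C₁ / (κ * v1)), fun u hu h0 ε hε hε1 => ?_⟩
      have hε1' : ε < ε₁ := hε1.trans_le (min_le_left _ _)
      have hε1'' : ε < 1 := hε1.trans_le (min_le_right _ _)
      set s := κ * ε with hs
      have hs0 : 0 < s := by positivity
      set S := {z | ρ z = -ε} ∩ V with hS
      have hlevm : MeasurableSet {z | ρ z = -ε} :=
        (isClosed_eq hρ.contDiff.continuous continuous_const).measurableSet
      have hSm : MeasurableSet S := hlevm.inter hVo.measurableSet
      have hfin : IsFiniteMeasure (σ.restrict S) := by
        obtain ⟨R, hR0, hR⟩ := hρ.isBounded.subset_closedBall_lt 0 (0 : EuclideanSpace ℂ (Fin n))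
        refine ⟨?_⟩
        rw [Measure.restrict_apply_univ]
        refine (measure_mono (t := {z | ρ z = -ε} ∩ V ∩ closedBall 0 R) ?_).trans_lt
          ((hC (-ε) 0 R hR0.le).trans_lt (ENNReal.mul_lt_top ENNReal.coe_lt_top ENNReal.ofReal_lt_top))
        intro z hz
        refine ⟨hz, hR (hρ.mem_iff.2 ?_)⟩
        rw [show ρ z = -ε from hz.1]; linarith
      have hmain := (hu.meanValueOn hρ.isOpen).lintegral_le h0 (σ.restrict S) (s := s)
        (hρ.isCompact_shell hε) (fun z hz => hz.1)
        ((ae_restrict_mem hSm).mono fun z hz => hκ ε hε hε1'' z hz.1)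
        (B := C * ENNReal.ofReal (s ^ (2 * n - 1))) (fun w => by
          rw [Measure.restrict_apply isClosed_closedBall.measurableSet, inter_comm]
          exact hC (-ε) w s hs0.le)
      -- The volume is split into `s ^ (2n-1)`, which cancels against the surface measure of a ball,
      -- and one further factor `s = κ * ε`, which cancels the `ε` of the shell bound.
      have hvol : volume (closedBall (0 : EuclideanSpace ℂ (Fin n)) s)
          = ENNReal.ofReal (s ^ (2 * n - 1)) * ENNReal.ofReal (s * v1) := by
        rw [← ENNReal.ofReal_toReal (isCompact_closedBall (0 : EuclideanSpace ℂ (Fin n)) s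
          ).measure_lt_top.ne, ← measureReal_def, Measure.addHaar_real_closedBall' _ _ hs0.le,
          finrank_real_euclidean, ← ENNReal.ofReal_mul (by positivity), ← mul_assoc, ← pow_succ]
        congr 3
        omega
      have hI := hC₁ u hu h0 ε hε hε1'
      rw [hvol] at hmain
      have hsp : ENNReal.ofReal (s ^ (2 * n - 1)) ≠ 0 := by
        simp only [ne_eq, ENNReal.ofReal_eq_zero, not_le]; positivity
      have hsv : ENNReal.ofReal (s * v1) ≠ 0 := by
        simp only [ne_eq, ENNReal.ofReal_eq_zero, not_le]; positivity
      have h1 : ENNReal.ofReal (s * v1) * ∫⁻ z in S, ENNReal.ofReal (u z) ∂σ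
          ≤ C * ENNReal.ofReal (C₁ * ε * u P₀) := by
        rw [← ENNReal.mul_le_mul_iff_right hsp ENNReal.ofReal_ne_top]
        calc _ = ENNReal.ofReal (s ^ (2 * n - 1)) * ENNReal.ofReal (s * v1)
              * ∫⁻ z in S, ENNReal.ofReal (u z) ∂σ := (mul_assoc _ _ _).symm
          _ ≤ _ := hmain
          _ ≤ C * ENNReal.ofReal (s ^ (2 * n - 1)) * ENNReal.ofReal (C₁ * ε * u P₀) := by gcongr
          _ = _ := by ring
      have h2 : C₁ * ε * u P₀ = s * v1 * (C₁ / (κ * v1) * u P₀) := by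
        rw [hs]; field_simp
      rw [h2, ENNReal.ofReal_mul (p := s * v1) (by positivity), mul_left_comm,
        ENNReal.mul_le_mul_iff_right hsv ENNReal.ofReal_ne_top,
        ENNReal.ofReal_mul (p := C₁ / (κ * v1)) (by positivity), ← mul_assoc] at h1
      rw [ENNReal.coe_mul]
      exact h1
  obtain ⟨U, hU, hfU, C, hC⟩ := hlocal
  obtain ⟨η, hη0, hη⟩ := hρ.exists_collar hU hfU
  refine ⟨min (min ε₁ 1) η, by positivity, C, fun u hu h0 ε hε hε1 => ?_⟩
  have hsub : {z | ρ z = -ε} = {z | ρ z = -ε} ∩ U := by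
    refine (inter_eq_left.2 fun z hz => ?_).symm
    have hz' : ρ z = -ε := hz
    refine hη z (hρ.mem_iff.2 (by linarith)) ?_
    have := hε1.trans_le (min_le_right _ _)
    linarith
  rw [hsub]
  exact hC u hu h0 ε hε (hε1.trans_le (min_le_left _ _))

theorem exists_hardyNorm_le (hn : 1 ≤ n) (hρ : IsC2DefiningFunction Ω ρ) (P₀ : Ω) :
    ∃ ε₀ > (0 : ℝ), ∃ C : ℝ≥0, ∀ f : LumerSpace Ω P₀,
      hardyNorm ρ ε₀ f.toFun ≤ C * ENNReal.ofReal ‖f‖ := by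
  obtain ⟨ε₀, hε₀, C, hC⟩ := hρ.exists_lintegral_level_le hn P₀.2
  refine ⟨ε₀, hε₀, NNReal.sqrt C, fun f => ?_⟩
  -- The infimum that defines the norm need not be attained, so the bound is proved for every `r >
  -- ‖f‖` and then `r` tends to `‖f‖`.
  have hle : ∀ r : ℝ, ‖f‖ < r → hardyNorm ρ ε₀ f.toFun ≤ NNReal.sqrt C * ENNReal.ofReal r := by
    intro r hr
    obtain ⟨u, hu, hur⟩ := LumerSpace.exists_majorant_le_sq hr
    have hr0 : 0 ≤ r := (LumerSpace.norm_nonneg' f).trans hr.le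
    refine iSup₂_le fun ε hε => ?_
    have h1 : levelIntegral ρ f.toFun ε ≤ (NNReal.sqrt C * ENNReal.ofReal r) ^ 2 := by
      have h2 : levelIntegral ρ f.toFun ε ≤ ∫⁻ z in {z | ρ z = -ε}, ENNReal.ofReal (u z)
          ∂(Measure.hausdorffMeasure (2 * n - 1 : ℝ)) := by
        refine setLIntegral_mono' (isClosed_eq hρ.contDiff.continuous
          continuous_const).measurableSet fun z hz => ?_
        have hz' : ρ z = -ε := hz
        have hzΩ : z ∈ Ω := hρ.mem_iff.2 (by linarith [hε.1])
        have h3 := extZero_apply f.toFun ⟨z, hzΩ⟩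
        rw [h3, ← ofReal_norm, ← ENNReal.ofReal_pow (norm_nonneg _)]
        exact ENNReal.ofReal_le_ofReal (hu.2 ⟨z, hzΩ⟩)
      refine h2.trans ((hC u hu.1 hu.nonneg ε hε.1 hε.2).trans ?_)
      rw [mul_pow, ← ENNReal.ofReal_pow hr0, ← ENNReal.coe_pow, NNReal.sq_sqrt]
      gcongr
    calc (levelIntegral ρ f.toFun ε) ^ (1 / 2 : ℝ)
        ≤ ((NNReal.sqrt C * ENNReal.ofReal r) ^ 2) ^ (1 / 2 : ℝ) := by gcongr
      _ = _ := by
        rw [← ENNReal.rpow_natCast, ← ENNReal.rpow_mul]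
        norm_num
  have hlim : Tendsto (fun r : ℝ => (NNReal.sqrt C : ℝ≥0∞) * ENNReal.ofReal r) (𝓝[>] ‖f‖)
      (𝓝 (NNReal.sqrt C * ENNReal.ofReal ‖f‖)) := by
    refine Tendsto.mono_left ?_ nhdsWithin_le_nhds
    exact ENNReal.Tendsto.const_mul (ENNReal.tendsto_ofReal tendsto_id)
      (Or.inr ENNReal.coe_ne_top)
  exact ge_of_tendsto hlim (eventually_mem_nhdsWithin.mono fun r hr => hle r hr)

end Inclusion

end LumerHardy

namespace LumerHardy

open Filter Topology Metric

/-! ### Strong convexity from a Hessian bound -/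

section StrongConvexity

variable {E : Type*} [NormedAddCommGroup E] [NormedSpace ℝ E]

/-- The first order characterization of strong convexity, from a lower bound for the Hessian. -/
theorem add_fderiv_add_sq_le {f : E → ℝ} (hf : ContDiff ℝ 2 f) {S : Set E} (hS : Convex ℝ S)
    {c : ℝ} (hc : ∀ z ∈ S, ∀ x, 2 * c * ‖x‖ ^ 2 ≤ fderiv ℝ (fderiv ℝ f) z x x)
    {p z : E} (hp : p ∈ S) (hz : z ∈ S) :
    f p + fderiv ℝ f p (z - p) + c * ‖z - p‖ ^ 2 ≤ f z := by
  set d := z - p with hd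
  have hline : ∀ t : ℝ, HasDerivAt (fun t : ℝ => p + t • d) d t := fun t => by
    simpa using ((hasDerivAt_id t).smul_const d).const_add p
  have hmem : ∀ t ∈ Icc (0 : ℝ) 1, p + t • d ∈ S := fun t ht =>
    hS.add_smul_sub_mem hp hz ht
  have h1 : ∀ t : ℝ, HasDerivAt (fun t : ℝ => f (p + t • d)) (fderiv ℝ f (p + t • d) d) t :=
    fun t => ((hf.differentiable (by simp) _).hasFDerivAt).comp_hasDerivAt t (hline t)
  have h2 : ∀ t : ℝ, HasDerivAt (fun t : ℝ => fderiv ℝ f (p + t • d) d)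
      (fderiv ℝ (fderiv ℝ f) (p + t • d) d d) t := fun t => by
    have h := (((hf.fderiv_right (m := 1) (by norm_num)).differentiable (by simp)
      (p + t • d)).hasFDerivAt).comp_hasDerivAt t (hline t)
    have h' := h.clm_apply (hasDerivAt_const t d)
    simpa using h'
  -- Integrating the Hessian bound once along the segment bounds the slope; the second integration
  -- below gives the quadratic term.
  have h3 : ∀ t ∈ Icc (0 : ℝ) 1,
      fderiv ℝ f p d + 2 * c * ‖d‖ ^ 2 * t ≤ fderiv ℝ f (p + t • d) d := by
    have hmono : MonotoneOn (fun t : ℝ => fderiv ℝ f (p + t • d) d - 2 * c * ‖d‖ ^ 2 * t)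
        (Icc 0 1) := by
      have hder : ∀ t : ℝ, HasDerivAt
          (fun t : ℝ => fderiv ℝ f (p + t • d) d - 2 * c * ‖d‖ ^ 2 * t)
          (fderiv ℝ (fderiv ℝ f) (p + t • d) d d - 2 * c * ‖d‖ ^ 2) t := fun t => by
        refine ((h2 t).fun_sub ((hasDerivAt_id t).const_mul (2 * c * ‖d‖ ^ 2))).congr_deriv ?_
        ring
      refine monotoneOn_of_deriv_nonneg (convex_Icc 0 1)
        (fun t _ => (hder t).continuousAt.continuousWithinAt)
        (fun t _ => (hder t).differentiableAt.differentiableWithinAt) fun t ht => ?_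
      rw [(hder t).deriv, sub_nonneg]
      exact hc _ (hmem t (interior_subset ht)) d
    intro t ht
    have := hmono (left_mem_Icc.2 zero_le_one) ht ht.1
    simp only [zero_smul, add_zero, mul_zero, sub_zero] at this
    linarith
  have hmono : MonotoneOn (fun t : ℝ => f (p + t • d) - (fderiv ℝ f p d * t + c * ‖d‖ ^ 2 * t ^ 2))
      (Icc 0 1) := by
    have hder : ∀ t : ℝ, HasDerivAt
        (fun t : ℝ => f (p + t • d) - (fderiv ℝ f p d * t + c * ‖d‖ ^ 2 * t ^ 2))
        (fderiv ℝ f (p + t • d) d - (fderiv ℝ f p d + c * ‖d‖ ^ 2 * (2 * t))) t := fun t => by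
      have h4 : HasDerivAt (fun t : ℝ => t ^ 2) (2 * t) t := by simpa using hasDerivAt_pow 2 t
      refine ((h1 t).fun_sub (((hasDerivAt_id t).const_mul (fderiv ℝ f p d)).fun_add
        (h4.const_mul (c * ‖d‖ ^ 2)))).congr_deriv ?_
      ring
    refine monotoneOn_of_deriv_nonneg (convex_Icc 0 1)
      (fun t _ => (hder t).continuousAt.continuousWithinAt)
      (fun t _ => (hder t).differentiableAt.differentiableWithinAt) fun t ht => ?_
    rw [(hder t).deriv, sub_nonneg]
    have := h3 t (interior_subset ht)
    linarith
  have := hmono (left_mem_Icc.2 zero_le_one) (right_mem_Icc.2 zero_le_one) zero_le_one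
  have hz' : p + d = z := by rw [hd, add_sub_cancel]
  simp only [zero_smul, add_zero, mul_zero, one_smul, hz', mul_one, one_pow] at this
  norm_num only at this
  linarith

end StrongConvexity

/-! ### A strongly convex boundary point -/

section FarthestPoint

variable {n : ℕ} {Ω : Set (EuclideanSpace ℂ (Fin n))} {ρ : EuclideanSpace ℂ (Fin n) → ℝ}

/-- The norm attains its maximum on the compact closure. A maximum point inside `Ω` could be pushed
radially outwards, and it is not `0` because a nonempty open set is not a single point when `n ≥ 1`.
-/
theorem IsC2DefiningFunction.exists_farthest (hn : 1 ≤ n) (hρ : IsC2DefiningFunction Ω ρ) :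
    ∃ ζ ∈ frontier Ω, ζ ≠ 0 ∧ ∀ z ∈ Ω, ‖z‖ ≤ ‖ζ‖ := by
  have hne : (closure Ω).Nonempty := hρ.isConnected.nonempty.closure
  obtain ⟨ζ, hζ, hmax⟩ := hρ.isCompact_closure.exists_isMaxOn hne continuous_norm.continuousOn
  have hmax' : ∀ z ∈ Ω, ‖z‖ ≤ ‖ζ‖ := fun z hz => hmax (subset_closure hz)
  have hnt : Nontrivial (EuclideanSpace ℂ (Fin n)) := by
    have : Nonempty (Fin n) := ⟨⟨0, by omega⟩⟩
    infer_instance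
  have hζ0 : ζ ≠ 0 := by
    rintro rfl
    obtain ⟨z, hz⟩ := hρ.isConnected.nonempty
    have hz0 : Ω ⊆ {0} := fun w hw => by simpa using hmax' w hw
    have h1 : Ω = {z} := by
      ext w
      constructor
      · intro hw
        have h2 : w = 0 := hz0 hw
        have h3 : z = 0 := hz0 hz
        simp [h2, h3]
      · rintro rfl; exact hz
    have : IsOpen ({z} : Set (EuclideanSpace ℂ (Fin n))) := h1 ▸ hρ.isOpen
    exact not_isOpen_singleton z this
  refine ⟨ζ, ⟨hζ, ?_⟩, hζ0, hmax'⟩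
  rw [hρ.isOpen.interior_eq]
  intro hζΩ
  have hcont : ContinuousAt (fun t : ℝ => (1 + t) • ζ) 0 := by fun_prop
  have hev : ∀ᶠ t : ℝ in 𝓝 0, (1 + t) • ζ ∈ Ω := hcont (hρ.isOpen.mem_nhds (by simpa using hζΩ))
  obtain ⟨δ, hδ0, hδ⟩ := Metric.eventually_nhds_iff.1 hev
  have h1 := hmax' _ (hδ (y := δ / 2) (by rw [Real.dist_eq, sub_zero, abs_of_pos] <;> linarith))
  rw [norm_smul, Real.norm_of_nonneg (by linarith)] at h1
  have : 0 < ‖ζ‖ := norm_pos_iff.2 hζ0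
  nlinarith

/-- The first and second order conditions at a point of `{ρ < 0}` farthest from the origin. -/
theorem farthest_conditions (hρ : ContDiff ℝ 2 ρ) {ζ : EuclideanSpace ℂ (Fin n)} (hζ : ρ ζ = 0)
    (hζ0 : ζ ≠ 0) (hd : fderiv ℝ ρ ζ ≠ 0) (hmax : ∀ z, ρ z < 0 → ‖z‖ ≤ ‖ζ‖) :
    ∃ μ > 0, (∀ x, inner ℝ ζ x = μ * fderiv ℝ ρ ζ x) ∧
      ∀ v, fderiv ℝ ρ ζ v = 0 → ‖v‖ ^ 2 ≤ μ * fderiv ℝ (fderiv ℝ ρ) ζ v v := by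
  set l := fderiv ℝ ρ ζ with hl
  -- Moving in such a direction enters `{ρ < 0}`, so the norm cannot increase to first order.
  -- Perturbing vectors in the kernel of `l` by `-t • N` then shows that `inner ℝ ζ` vanishes on
  -- that kernel and is a multiple of `l`.
  have hneg : ∀ x, l x < 0 → inner ℝ ζ x ≤ 0 := by
    intro x hx
    by_contra! hpos
    have hder : HasDerivAt (fun t : ℝ => ρ (ζ + t • x)) (l x) 0 := by
      have h1 : HasDerivAt (fun t : ℝ => ζ + t • x) x 0 := by
        simpa using ((hasDerivAt_id (0 : ℝ)).smul_const x).const_add ζ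
      have h2 : HasFDerivAt ρ l (ζ + (0 : ℝ) • x) := by
        simpa using (hρ.differentiable (by simp) ζ).hasFDerivAt
      exact h2.comp_hasDerivAt 0 h1
    have hev := hder.tendsto_slope_zero_right.eventually (gt_mem_nhds hx)
    obtain ⟨t, ht, ht0⟩ := (hev.and self_mem_nhdsWithin).exists
    have ht0' : 0 < t := ht0
    simp only [zero_add, zero_smul, add_zero, hζ, sub_zero, smul_eq_mul] at ht
    have hρt : ρ (ζ + t • x) < 0 := by
      by_contra! h
      have : 0 ≤ t⁻¹ * ρ (ζ + t • x) := by positivity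
      linarith
    have h3 := hmax _ hρt
    have h4 : ‖ζ + t • x‖ ^ 2 ≤ ‖ζ‖ ^ 2 := pow_le_pow_left₀ (norm_nonneg _) h3 2
    rw [norm_add_sq_real, inner_smul_right] at h4
    nlinarith [sq_nonneg ‖t • x‖, mul_pos ht0' hpos]
  obtain ⟨N, hN⟩ : ∃ N, l N = 1 := by
    obtain ⟨x, hx⟩ : ∃ x, l x ≠ 0 := by
      by_contra! h
      exact hd (ContinuousLinearMap.ext h)
    exact ⟨(l x)⁻¹ • x, by simp [hx]⟩
  have hker : ∀ x, l x = 0 → inner ℝ ζ x ≤ 0 := by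
    intro x hx
    have h1 : ∀ t : ℝ, 0 < t → inner ℝ ζ x ≤ t * inner ℝ ζ N := by
      intro t ht
      have := hneg (x - t • N) (by simp [hx, hN, ht])
      rw [inner_sub_right, inner_smul_right] at this
      linarith
    have h2 : Tendsto (fun t : ℝ => t * inner ℝ ζ N) (𝓝[>] 0) (𝓝 0) := by
      have : Tendsto (fun t : ℝ => t * inner ℝ ζ N) (𝓝 0) (𝓝 (0 * inner ℝ ζ N)) :=
        tendsto_id.mul_const _
      rw [zero_mul] at this
      exact this.mono_left nhdsWithin_le_nhds
    exact ge_of_tendsto h2 (eventually_mem_nhdsWithin.mono fun t ht => h1 t ht)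
  have hker' : ∀ x, l x = 0 → inner ℝ ζ x = 0 := by
    intro x hx
    refine le_antisymm (hker x hx) ?_
    have := hker (-x) (by simp [hx])
    rw [inner_neg_right] at this
    linarith
  set μ := inner ℝ ζ N with hμ
  have hlin : ∀ x, inner ℝ ζ x = μ * l x := by
    intro x
    have := hker' (x - l x • N) (by simp [hN])
    rw [inner_sub_right, inner_smul_right] at this
    linarith
  have hζζ : 0 < inner ℝ ζ ζ := by
    rw [real_inner_self_eq_norm_sq]
    have : 0 < ‖ζ‖ := norm_pos_iff.2 hζ0
    positivity
  have hμ0 : 0 < μ := by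
    have h1 : 0 ≤ μ := by
      have := hneg (-N) (by simp [hN])
      rw [inner_neg_right] at this
      linarith
    refine lt_of_le_of_ne h1 fun h => ?_
    have := hlin ζ
    rw [← h, zero_mul] at this
    linarith
  refine ⟨μ, hμ0, hlin, fun v hv => ?_⟩
  have hζv : inner ℝ ζ v = 0 := hker' v hv
  set q := fderiv ℝ (fderiv ℝ ρ) ζ v v with hq
  -- The parabola `ζ + s v - β s² N` enters `{ρ < 0}`, as `ρ` behaves like `(q / 2 - β) s²` along
  -- it. Comparing norms to second order in `s` gives the inequality, and `β` may then approach `q /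
  -- 2`.
  have hβ : ∀ β, q < 2 * β → ‖v‖ ^ 2 ≤ 2 * β * μ := by
    intro β hβq
    -- With this `κ` the second derivative of `ρ (Z s) + κ s²` at `0` is `(q - 2 * β) / 2 < 0`, so
    -- `ρ (Z s) ≤ -κ s²` for small `s`.
    set κ := (2 * β - q) / 4 with hκ
    have hκ0 : 0 < κ := by rw [hκ]; linarith
    set Z : ℝ → EuclideanSpace ℂ (Fin n) := fun s => ζ + s • v - (β * s ^ 2) • N with hZ
    have hZd : ∀ s, HasDerivAt Z (v - (2 * β * s) • N) s := by
      intro s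
      have h1 : HasDerivAt (fun s : ℝ => ζ + s • v) v s := by
        simpa using ((hasDerivAt_id s).smul_const v).const_add ζ
      have h2 : HasDerivAt (fun s : ℝ => β * s ^ 2) (2 * β * s) s := by
        refine ((hasDerivAt_pow 2 s).const_mul β).congr_deriv ?_
        simp; ring
      exact h1.sub (h2.smul_const N)
    have hZ0 : Z 0 = ζ := by simp [hZ]
    set F : ℝ → ℝ := fun s => ρ (Z s) + κ * s ^ 2 with hF
    have hFd : ∀ s, HasDerivAt F (fderiv ℝ ρ (Z s) (v - (2 * β * s) • N) + κ * (2 * s)) s := by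
      intro s
      have h1 := ((hρ.differentiable (by simp) (Z s)).hasFDerivAt).comp_hasDerivAt s (hZd s)
      have h2 : HasDerivAt (fun s : ℝ => κ * s ^ 2) (κ * (2 * s)) s := by
        refine ((hasDerivAt_pow 2 s).const_mul κ).congr_deriv ?_
        simp
      exact h1.add h2
    have hF' : deriv F = fun s => fderiv ℝ ρ (Z s) (v - (2 * β * s) • N) + κ * (2 * s) :=
      funext fun s => (hFd s).deriv
    have hF'' : deriv (deriv F) 0 = q - 2 * β + 2 * κ := by
      rw [hF']
      have h1 : HasDerivAt (fun s => fderiv ℝ ρ (Z s)) (fderiv ℝ (fderiv ℝ ρ) ζ v) 0 := by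
        have h2 := (((hρ.fderiv_right (m := 1) (by norm_num)).differentiable (by simp)
          (Z 0)).hasFDerivAt).comp_hasDerivAt 0 (hZd 0)
        rw [hZ0] at h2
        have h3 : v - (2 * β * 0) • N = v := by simp
        rw [h3] at h2
        exact h2
      have h3 : HasDerivAt (fun s : ℝ => v - (2 * β * s) • N) (-((2 * β) • N)) 0 := by
        simpa using (((hasDerivAt_id (0 : ℝ)).const_mul (2 * β)).smul_const N).const_sub v
      have h4 : HasDerivAt (fun s : ℝ => κ * (2 * s)) (2 * κ) 0 := by
        refine (((hasDerivAt_id (0 : ℝ)).const_mul 2).const_mul κ).congr_deriv ?_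
        ring
      have h5 := (h1.clm_apply h3).add h4
      have h6 := h5.deriv
      rw [hZ0] at h6
      refine Eq.trans h6 ?_
      simp only [mul_zero, zero_smul, sub_zero, map_neg, map_smul, ← hl, hN, smul_eq_mul, ← hq]
      ring
    have hloc : IsLocalMax F 0 := by
      refine isLocalMax_of_deriv_deriv_neg ?_ ?_ (hFd 0).continuousAt
      · rw [hF'', hκ]; linarith
      · rw [hF']
        simp [hZ0, ← hl, hv]
    have hev : ∀ᶠ s : ℝ in 𝓝[>] 0, ‖v‖ ^ 2 ≤ 2 * β * μ + s * (2 * β * inner ℝ v N) := by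
      filter_upwards [nhdsWithin_le_nhds hloc, self_mem_nhdsWithin] with s hs hs0
      have hs0' : 0 < s := hs0
      have h1 : ρ (Z s) < 0 := by
        have : F s ≤ F 0 := hs
        simp only [hF, hZ0, hζ] at this
        have : 0 < κ * s ^ 2 := by positivity
        linarith
      have h2 : ‖Z s‖ ^ 2 ≤ ‖ζ‖ ^ 2 := pow_le_pow_left₀ (norm_nonneg _) (hmax _ h1) 2
      have h3 : ‖Z s‖ ^ 2 = ‖ζ‖ ^ 2 + s ^ 2 * ‖v‖ ^ 2 + (β * s ^ 2) ^ 2 * ‖N‖ ^ 2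
          - 2 * (β * s ^ 2) * μ - 2 * s * (β * s ^ 2) * inner ℝ v N := by
        simp only [hZ]
        rw [norm_sub_sq_real, norm_add_sq_real, inner_smul_right, inner_add_left,
          real_inner_smul_left, norm_smul, norm_smul, mul_pow, mul_pow, Real.norm_eq_abs,
          Real.norm_eq_abs, sq_abs, sq_abs]
        simp only [inner_smul_right, hζv, ← hμ]
        ring
      rw [h3] at h2
      have h4 : 0 ≤ (β * s ^ 2) ^ 2 * ‖N‖ ^ 2 := by positivity
      have h5 : s ^ 2 * ‖v‖ ^ 2 ≤ s ^ 2 * (2 * β * μ + s * (2 * β * inner ℝ v N)) := by linarith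
      exact le_of_mul_le_mul_left h5 (by positivity)
    have hlim : Tendsto (fun s : ℝ => 2 * β * μ + s * (2 * β * inner ℝ v N)) (𝓝[>] 0)
        (𝓝 (2 * β * μ)) := by
      have : Continuous fun s : ℝ => 2 * β * μ + s * (2 * β * inner ℝ v N) := by fun_prop
      have h := this.tendsto 0
      simp only [zero_mul, add_zero] at h
      exact h.mono_left nhdsWithin_le_nhds
    exact ge_of_tendsto hlim hev
  refine le_of_forall_pos_le_add fun ε hε => ?_
  have := hβ (q / 2 + ε / (2 * μ)) (by
    have : 0 < ε / (2 * μ) := by positivity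
    linarith)
  refine this.trans (le_of_eq ?_)
  field_simp

/-- Adding a multiple of the square makes a function with positive definite tangential Hessian
strongly convex. -/
theorem exists_hess_pos {B : EuclideanSpace ℂ (Fin n) →L[ℝ] EuclideanSpace ℂ (Fin n) →L[ℝ] ℝ}
    (hsymm : ∀ x y, B x y = B y x) {l : EuclideanSpace ℂ (Fin n) →L[ℝ] ℝ} (hl : l ≠ 0) {μ : ℝ}
    (hμ : 0 < μ) (hB : ∀ v, l v = 0 → ‖v‖ ^ 2 ≤ μ * B v v) :
    ∃ K > 0, ∃ c > 0, ∀ x, c * ‖x‖ ^ 2 ≤ B x x + 2 * K * (l x) ^ 2 := by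
  obtain ⟨N, hN⟩ : ∃ N, l N = 1 := by
    obtain ⟨x, hx⟩ : ∃ x, l x ≠ 0 := by
      by_contra! h
      exact hl (ContinuousLinearMap.ext h)
    exact ⟨(l x)⁻¹ • x, by simp [hx]⟩
  set b := ‖B‖ with hb
  set m := ‖N‖ with hm
  have hb0 : 0 ≤ b := by rw [hb]; positivity
  have hm0 : 0 ≤ m := by rw [hm]; positivity
  -- The three summands absorb the mixed term `B v N`, the term `B N N` and the share of `‖x‖²`
  -- along `N`; the final `1` keeps `K` positive.
  refine ⟨(2 * μ * b ^ 2 * m ^ 2 + b * m ^ 2 + m ^ 2 / (2 * μ)) / 2 + 1, by positivity,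
    1 / (4 * μ), by positivity, fun x => ?_⟩
  set τ := l x with hτ
  set v := x - τ • N with hv
  have hlv : l v = 0 := by simp [hv, hN, ← hτ]
  have hx : x = v + τ • N := by simp [hv]
  have h1 := hB v hlv
  have h2 : B x x = B v v + 2 * τ * B v N + τ ^ 2 * B N N := by
    rw [hx]
    simp only [map_add, map_smul, add_apply, smul_apply, smul_eq_mul]
    rw [hsymm N v]
    ring
  have h3 : |B v N| ≤ b * ‖v‖ * m := by
    simpa using B.le_opNorm₂ v N
  have h4 : |B N N| ≤ b * m * m := by
    simpa using B.le_opNorm₂ N N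
  have h5 : ‖x‖ ^ 2 ≤ 2 * ‖v‖ ^ 2 + 2 * (τ ^ 2 * m ^ 2) := by
    have h6 : ‖x‖ ≤ ‖v‖ + |τ| * m := by
      conv_lhs => rw [hx]
      refine (norm_add_le _ _).trans ?_
      rw [norm_smul, Real.norm_eq_abs]
    have h7 : ‖x‖ ^ 2 ≤ (‖v‖ + |τ| * m) ^ 2 := pow_le_pow_left₀ (norm_nonneg _) h6 2
    have h8 : (|τ| * m) ^ 2 = τ ^ 2 * m ^ 2 := by rw [mul_pow, sq_abs]
    nlinarith [sq_nonneg (‖v‖ - |τ| * m)]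
  have h6 : -(‖v‖ ^ 2 / (2 * μ) + 2 * μ * b ^ 2 * m ^ 2 * τ ^ 2) ≤ 2 * τ * B v N := by
    have h7 : |2 * τ * B v N| ≤ 2 * |τ| * (b * ‖v‖ * m) := by
      rw [abs_mul, abs_mul, abs_two]
      gcongr
    have h8 : 2 * |τ| * (b * ‖v‖ * m) ≤ ‖v‖ ^ 2 / (2 * μ) + 2 * μ * b ^ 2 * m ^ 2 * τ ^ 2 := by
      have h9 : ‖v‖ ^ 2 / (2 * μ) + 2 * μ * b ^ 2 * m ^ 2 * |τ| ^ 2 - 2 * |τ| * (b * ‖v‖ * m)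
          = (‖v‖ - 2 * μ * b * m * |τ|) ^ 2 / (2 * μ) := by
        field_simp
        ring
      have h10 : 0 ≤ (‖v‖ - 2 * μ * b * m * |τ|) ^ 2 / (2 * μ) := by positivity
      rw [sq_abs] at h9
      linarith
    have := neg_le_of_abs_le (h7.trans h8)
    exact this
  have h7 : -(b * m ^ 2 * τ ^ 2) ≤ τ ^ 2 * B N N := by
    have h8 := neg_le_of_abs_le h4
    nlinarith [mul_le_mul_of_nonneg_left h8 (sq_nonneg τ)]
  have h8 : ‖v‖ ^ 2 / μ ≤ B v v := by
    rw [div_le_iff₀ hμ]; linarith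
  have h9 : 1 / (4 * μ) * ‖x‖ ^ 2 ≤ ‖v‖ ^ 2 / (2 * μ) + m ^ 2 / (2 * μ) * τ ^ 2 := by
    calc 1 / (4 * μ) * ‖x‖ ^ 2 ≤ 1 / (4 * μ) * (2 * ‖v‖ ^ 2 + 2 * (τ ^ 2 * m ^ 2)) := by gcongr
      _ = _ := by field_simp; ring
  have h10 : ‖v‖ ^ 2 / μ = ‖v‖ ^ 2 / (2 * μ) + ‖v‖ ^ 2 / (2 * μ) := by field_simp; ring
  rw [h2]
  nlinarith [sq_nonneg τ]

end FarthestPoint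

end LumerHardy

namespace LumerHardy

open Filter Topology Metric

/-! ### The local convex model with global supporting hyperplanes -/

section Frame

variable {n : ℕ} {Ω : Set (EuclideanSpace ℂ (Fin n))} {ρ : EuclideanSpace ℂ (Fin n) → ℝ}

/-- A boundary point `pt` of `Ω` near which `Ω = {g < 0}` with `g` strongly convex, a complex
tangent vector `dir` there, and strongly supporting hyperplanes of `Ω` at the nearby boundary
points. -/
structure ConvexFrame (Ω : Set (EuclideanSpace ℂ (Fin n))) where
  g : EuclideanSpace ℂ (Fin n) → ℝ
  pt : EuclideanSpace ℂ (Fin n)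
  dir : EuclideanSpace ℂ (Fin n)
  c : ℝ
  r : ℝ
  κ : ℝ
  contDiff : ContDiff ℝ 2 g
  pt_ne : pt ≠ 0
  norm_dir : ‖dir‖ = 1
  inner_dir : inner ℂ pt dir = 0
  c_pos : 0 < c
  r_pos : 0 < r
  κ_pos : 0 < κ
  g_pt : g pt = 0
  fderiv_pt : ∀ x, fderiv ℝ g pt x = κ * inner ℝ pt x
  neg_iff : ∀ z ∈ closedBall pt r, g z < 0 ↔ z ∈ Ω
  convex : ∀ p ∈ closedBall pt r, ∀ z ∈ closedBall pt r,
    g p + fderiv ℝ g p (z - p) + c * ‖z - p‖ ^ 2 ≤ g z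
  support : ∀ p ∈ closedBall pt r, g p = 0 → ∀ z ∈ Ω, c * ‖z - p‖ ^ 2 ≤ fderiv ℝ g p (p - z)

theorem eventually_norm_sub_lt {X E : Type*} [TopologicalSpace X] [SeminormedAddCommGroup E]
    {F : X → E} (hF : Continuous F) (x : X) {ε : ℝ} (hε : 0 < ε) :
    ∀ᶠ z in 𝓝 x, ‖F z - F x‖ < ε :=
  (tendsto_iff_norm_sub_tendsto_zero.1 (hF.tendsto x)).eventually (gt_mem_nhds hε)

/-- The one place where dimension one has to be excluded: a nonzero complex tangent direction exists
only for `n ≥ 2`. -/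
theorem exists_unit_orthogonal (hn : 2 ≤ n) (ζ : EuclideanSpace ℂ (Fin n)) :
    ∃ e : EuclideanSpace ℂ (Fin n), ‖e‖ = 1 ∧ inner ℂ ζ e = 0 := by
  obtain ⟨e, he, he0⟩ : ∃ e ∈ (ℂ ∙ ζ)ᗮ, e ≠ 0 := by
    apply Submodule.exists_mem_ne_zero_of_ne_bot
    intro h
    have h1 := Submodule.finrank_add_finrank_orthogonal (𝕜 := ℂ) (ℂ ∙ ζ)
    rw [h, finrank_bot, finrank_euclideanSpace_fin] at h1
    have h2 : Module.finrank ℂ (ℂ ∙ ζ) ≤ 1 := by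
      simpa using finrank_span_le_card (R := ℂ) {ζ}
    omega
  have h0 : ‖e‖ ≠ 0 := norm_ne_zero_iff.2 he0
  refine ⟨((‖e‖⁻¹ : ℝ) : ℂ) • e, ?_, ?_⟩
  · rw [norm_smul, Complex.norm_real, norm_inv, norm_norm, inv_mul_cancel₀ h0]
  · rw [inner_smul_right, Submodule.mem_orthogonal_singleton_iff_inner_right.1 he, mul_zero]

set_option maxHeartbeats 400000 in
-- At a farthest point the Hessian of `ρ` is positive on the tangent space. Adding `K ρ²` makes it
-- positive in all directions without changing the sign of `ρ` near the point. Support by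
-- hyperplanes follows from convexity for nearby `z`, and for distant `z` by perturbing the support
-- of `Ω` at `ζ` by the sphere through `ζ`.
theorem IsC2DefiningFunction.nonempty_convexFrame (hn : 2 ≤ n) (hρ : IsC2DefiningFunction Ω ρ) :
    Nonempty (ConvexFrame Ω) := by
  obtain ⟨ζ, hζf, hζ0, hmax⟩ := hρ.exists_farthest (by omega)
  obtain ⟨e, he1, he⟩ := exists_unit_orthogonal hn ζ
  have hζρ := hρ.eq_zero_of_mem_frontier hζf
  have hd := hρ.fderiv_ne_zero ζ hζf
  obtain ⟨μ, hμ0, hμ, hB⟩ := farthest_conditions hρ.contDiff hζρ hζ0 hd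
    fun z hz => hmax z (hρ.mem_iff.2 hz)
  have hsymm : ∀ x y, fderiv ℝ (fderiv ℝ ρ) ζ x y = fderiv ℝ (fderiv ℝ ρ) ζ y x := fun x y =>
    (hρ.contDiff.contDiffAt (x := ζ)).isSymmSndFDerivAt (by simp) x y
  obtain ⟨K, hK0, c, hc0, hc⟩ := exists_hess_pos hsymm hd hμ0 hB
  set g : EuclideanSpace ℂ (Fin n) → ℝ := fun z => ρ z + K * ρ z ^ 2 with hg
  have hgC : ContDiff ℝ 2 g :=
    hρ.contDiff.add (contDiff_const.mul (hρ.contDiff.pow 2))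
  have hφ : ∀ t : ℝ, HasDerivAt (fun t : ℝ => t + K * t ^ 2) (1 + 2 * K * t) t := fun t => by
    refine ((hasDerivAt_id t).add ((hasDerivAt_pow 2 t).const_mul K)).congr_deriv ?_
    simp; ring
  have hφ' : ∀ t : ℝ, HasDerivAt (fun t : ℝ => 1 + 2 * K * t) (2 * K) t := fun t => by
    simpa using ((hasDerivAt_id t).const_mul (2 * K)).const_add 1
  have hgd : ∀ z, fderiv ℝ g z = (1 + 2 * K * ρ z) • fderiv ℝ ρ z := fun z =>
    ((hφ (ρ z)).comp_hasFDerivAt z (hρ.contDiff.differentiable (by simp) z).hasFDerivAt).fderiv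
  have hgH : ∀ w, c * ‖w‖ ^ 2 ≤ fderiv ℝ (fderiv ℝ g) ζ w w := fun w => by
    have h := hess_comp hφ hφ' hρ.contDiff ζ w
    rw [hζρ] at h
    refine (hc w).trans (le_of_eq ?_)
    rw [hg, h]
    ring
  have hgdζ : fderiv ℝ g ζ = fderiv ℝ ρ ζ := by rw [hgd, hζρ]; simp
  set R := ‖ζ‖ with hR
  have hR0 : 0 < R := norm_pos_iff.2 hζ0
  have hH1 : Continuous (fderiv ℝ (fderiv ℝ g)) :=
    (hgC.fderiv_right (m := 1) (by norm_num)).continuous_fderiv (by simp)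
  have hG1 : Continuous (fderiv ℝ g) := continuous_fderiv_of_contDiff_two hgC
  have ev1 : ∀ᶠ z in 𝓝 ζ, ‖fderiv ℝ (fderiv ℝ g) z - fderiv ℝ (fderiv ℝ g) ζ‖ < c / 2 :=
    eventually_norm_sub_lt (E := EuclideanSpace ℂ (Fin n) →L[ℝ] EuclideanSpace ℂ (Fin n) →L[ℝ] ℝ)
      hH1 ζ (half_pos hc0)
  have ev2 : ∀ᶠ z in 𝓝 ζ, -1 < K * ρ z := by
    have hcont : Continuous fun z => K * ρ z := continuous_const.mul hρ.contDiff.continuous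
    have := hcont.tendsto ζ
    rw [hζρ, mul_zero] at this
    exact this.eventually (lt_mem_nhds (by norm_num))
  obtain ⟨r₀, hr₀, hball⟩ := Metric.nhds_basis_closedBall.mem_iff.1 (ev1.and ev2)
  have hconv : ∀ p ∈ closedBall ζ r₀, ∀ z ∈ closedBall ζ r₀,
      g p + fderiv ℝ g p (z - p) + c / 4 * ‖z - p‖ ^ 2 ≤ g z := by
    intro p hp z hz
    refine add_fderiv_add_sq_le hgC (convex_closedBall ζ r₀) (fun w hw x => ?_) hp hz
    have h1 : |(fderiv ℝ (fderiv ℝ g) w - fderiv ℝ (fderiv ℝ g) ζ) x x| ≤ c / 2 * ‖x‖ * ‖x‖ := by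
      refine ((fderiv ℝ (fderiv ℝ g) w - fderiv ℝ (fderiv ℝ g) ζ).le_opNorm₂ x x).trans ?_
      gcongr
      exact (hball hw).1.le
    have h2 := neg_le_of_abs_le h1
    have h3 := hgH x
    simp only [sub_apply] at h2
    nlinarith
  have hneg : ∀ z ∈ closedBall ζ r₀, g z < 0 ↔ z ∈ Ω := by
    intro z hz
    have h1 : -1 < K * ρ z := (hball hz).2
    have h2 : g z = ρ z * (1 + K * ρ z) := by simp only [hg]; ring
    rw [hρ.mem_iff, h2]
    exact ⟨fun h => neg_of_mul_neg_left h (by linarith),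
      fun h => mul_neg_of_neg_of_pos h (by linarith)⟩
  -- From `‖z‖ ≤ ‖ζ‖` and `‖z - ζ‖ > r₀` the derivative at `ζ` in the direction `ζ - z` is at least
  -- `2 * a`; replacing `ζ` by a nearby `p` may cost up to `a`.
  set a := μ⁻¹ * r₀ ^ 2 / 4 with ha
  have ha0 : 0 < a := by positivity
  have ev3 : ∀ᶠ p in 𝓝 ζ,
      ‖fderiv ℝ g p - fderiv ℝ g ζ‖ * (2 * R + 1) + ‖fderiv ℝ g ζ‖ * ‖p - ζ‖ < a := by
    have : Continuous fun p =>
        ‖fderiv ℝ g p - fderiv ℝ g ζ‖ * (2 * R + 1) + ‖fderiv ℝ g ζ‖ * ‖p - ζ‖ := by fun_prop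
    have h := this.tendsto ζ
    simp only [sub_self, norm_zero, zero_mul, mul_zero, add_zero] at h
    exact h.eventually (gt_mem_nhds ha0)
  obtain ⟨r₁, hr₁, hball₁⟩ := Metric.nhds_basis_closedBall.mem_iff.1 ev3
  set r := min (min r₀ r₁) 1 with hr
  have hr0 : 0 < r := by positivity
  have hrr₀ : closedBall ζ r ⊆ closedBall ζ r₀ :=
    closedBall_subset_closedBall ((min_le_left _ _).trans (min_le_left _ _))
  have hrr₁ : closedBall ζ r ⊆ closedBall ζ r₁ :=
    closedBall_subset_closedBall ((min_le_left _ _).trans (min_le_right _ _))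
  set c' := min (c / 4) (a / (2 * R + 1) ^ 2) with hc'
  have hc'0 : 0 < c' := by positivity
  refine ⟨⟨g, ζ, e, c', r, μ⁻¹, hgC, hζ0, he1, he, hc'0, hr0, inv_pos.2 hμ0, by simp [hg, hζρ],
    fun x => ?_, fun z hz => hneg z (hrr₀ hz), fun p hp z hz => ?_, fun p hp hgp z hz => ?_⟩⟩
  · rw [hμ, hgdζ, ← mul_assoc, inv_mul_cancel₀ hμ0.ne', one_mul]
  · refine le_trans ?_ (hconv p (hrr₀ hp) z (hrr₀ hz))
    gcongr
    exact min_le_left _ _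
  · by_cases hzr : z ∈ closedBall ζ r₀
    · have h1 := hconv p (hrr₀ hp) z hzr
      have h2 := (hneg z hzr).2 hz
      have h3 : c' * ‖z - p‖ ^ 2 ≤ c / 4 * ‖z - p‖ ^ 2 := by
        gcongr
        exact min_le_left _ _
      rw [← neg_sub z p, map_neg]
      linarith
    · have hzr' : r₀ < ‖z - ζ‖ := by simpa [dist_eq_norm] using hzr
      have hp1 : ‖p - ζ‖ ≤ 1 := by
        have : ‖p - ζ‖ ≤ r := by simpa [dist_eq_norm] using hp
        exact this.trans (min_le_right _ _)
      have hzR := hmax z hz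
      have hpz : ‖p - z‖ ≤ 2 * R + 1 := by
        calc ‖p - z‖ = ‖(p - ζ) + (ζ - z)‖ := by congr 1; abel
          _ ≤ ‖p - ζ‖ + (‖ζ‖ + ‖z‖) := (norm_add_le _ _).trans (by gcongr; exact norm_sub_le _ _)
          _ ≤ 2 * R + 1 := by linarith
      have h1 : 2 * a ≤ fderiv ℝ g ζ (ζ - z) := by
        have h2 : fderiv ℝ g ζ (ζ - z) = μ⁻¹ * inner ℝ ζ (ζ - z) := by
          rw [hμ, hgdζ, ← mul_assoc, inv_mul_cancel₀ hμ0.ne', one_mul]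
        have h3 : ‖z - ζ‖ ^ 2 ≤ 2 * inner ℝ ζ (ζ - z) := by
          rw [norm_sub_sq_real, inner_sub_right, real_inner_self_eq_norm_sq, real_inner_comm]
          nlinarith [norm_nonneg z]
        have h4 : r₀ ^ 2 ≤ ‖z - ζ‖ ^ 2 := by gcongr
        have h5 : μ⁻¹ * (r₀ ^ 2 / 2) ≤ μ⁻¹ * inner ℝ ζ (ζ - z) := by
          gcongr
          linarith
        rw [h2, ha]
        linarith
      have h2 : fderiv ℝ g p (p - z) = fderiv ℝ g ζ (ζ - z)
          + (fderiv ℝ g p - fderiv ℝ g ζ) (p - z) + fderiv ℝ g ζ (p - ζ) := by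
        simp only [sub_apply, map_sub]
        ring
      have h3 : |(fderiv ℝ g p - fderiv ℝ g ζ) (p - z)|
          ≤ ‖fderiv ℝ g p - fderiv ℝ g ζ‖ * (2 * R + 1) := by
        refine ((fderiv ℝ g p - fderiv ℝ g ζ).le_opNorm _).trans ?_
        gcongr
      have h4 : |fderiv ℝ g ζ (p - ζ)| ≤ ‖fderiv ℝ g ζ‖ * ‖p - ζ‖ :=
        (fderiv ℝ g ζ).le_opNorm _
      have h5 := neg_le_of_abs_le h3
      have h6 := neg_le_of_abs_le h4
      have h7 := hball₁ (hrr₁ hp)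
      simp only [mem_ofPred_eq] at h7
      have h8 : c' * ‖z - p‖ ^ 2 ≤ a := by
        calc c' * ‖z - p‖ ^ 2 ≤ a / (2 * R + 1) ^ 2 * (2 * R + 1) ^ 2 := by
              rw [norm_sub_rev]
              gcongr
              exact min_le_right _ _
          _ = a := by field_simp
      linarith

end Frame

end LumerHardy

namespace LumerHardy

open Filter Topology Metric

/-! ### Complex tangential slices near the convex point -/

section Slices

variable {n : ℕ} {Ω : Set (EuclideanSpace ℂ (Fin n))}

theorem real_inner_euclidean_eq_re (x y : EuclideanSpace ℂ (Fin n)) :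
    inner ℝ x y = (inner ℂ x y).re := by
  simp only [PiLp.inner_apply, Complex.inner, RCLike.inner_apply, Complex.re_sum]

/-- The complex line `λ ↦ (1 - t) ζ + λ e` through `(1 - t) ζ` in the tangent direction `e`. -/
noncomputable def ConvexFrame.slice (fr : ConvexFrame Ω) (t : ℝ) (a : ℂ) :
    EuclideanSpace ℂ (Fin n) :=
  (1 - t) • fr.pt + a • fr.dir

theorem ConvexFrame.slice_sub_slice (fr : ConvexFrame Ω) (t : ℝ) (a b : ℂ) :
    fr.slice t a - fr.slice t b = (a - b) • fr.dir := by
  simp only [ConvexFrame.slice, sub_smul]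
  abel

theorem ConvexFrame.norm_slice_sub_slice (fr : ConvexFrame Ω) (t : ℝ) (a b : ℂ) :
    ‖fr.slice t a - fr.slice t b‖ = ‖a - b‖ := by
  rw [fr.slice_sub_slice, norm_smul, fr.norm_dir, mul_one]

theorem ConvexFrame.slice_sub_pt (fr : ConvexFrame Ω) (t : ℝ) (a : ℂ) :
    fr.slice t a - fr.pt = -(t • fr.pt) + a • fr.dir := by
  simp only [ConvexFrame.slice, sub_smul, one_smul]
  abel

theorem ConvexFrame.inner_real_smul_dir (fr : ConvexFrame Ω) (a : ℂ) :
    inner ℝ fr.pt (a • fr.dir) = 0 := by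
  rw [real_inner_euclidean_eq_re, inner_smul_right, fr.inner_dir, mul_zero, Complex.zero_re]

theorem ConvexFrame.inner_slice (fr : ConvexFrame Ω) (t : ℝ) (a : ℂ) :
    inner ℝ fr.pt (fr.slice t a) = (1 - t) * ‖fr.pt‖ ^ 2 := by
  rw [ConvexFrame.slice, inner_add_right, inner_smul_right, fr.inner_real_smul_dir, add_zero,
    real_inner_self_eq_norm_sq]

theorem ConvexFrame.norm_le_norm_slice_sub_pt (fr : ConvexFrame Ω) (t : ℝ) (a : ℂ) :
    ‖a‖ ≤ ‖fr.slice t a - fr.pt‖ := by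
  have h1 : inner ℂ fr.dir (fr.slice t a - fr.pt) = a := by
    have h2 : inner ℂ fr.dir fr.pt = 0 := by rw [← inner_conj_symm, fr.inner_dir, map_zero]
    have h3 : inner ℂ fr.dir (t • fr.pt) = 0 := by
      rw [← Complex.coe_smul, inner_smul_right, h2, mul_zero]
    rw [fr.slice_sub_pt, inner_add_right, inner_neg_right, h3, inner_smul_right,
      inner_self_eq_norm_sq_to_K, fr.norm_dir]
    simp
  have h2 := norm_inner_le_norm (𝕜 := ℂ) fr.dir (fr.slice t a - fr.pt)
  rwa [h1, fr.norm_dir, one_mul] at h2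

theorem ConvexFrame.continuous_slice (fr : ConvexFrame Ω) (t : ℝ) : Continuous (fr.slice t) := by
  unfold ConvexFrame.slice
  fun_prop

/-- Constants describing the slices `{t} × {‖λ‖ ≤ Λ}`, `τ ≤ t ≤ 2τ`, of a convex frame. -/
structure SliceData (fr : ConvexFrame Ω) where
  τ : ℝ
  Λ : ℝ
  m : ℝ
  L : ℝ
  τ_pos : 0 < τ
  Λ_pos : 0 < Λ
  m_pos : 0 < m
  L_pos : 0 < L
  slice_mem : ∀ t ∈ Icc τ (2 * τ), ∀ a : ℂ, ‖a‖ ≤ Λ → fr.slice t a ∈ closedBall fr.pt fr.r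
  slice_pos : ∀ t ∈ Icc τ (2 * τ), ∀ a : ℂ, Λ / 2 ≤ ‖a‖ → ‖a‖ ≤ Λ → 0 < fr.g (fr.slice t a)
  slice_zero_le : ∀ t ∈ Icc τ (2 * τ), fr.g (fr.slice t 0) ≤ -m
  abs_le : ∀ p ∈ closedBall fr.pt fr.r, |fr.g p| ≤ L
  norm_fderiv_le : ∀ p ∈ closedBall fr.pt fr.r, ‖fderiv ℝ fr.g p‖ ≤ L
  norm_hess_le : ∀ p ∈ closedBall fr.pt fr.r, ‖fderiv ℝ (fderiv ℝ fr.g) p‖ ≤ L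

theorem SliceData.abs_sub_le {fr : ConvexFrame Ω} (sd : SliceData fr)
    {p q : EuclideanSpace ℂ (Fin n)} (hp : p ∈ closedBall fr.pt fr.r)
    (hq : q ∈ closedBall fr.pt fr.r) : |fr.g p - fr.g q| ≤ sd.L * ‖p - q‖ :=
  (convex_closedBall fr.pt fr.r).norm_image_sub_le_of_norm_fderiv_le
    (fun x _ => fr.contDiff.differentiable (by simp) x) sd.norm_fderiv_le hq hp

theorem SliceData.norm_fderiv_sub_le {fr : ConvexFrame Ω} (sd : SliceData fr)
    {p q : EuclideanSpace ℂ (Fin n)} (hp : p ∈ closedBall fr.pt fr.r)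
    (hq : q ∈ closedBall fr.pt fr.r) :
    ‖fderiv ℝ fr.g p - fderiv ℝ fr.g q‖ ≤ sd.L * ‖p - q‖ :=
  (convex_closedBall fr.pt fr.r).norm_image_sub_le_of_norm_fderiv_le
    (fun x _ => (fr.contDiff.fderiv_right (m := 1) (by norm_num)).differentiable (by simp) x)
    sd.norm_hess_le hq hp

/-- Moving from `ζ` towards the origin makes `g` negative to first order in `t`. Moving by `a` in
the tangent direction has no first order effect and adds at least `c ‖a‖²`, so for small `t` the
slice is negative at its centre and positive on an annulus. -/
theorem ConvexFrame.nonempty_sliceData (fr : ConvexFrame Ω) : Nonempty (SliceData fr) := by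
  have hc := fr.c_pos
  have hr := fr.r_pos
  have hκ := fr.κ_pos
  set R := ‖fr.pt‖ with hR
  have hR0 : 0 < R := norm_pos_iff.2 fr.pt_ne
  set Λ := fr.r / 2 with hΛ
  have hΛ0 : 0 < Λ := by positivity
  have hgd : Continuous (fderiv ℝ fr.g) := continuous_fderiv_of_contDiff_two fr.contDiff
  have hgdd : Continuous (fderiv ℝ (fderiv ℝ fr.g)) :=
    (fr.contDiff.fderiv_right (m := 1) (by norm_num)).continuous_fderiv (by simp)
  have hK : IsCompact (closedBall fr.pt fr.r) := isCompact_closedBall _ _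
  obtain ⟨L₁, hL₁⟩ := hK.exists_bound_of_continuousOn fr.contDiff.continuous.continuousOn
  obtain ⟨L₂, hL₂⟩ := hK.exists_bound_of_continuousOn hgd.continuousOn
  obtain ⟨L₃, hL₃⟩ := hK.exists_bound_of_continuousOn
    (E := EuclideanSpace ℂ (Fin n) →L[ℝ] EuclideanSpace ℂ (Fin n) →L[ℝ] ℝ) hgdd.continuousOn
  have hder : HasDerivAt (fun s : ℝ => fr.g (fr.slice s 0)) (-(fr.κ * R ^ 2)) 0 := by
    have h1 : HasDerivAt (fun s : ℝ => fr.slice s 0) (-fr.pt) 0 := by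
      have h2 := ((hasDerivAt_id (0 : ℝ)).const_sub 1).smul_const fr.pt
      have h3 : (fun s : ℝ => fr.slice s 0) = fun s : ℝ => (1 - id s) • fr.pt := by
        funext s; simp [ConvexFrame.slice]
      rw [h3]
      simpa using h2
    have h2 : HasFDerivAt fr.g (fderiv ℝ fr.g fr.pt) (fr.slice 0 0) := by
      have h3 : fr.slice 0 0 = fr.pt := by simp [ConvexFrame.slice]
      rw [h3]
      exact (fr.contDiff.differentiable (by simp) _).hasFDerivAt
    refine (h2.comp_hasDerivAt 0 h1).congr_deriv ?_
    rw [fr.fderiv_pt, inner_neg_right, real_inner_self_eq_norm_sq]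
    ring
  have hev : ∀ᶠ s : ℝ in 𝓝[>] 0, fr.g (fr.slice s 0) < 0 := by
    have h0 : fr.g (fr.slice 0 0) = 0 := by simp [ConvexFrame.slice, fr.g_pt]
    have hlt : -(fr.κ * R ^ 2) < 0 := by
      have : 0 < fr.κ * R ^ 2 := by positivity
      linarith
    filter_upwards [hder.tendsto_slope_zero_right.eventually (gt_mem_nhds hlt),
      self_mem_nhdsWithin] with s hs hs0
    have hs0' : 0 < s := hs0
    simp only [zero_add, h0, sub_zero, smul_eq_mul] at hs
    by_contra! h
    have : 0 ≤ s⁻¹ * fr.g (fr.slice s 0) := by positivity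
    linarith
  obtain ⟨δ, hδ0, hδ⟩ := mem_nhdsGT_iff_exists_Ioo_subset.1 hev
  have hδ0' : 0 < δ := hδ0
  -- The three bounds give `2 * τ < δ`, so the centres are negative; a shift by `2 * τ * R ≤ r / 2`,
  -- so slices stay in the ball; and a first order loss below the gain `c * (Λ / 2) ^ 2`.
  set τ := min (δ / 3) (min (fr.r / (4 * R)) (fr.c * Λ ^ 2 / (16 * fr.κ * R ^ 2))) with hτ
  have hτ0 : 0 < τ := by positivity
  have hτ1 : τ ≤ δ / 3 := min_le_left _ _
  have hτ2 : τ ≤ fr.r / (4 * R) := (min_le_right _ _).trans (min_le_left _ _)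
  have hτ3 : τ ≤ fr.c * Λ ^ 2 / (16 * fr.κ * R ^ 2) := (min_le_right _ _).trans (min_le_right _ _)
  rw [le_div_iff₀ (by positivity)] at hτ2 hτ3
  have hcont : Continuous fun s : ℝ => -fr.g (fr.slice s 0) := by
    have : Continuous fun s : ℝ => fr.slice s 0 := by
      unfold ConvexFrame.slice
      fun_prop
    exact (fr.contDiff.continuous.comp this).neg
  obtain ⟨m, hm0, hm⟩ := (isCompact_Icc (a := τ) (b := 2 * τ)).exists_forall_le' (a := 0)
    hcont.continuousOn fun s hs => by
      have : fr.g (fr.slice s 0) < 0 := hδ ⟨hτ0.trans_le hs.1, by linarith [hs.2]⟩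
      linarith
  have hmem : ∀ t ∈ Icc τ (2 * τ), ∀ a : ℂ, ‖a‖ ≤ Λ → fr.slice t a ∈ closedBall fr.pt fr.r := by
    intro t ht a ha
    rw [mem_closedBall, dist_eq_norm, fr.slice_sub_pt]
    refine (norm_add_le _ _).trans ?_
    rw [norm_neg, norm_smul, norm_smul, fr.norm_dir, mul_one,
      Real.norm_of_nonneg (hτ0.le.trans ht.1)]
    have : t * R ≤ 2 * τ * R := by
      gcongr
      exact ht.2
    linarith
  refine ⟨⟨τ, Λ, m, max (max L₁ L₂) (max L₃ 1), hτ0, hΛ0, hm0, by positivity, hmem, ?_, ?_, ?_,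
    ?_, ?_⟩⟩
  · intro t ht a ha ha'
    have h1 := fr.convex fr.pt (mem_closedBall_self hr.le) _ (hmem t ht a ha')
    rw [fr.g_pt, fr.fderiv_pt, fr.slice_sub_pt, inner_add_right, inner_neg_right,
      inner_smul_right, fr.inner_real_smul_dir, real_inner_self_eq_norm_sq, ← fr.slice_sub_pt] at h1
    have h2 : (Λ / 2) ^ 2 ≤ ‖fr.slice t a - fr.pt‖ ^ 2 :=
      pow_le_pow_left₀ (by positivity) (ha.trans (fr.norm_le_norm_slice_sub_pt t a)) 2
    have h3 : fr.κ * (t * R ^ 2) ≤ fr.κ * (2 * τ * R ^ 2) := by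
      gcongr
      exact ht.2
    have h4 : fr.c * (Λ / 2) ^ 2 ≤ fr.c * ‖fr.slice t a - fr.pt‖ ^ 2 := by gcongr
    have h5 : 0 < fr.c * Λ ^ 2 := by positivity
    nlinarith
  · intro t ht
    have := hm t ht
    linarith
  · exact fun p hp => (hL₁ p hp).trans ((le_max_left _ _).trans (le_max_left _ _))
  · exact fun p hp => (hL₂ p hp).trans ((le_max_right _ _).trans (le_max_left _ _))
  · exact fun p hp => (hL₃ p hp).trans ((le_max_left _ _).trans (le_max_right _ _))

variable {fr : ConvexFrame Ω}

/-- At boundary points of a slice the derivative along the slice does not vanish. -/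
theorem SliceData.le_fderiv_smul_dir (sd : SliceData fr) {t : ℝ} (ht : t ∈ Icc sd.τ (2 * sd.τ))
    {a : ℂ} (ha : ‖a‖ ≤ sd.Λ) :
    fr.g (fr.slice t a) + sd.m ≤ fderiv ℝ fr.g (fr.slice t a) (a • fr.dir) := by
  have h1 := fr.convex _ (sd.slice_mem t ht a ha) _
    (sd.slice_mem t ht 0 (by simpa using sd.Λ_pos.le))
  have h2 := sd.slice_zero_le t ht
  have h3 : 0 ≤ fr.c * ‖fr.slice t 0 - fr.slice t a‖ ^ 2 := by
    have := fr.c_pos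
    positivity
  rw [fr.slice_sub_slice, zero_sub, neg_smul, map_neg] at h1
  rw [fr.slice_sub_slice] at h3
  have h4 : ‖(0 - a) • fr.dir‖ = ‖-(a • fr.dir)‖ := by rw [zero_sub, neg_smul]
  rw [h4] at h3
  linarith

set_option maxHeartbeats 1000000 in
-- The restriction of `u` to a slice is harmonic, so the shell estimate applies in the plane; all
-- its constants depend only on the slice data and hence not on `t`.
theorem SliceData.exists_shell_le (sd : SliceData fr) (hΩ : IsOpen Ω) (hc : IsPreconnected Ω)
    {P₀ : EuclideanSpace ℂ (Fin n)} (hP₀ : P₀ ∈ Ω) :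
    ∃ ε₀ > 0, ∃ C > 0, ∀ t ∈ Icc sd.τ (2 * sd.τ), ∀ u, PluriharmonicOn u Ω →
      (∀ z ∈ Ω, 0 ≤ u z) → ∀ ε, 0 < ε → ε < ε₀ →
      ∫ a in {a : ℂ | ‖a‖ ≤ sd.Λ ∧ -(3 / 2 * ε) ≤ fr.g (fr.slice t a) ∧
        fr.g (fr.slice t a) ≤ -(ε / 2)}, u (fr.slice t a) ≤ C * ε * u P₀ := by
  have hm0 := sd.m_pos
  have hΛ0 := sd.Λ_pos
  have hL0 := sd.L_pos
  -- Where `g > -m / 2`, convexity gives a radial derivative of at least `m / 2` over a radius of at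
  -- most `Λ`, which bounds the squared gradient from below; the Laplacian is a sum of two second
  -- derivatives, each at most `L`.
  obtain ⟨C, hC0, hC⟩ := exists_shell_estimate (volume : Measure ℂ) ![(1 : ℂ), Complex.I]
    (c := (sd.m / 2 / sd.Λ) ^ 2) (A := 2 * sd.L) (η := sd.m / 2) (by positivity) (by positivity)
    (by positivity)
  have hK : IsCompact {z | z ∈ closedBall fr.pt fr.r ∧ fr.g z ≤ -(sd.m / 2)} :=
    (isCompact_closedBall fr.pt fr.r).inter_right
      (isClosed_le fr.contDiff.continuous continuous_const)
  obtain ⟨H, hH0, hH⟩ := exists_harnack hΩ hc hK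
    (fun z hz => (fr.neg_iff z hz.1).1 (by linarith [hz.2])) hP₀
  set B : ℝ := volume.real (closedBall (0 : ℂ) sd.Λ) with hB
  refine ⟨sd.m / 4, by positivity, C * (H * B) + 1, by positivity, fun t ht u hu hu0 ε hε hε₀ => ?_⟩
  set r : ℂ → ℝ := fun a => fr.g (fr.slice t a) with hr
  set W : Set ℂ := {a | ‖a‖ < sd.Λ ∧ r a < 0} with hW
  have hsl : ∀ a, fr.slice t a = (1 - t) • fr.pt + lineCLM fr.dir a := fun a => rfl
  have hslC : ContDiff ℝ 2 (fr.slice t) := contDiff_const.add (lineCLM fr.dir).contDiff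
  have hrC : ContDiff ℝ 2 r := fr.contDiff.comp hslC
  have hmem : ∀ a, ‖a‖ ≤ sd.Λ → fr.slice t a ∈ closedBall fr.pt fr.r := sd.slice_mem t ht
  have hrd : ∀ a v, fderiv ℝ r a v = fderiv ℝ fr.g (fr.slice t a) (v • fr.dir) := by
    intro a v
    have h1 : HasFDerivAt (fr.slice t) (lineCLM fr.dir) a :=
      (lineCLM fr.dir).hasFDerivAt.const_add _
    have h2 := ((fr.contDiff.differentiable (by simp) (fr.slice t a)).hasFDerivAt).comp a h1
    have h3 : fderiv ℝ r a = _ := h2.fderiv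
    rw [h3]
    rfl
  have hrdd : ∀ a v, fderiv ℝ (fderiv ℝ r) a v v
      = fderiv ℝ (fderiv ℝ fr.g) (fr.slice t a) (v • fr.dir) (v • fr.dir) := fun a v =>
    fderiv_fderiv_comp_affine (lineCLM fr.dir) _ a v v fr.contDiff.contDiffAt
  have hWΩ : ∀ a ∈ W, fr.slice t a ∈ Ω := fun a ha => (fr.neg_iff _ (hmem a ha.1.le)).1 ha.2
  -- Positivity of `g` on the outer annulus keeps `W` away from the circle of radius `Λ`, so its
  -- sublevel sets are compact.
  have hWeq : ∀ a : ℂ, ‖a‖ ≤ sd.Λ → r a < 0 → a ∈ W := fun a ha hra => by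
    refine ⟨lt_of_le_of_ne ha fun h => ?_, hra⟩
    have := sd.slice_pos t ht a (by linarith) ha
    exact absurd hra this.not_gt
  have hWC : ∀ s > 0, {a | a ∈ W ∧ r a ≤ -s} = closedBall (0 : ℂ) sd.Λ ∩ {a | r a ≤ -s} := by
    intro s hs
    ext a
    simp only [mem_inter_iff, mem_closedBall, dist_zero_right, mem_ofPred_eq]
    exact ⟨fun h => ⟨h.1.1.le, h.2⟩, fun h => ⟨hWeq a h.1 (by linarith [h.2]), h.2⟩⟩
  have hcomp : ∀ s > 0, IsCompact {a | a ∈ W ∧ r a ≤ -s} := fun s hs => by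
    rw [hWC s hs]
    exact (isCompact_closedBall _ _).inter_right (isClosed_le hrC.continuous continuous_const)
  have hsmul : ∀ v : ℂ, ‖v‖ = 1 → ‖v • fr.dir‖ = 1 := fun v hv => by
    rw [norm_smul, hv, fr.norm_dir, mul_one]
  have hUC : ContDiffOn ℝ 2 (fun a => u (fr.slice t a)) W :=
    hu.1.comp hslC.contDiffOn hWΩ
  have key := hC W r ?_ hrC (fun a ha => ha.2) hcomp ?_ ?_ ?_ (fun a => u (fr.slice t a)) hUC
    (fun a ha => hu0 _ (hWΩ a ha)) ?_ ε hε (by linarith)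
  · have hset : {a | a ∈ W ∧ -(3 / 2 * ε) ≤ r a ∧ r a ≤ -(ε / 2)}
        = {a : ℂ | ‖a‖ ≤ sd.Λ ∧ -(3 / 2 * ε) ≤ r a ∧ r a ≤ -(ε / 2)} := by
      ext a
      exact ⟨fun h => ⟨h.1.1.le, h.2⟩, fun h => ⟨hWeq a h.1 (by linarith [h.2.2]), h.2⟩⟩
    rw [hset] at key
    refine key.trans ?_
    have hu00 := hu0 P₀ hP₀
    have h1 : ∫ a in {a | a ∈ W ∧ r a ≤ -(sd.m / 2)}, u (fr.slice t a) ≤ H * u P₀ * B := by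
      have hcK := hcomp (sd.m / 2) (by positivity)
      have hfin : volume {a | a ∈ W ∧ r a ≤ -(sd.m / 2)} ≠ ∞ := hcK.measure_lt_top.ne
      have h2 : ∫ a in {a | a ∈ W ∧ r a ≤ -(sd.m / 2)}, u (fr.slice t a)
          ≤ ∫ a in {a | a ∈ W ∧ r a ≤ -(sd.m / 2)}, H * u P₀ := by
        refine setIntegral_mono_on ?_ (integrableOn_const hfin) hcK.measurableSet fun a ha => ?_
        · exact (hUC.continuousOn.mono fun a ha => ha.1).integrableOn_compact hcK
        · exact hH u (hu.meanValueOn hΩ) hu0 _ ⟨hmem a ha.1.1.le, ha.2⟩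
      refine h2.trans ?_
      rw [setIntegral_const, smul_eq_mul, mul_comm]
      refine mul_le_mul_of_nonneg_left ?_ (by positivity)
      refine measureReal_mono (fun a ha => ?_) (isCompact_closedBall _ _).measure_lt_top.ne
      simpa using ha.1.1.le
    calc C * ε * ∫ a in {a | a ∈ W ∧ r a ≤ -(sd.m / 2)}, u (fr.slice t a)
        ≤ C * ε * (H * u P₀ * B) := by gcongr
      _ = (C * (H * B)) * ε * u P₀ := by ring
      _ ≤ _ := by gcongr; linarith
  · exact (isOpen_lt continuous_norm continuous_const).inter
      (isOpen_lt hrC.continuous continuous_const)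
  · intro a ha har
    have h1 := sd.le_fderiv_smul_dir ht ha.1.le
    have h2 : fderiv ℝ fr.g (fr.slice t a) (a • fr.dir)
        = a.re * fderiv ℝ r a 1 + a.im * fderiv ℝ r a Complex.I := by
      rw [← hrd, ← smul_eq_mul, ← smul_eq_mul, ← map_smul, ← map_smul, ← map_add]
      congr 1
      apply Complex.ext <;> simp
    rw [h2] at h1
    simp only [Fin.sum_univ_two, Matrix.cons_val_zero, Matrix.cons_val_one]
    set X := fderiv ℝ r a 1
    set Y := fderiv ℝ r a Complex.I
    have har' : -(sd.m / 2) < fr.g (fr.slice t a) := har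
    have h3 : sd.m / 2 ≤ a.re * X + a.im * Y := by linarith
    have h4 : (sd.m / 2) ^ 2 ≤ sd.Λ ^ 2 * (X ^ 2 + Y ^ 2) := by
      have h5 : (sd.m / 2) ^ 2 ≤ (a.re * X + a.im * Y) ^ 2 :=
        pow_le_pow_left₀ (by positivity) h3 2
      have h6 : a.re ^ 2 + a.im ^ 2 ≤ sd.Λ ^ 2 := by
        have := pow_le_pow_left₀ (norm_nonneg _) ha.1.le 2
        rw [Complex.sq_norm, Complex.normSq_apply] at this
        linarith
      have h7 : (a.re * X + a.im * Y) ^ 2 ≤ (a.re ^ 2 + a.im ^ 2) * (X ^ 2 + Y ^ 2) := by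
        nlinarith [sq_nonneg (a.re * Y - a.im * X)]
      exact h5.trans (h7.trans (by gcongr))
    rw [div_pow, div_le_iff₀ (by positivity)]
    linarith
  · intro a ha
    simp only [Fin.sum_univ_two, Matrix.cons_val_zero, Matrix.cons_val_one, hrdd]
    have hb : ∀ v : ℂ, ‖v‖ = 1 →
        |fderiv ℝ (fderiv ℝ fr.g) (fr.slice t a) (v • fr.dir) (v • fr.dir)| ≤ sd.L := by
      intro v hv
      have h1 := (fderiv ℝ (fderiv ℝ fr.g) (fr.slice t a)).le_opNorm₂ (v • fr.dir) (v • fr.dir)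
      rw [hsmul v hv, mul_one, mul_one] at h1
      exact h1.trans (sd.norm_hess_le _ (hmem a ha.1.le))
    refine (abs_add_le _ _).trans ?_
    linarith [hb 1 (by simp), hb Complex.I (by simp)]
  · intro a ha
    have := neg_le_of_abs_le (sd.abs_le _ (hmem a ha.1.le))
    simp only [hr]
    linarith
  · intro a ha
    simp only [Fin.sum_univ_two, Matrix.cons_val_zero, Matrix.cons_val_one]
    have h1 := hu.contDiffAt hΩ (hWΩ a ha)
    have h2 : ∀ v : ℂ, fderiv ℝ (fderiv ℝ fun a => u (fr.slice t a)) a v v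
        = fderiv ℝ (fderiv ℝ u) (fr.slice t a) (v • fr.dir) (v • fr.dir) := fun v =>
      fderiv_fderiv_comp_affine (lineCLM fr.dir) _ a v v h1
    have h3 := hu.lineLaplacian_eq_zero hΩ (hWΩ a ha) fr.dir
    rw [lineLaplacian] at h3
    rw [h2, h2, one_smul]
    exact h3

end Slices

end LumerHardy

namespace LumerHardy

open Filter Topology Metric

/-! ### Sums of separated peaks -/

section PeakSums

/-- The indices on either side of `k` contribute at most `∑ 1 / i² ≤ 2` each. -/
theorem sum_inv_sq_sub_le (N k : ℕ) :
    ∑ j ∈ (Finset.range N).erase k, (((j : ℝ) - k) ^ 2)⁻¹ ≤ 4 := by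
  have hside : ∀ (S : Finset ℕ) (φ : ℕ → ℕ), (∀ j ∈ S, φ j ∈ Finset.Ioo 0 (N + k + 1)) →
      Set.InjOn φ S → ∑ j ∈ S, ((φ j : ℝ) ^ 2)⁻¹ ≤ 2 := by
    intro S φ hφ hinj
    rw [← Finset.sum_image (f := fun i : ℕ => ((i : ℝ) ^ 2)⁻¹) hinj]
    refine (Finset.sum_le_sum_of_subset_of_nonneg (Finset.image_subset_iff.2 hφ)
      fun i _ _ => by positivity).trans ((sum_Ioo_inv_sq_le 0 (N + k + 1)).trans (by norm_num))
  rw [← Finset.sum_filter_add_sum_filter_not _ (fun j => j < k)]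
  have h1 : ∑ j ∈ ((Finset.range N).erase k).filter (fun j => j < k), (((j : ℝ) - k) ^ 2)⁻¹ ≤ 2 := by
    refine le_trans (le_of_eq (Finset.sum_congr rfl fun j hj => ?_))
      (hside _ (fun j => k - j) ?_ ?_)
    · have := (Finset.mem_filter.1 hj).2
      rw [Nat.cast_sub this.le, ← neg_sq, neg_sub]
    · intro j hj
      have := (Finset.mem_filter.1 hj).2
      simp only [Finset.mem_Ioo]
      omega
    · intro i hi j hj hij
      have h2 := (Finset.mem_filter.1 hi).2
      have h3 := (Finset.mem_filter.1 hj).2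
      simp only at hij
      omega
  have h2 : ∑ j ∈ ((Finset.range N).erase k).filter (fun j => ¬ j < k), (((j : ℝ) - k) ^ 2)⁻¹
      ≤ 2 := by
    refine le_trans (le_of_eq (Finset.sum_congr rfl fun j hj => ?_))
      (hside _ (fun j => j - k) ?_ ?_)
    · have := (Finset.mem_filter.1 hj).2
      rw [Nat.cast_sub (not_lt.1 this)]
    · intro j hj
      have h2 := (Finset.mem_filter.1 hj).2
      have h3 := Finset.mem_erase.1 (Finset.mem_filter.1 hj).1
      have h4 := Finset.mem_range.1 h3.2
      have h5 := h3.1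
      simp only [Finset.mem_Ioo]
      omega
    · intro i hi j hj hij
      have h2 := (Finset.mem_filter.1 hi).2
      have h3 := (Finset.mem_filter.1 hj).2
      simp only at hij
      omega
  linarith

/-- The sum `∑ (1 + M w_k)⁻²`. -/
noncomputable def peakSum (M : ℝ) (N : ℕ) (w : ℕ → ℂ) : ℂ :=
  ∑ k ∈ Finset.range N, ((1 + M * w k) ^ 2)⁻¹

variable {M : ℝ} {N : ℕ} {w : ℕ → ℂ}

theorem one_le_norm_one_add (hM : 0 ≤ M) {w : ℂ} (hw : 0 ≤ w.re) : 1 ≤ ‖1 + M * w‖ := by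
  refine le_trans ?_ (Complex.re_le_norm _)
  simp only [Complex.add_re, Complex.one_re, Complex.re_ofReal_mul]
  have := mul_nonneg hM hw
  linarith

theorem mul_re_le_norm_one_add {w : ℂ} : M * w.re ≤ ‖1 + M * w‖ := by
  refine le_trans ?_ (Complex.re_le_norm _)
  simp only [Complex.add_re, Complex.one_re, Complex.re_ofReal_mul]
  linarith

theorem mul_norm_le_norm_one_add (hM : 0 ≤ M) {w : ℂ} (hw : 0 ≤ w.re) :
    M * ‖w‖ ≤ ‖1 + M * w‖ := by
  have h1 : 0 ≤ M * w.re := mul_nonneg hM hw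
  have h2 : (M * ‖w‖) ^ 2 ≤ ‖1 + M * w‖ ^ 2 := by
    rw [mul_pow, Complex.sq_norm, Complex.sq_norm, Complex.normSq_apply, Complex.normSq_apply]
    simp only [Complex.add_re, Complex.one_re, Complex.re_ofReal_mul, Complex.add_im,
      Complex.one_im, Complex.im_ofReal_mul, zero_add]
    nlinarith
  exact abs_le_of_sq_le_sq' h2 (norm_nonneg _) |>.2

theorem sum_erase_norm_inv_le {k : ℕ}
    (h : ∀ j ∈ Finset.range N, j ≠ k → 4 * |(j : ℝ) - k| ≤ ‖1 + M * w j‖) :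
    ∑ j ∈ (Finset.range N).erase k, ‖((1 + M * w j) ^ 2)⁻¹‖ ≤ 1 / 4 := by
  calc ∑ j ∈ (Finset.range N).erase k, ‖((1 + M * w j) ^ 2)⁻¹‖
      ≤ ∑ j ∈ (Finset.range N).erase k, 1 / 16 * (((j : ℝ) - k) ^ 2)⁻¹ := by
        refine Finset.sum_le_sum fun j hj => ?_
        obtain ⟨hjk, hj⟩ := Finset.mem_erase.1 hj
        have h1 := h j hj hjk
        have h2 : 0 < |(j : ℝ) - k| := abs_pos.2 (sub_ne_zero.2 (Nat.cast_injective.ne hjk))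
        rw [norm_inv, norm_pow, ← sq_abs ((j : ℝ) - k), one_div, ← mul_inv]
        refine inv_anti₀ (by positivity) ?_
        calc 16 * |(j : ℝ) - k| ^ 2 = (4 * |(j : ℝ) - k|) ^ 2 := by ring
          _ ≤ _ := by gcongr
    _ ≤ 1 / 16 * 4 := by
        rw [← Finset.mul_sum]
        gcongr
        exact sum_inv_sq_sub_le N k
    _ = 1 / 4 := by norm_num

/-- Let `w k` be smallest in modulus. Separation then forces `M * ‖w j‖ ≥ 4 * |j - k|`, so the
remaining terms add up to at most `1 / 4`, while the `k`-th is at most `1`. -/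
theorem norm_peakSum_le_five_quarters (hM : 0 ≤ M) (hre : ∀ k ∈ Finset.range N, 0 ≤ (w k).re)
    (hsep : ∀ j ∈ Finset.range N, ∀ k ∈ Finset.range N,
      8 * |(j : ℝ) - k| ≤ M * (‖w j‖ + ‖w k‖)) : ‖peakSum M N w‖ ≤ 5 / 4 := by
  rcases Nat.eq_zero_or_pos N with rfl | hN
  · simp only [peakSum, Finset.range_zero, Finset.sum_empty, norm_zero]
    norm_num
  obtain ⟨k, hk, hmin⟩ := Finset.exists_min_image (Finset.range N) (fun k => ‖w k‖)
    ⟨0, Finset.mem_range.2 hN⟩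
  have h1 := sum_erase_norm_inv_le (M := M) (N := N) (w := w) (k := k) fun j hj _ => by
    have h2 := hsep j hj k hk
    have h3 := mul_norm_le_norm_one_add hM (hre j hj)
    have h4 := mul_le_mul_of_nonneg_left (hmin j hj) hM
    linarith
  have h2 : ‖((1 + M * w k) ^ 2)⁻¹‖ ≤ 1 := by
    rw [norm_inv, norm_pow]
    exact inv_le_one_of_one_le₀ (one_le_pow₀ (one_le_norm_one_add hM (hre k hk)))
  refine (norm_sum_le _ _).trans ?_
  rw [← Finset.add_sum_erase _ _ hk]
  linarith

/-- The `k`-th term is at least `(10 / 11)² ≥ 3 / 4`, and separation from it bounds the other terms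
together by `1 / 4`. -/
theorem half_le_norm_peakSum (hM : 0 ≤ M) (hre : ∀ k ∈ Finset.range N, 0 ≤ (w k).re)
    (hsep : ∀ j ∈ Finset.range N, ∀ k ∈ Finset.range N,
      8 * |(j : ℝ) - k| ≤ M * (‖w j‖ + ‖w k‖))
    {k : ℕ} (hk : k ∈ Finset.range N) (hwk : M * ‖w k‖ ≤ 1 / 10) : 1 / 2 ≤ ‖peakSum M N w‖ := by
  have h1 := sum_erase_norm_inv_le (M := M) (N := N) (w := w) (k := k) fun j hj hjk => by
    have h2 := hsep j hj k hk
    have h3 := mul_norm_le_norm_one_add hM (hre j hj)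
    have h4 : (1 : ℝ) ≤ |(j : ℝ) - k| := by
      have h5 : (1 : ℤ) ≤ |(j : ℤ) - k| := Int.one_le_abs (by omega)
      exact_mod_cast h5
    linarith
  have h2 : 3 / 4 ≤ ‖((1 + M * w k) ^ 2)⁻¹‖ := by
    have h3 : ‖1 + M * w k‖ ≤ 11 / 10 := by
      refine (norm_add_le _ _).trans ?_
      rw [norm_one, norm_mul, Complex.norm_real, Real.norm_of_nonneg hM]
      linarith
    have h4 : 0 < ‖1 + M * w k‖ := one_pos.trans_le (one_le_norm_one_add hM (hre k hk))
    rw [norm_inv, norm_pow, le_inv_comm₀ (by norm_num) (by positivity)]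
    calc ‖1 + M * w k‖ ^ 2 ≤ (11 / 10) ^ 2 := by gcongr
      _ ≤ _ := by norm_num
  have h3 := norm_sum_le ((Finset.range N).erase k) fun j => ((1 + M * w j) ^ 2)⁻¹
  rw [peakSum, ← Finset.add_sum_erase _ _ hk]
  have h4 := norm_sub_le_norm_add ((((1 + M * w k) ^ 2)⁻¹ : ℂ))
    (∑ j ∈ (Finset.range N).erase k, ((1 + M * w j) ^ 2)⁻¹)
  linarith

theorem norm_peakSum_le_of_le_re {s : ℝ} (hs : 0 < s) (hM : 0 < M)
    (hre : ∀ k ∈ Finset.range N, s ≤ (w k).re) : ‖peakSum M N w‖ ≤ N / (M * s) ^ 2 := by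
  refine (norm_sum_le _ _).trans ?_
  refine (Finset.sum_le_card_nsmul _ _ (((M * s) ^ 2)⁻¹) fun k hk => ?_).trans (le_of_eq ?_)
  · rw [norm_inv, norm_pow]
    refine inv_anti₀ (by positivity) ?_
    gcongr
    exact (mul_le_mul_of_nonneg_left (hre k hk) hM.le).trans mul_re_le_norm_one_add
  · rw [Finset.card_range, nsmul_eq_mul, div_eq_mul_inv]

end PeakSums

/-! ### Complex supporting functions and boundary points of slices -/

section PeakFunctions

variable {n : ℕ} {Ω : Set (EuclideanSpace ℂ (Fin n))} {fr : ConvexFrame Ω}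

/-- The complex affine function with real part `dg_p (p - z)`. -/
noncomputable def ConvexFrame.supp (fr : ConvexFrame Ω) (p z : EuclideanSpace ℂ (Fin n)) : ℂ :=
  StrongDual.extendRCLike (𝕜 := ℂ) (fderiv ℝ fr.g p) (p - z)

theorem ConvexFrame.supp_re (p z : EuclideanSpace ℂ (Fin n)) :
    (fr.supp p z).re = fderiv ℝ fr.g p (p - z) :=
  StrongDual.re_extendRCLike_apply (𝕜 := ℂ) _ _

theorem ConvexFrame.norm_supp_le (p z : EuclideanSpace ℂ (Fin n)) :
    ‖fr.supp p z‖ ≤ ‖fderiv ℝ fr.g p‖ * ‖p - z‖ := by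
  refine (ContinuousLinearMap.le_opNorm _ _).trans ?_
  rw [StrongDual.norm_extendRCLike]

theorem ConvexFrame.differentiable_supp (p : EuclideanSpace ℂ (Fin n)) :
    Differentiable ℂ (fr.supp p) :=
  (ContinuousLinearMap.differentiable _).comp (differentiable_const p |>.sub differentiable_id)

theorem ConvexFrame.le_supp_re {p : EuclideanSpace ℂ (Fin n)} (hp : p ∈ closedBall fr.pt fr.r)
    (hgp : fr.g p = 0) {z : EuclideanSpace ℂ (Fin n)} (hz : z ∈ Ω) :
    fr.c * ‖z - p‖ ^ 2 ≤ (fr.supp p z).re := by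
  rw [ConvexFrame.supp_re]
  exact fr.support p hp hgp z hz

/-- If `z` is close to `p`, the two supporting functions differ by the value at `q - p` of the
complex derivative at `q`, which is at least a multiple of `‖a - b‖`, up to an error that is half as
large. If `z` is far from `p`, strong support bounds the first one from below. -/
theorem SliceData.exists_separation (sd : SliceData fr) :
    ∃ c > 0, ∀ t ∈ Icc sd.τ (2 * sd.τ), ∀ a b : ℂ, ‖a‖ ≤ sd.Λ → ‖b‖ ≤ sd.Λ →
      fr.g (fr.slice t a) = 0 → fr.g (fr.slice t b) = 0 → ∀ z ∈ Ω,
      c * ‖a - b‖ ≤ ‖fr.supp (fr.slice t a) z‖ + ‖fr.supp (fr.slice t b) z‖ := by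
  have hm := sd.m_pos
  have hΛ := sd.Λ_pos
  have hL := sd.L_pos
  have hc := fr.c_pos
  -- The derivative of `g` is `L`-Lipschitz, so for `‖p - z‖ ≤ s` the error is at most `m / (2 * Λ)
  -- * ‖a - b‖`, half of the main term.
  set s := sd.m / (2 * sd.L * sd.Λ) with hs
  have hs0 : 0 < s := by positivity
  refine ⟨min (sd.m / (2 * sd.Λ)) (fr.c * s ^ 2 / (2 * sd.Λ)), by positivity, ?_⟩
  intro t ht a b ha hb hga hgb z hz
  set p := fr.slice t a with hp
  set q := fr.slice t b with hq
  have hpB : p ∈ closedBall fr.pt fr.r := sd.slice_mem t ht a ha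
  have hqB : q ∈ closedBall fr.pt fr.r := sd.slice_mem t ht b hb
  by_cases hzs : ‖p - z‖ ≤ s
  · have h1 : fr.supp q z - fr.supp p z
        = StrongDual.extendRCLike (𝕜 := ℂ) (fderiv ℝ fr.g q) (q - p)
          + StrongDual.extendRCLike (𝕜 := ℂ) (fderiv ℝ fr.g q - fderiv ℝ fr.g p) (p - z) := by
      simp only [ConvexFrame.supp, StrongDual.extendRCLike_apply, sub_apply, map_sub]
      ring
    have h2 : ‖StrongDual.extendRCLike (𝕜 := ℂ) (fderiv ℝ fr.g q - fderiv ℝ fr.g p) (p - z)‖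
        ≤ sd.m / (2 * sd.Λ) * ‖a - b‖ := by
      refine (ContinuousLinearMap.le_opNorm _ _).trans ?_
      rw [StrongDual.norm_extendRCLike]
      calc ‖fderiv ℝ fr.g q - fderiv ℝ fr.g p‖ * ‖p - z‖
          ≤ (sd.L * ‖q - p‖) * s := by
            gcongr
            exact sd.norm_fderiv_sub_le hqB hpB
        _ = sd.m / (2 * sd.Λ) * ‖a - b‖ := by
            rw [hp, hq, fr.norm_slice_sub_slice, norm_sub_rev, hs]
            field_simp
    have h3 : sd.m / sd.Λ * ‖a - b‖
        ≤ ‖StrongDual.extendRCLike (𝕜 := ℂ) (fderiv ℝ fr.g q) (q - p)‖ := by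
      rw [hp, hq, fr.slice_sub_slice, map_smul, norm_smul, norm_sub_rev b a, mul_comm]
      gcongr
      rw [div_le_iff₀ hΛ]
      have h4 := sd.le_fderiv_smul_dir ht hb
      rw [hgb, zero_add, ← StrongDual.re_extendRCLike_apply (𝕜 := ℂ), map_smul] at h4
      refine h4.trans ((Complex.re_le_norm _).trans ?_)
      rw [norm_smul, mul_comm]
      gcongr
    have h4 := norm_sub_le (fr.supp q z) (fr.supp p z)
    rw [h1] at h4
    have h5 := norm_sub_le_norm_add (StrongDual.extendRCLike (𝕜 := ℂ) (fderiv ℝ fr.g q) (q - p))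
      (StrongDual.extendRCLike (𝕜 := ℂ) (fderiv ℝ fr.g q - fderiv ℝ fr.g p) (p - z))
    have h6 : min (sd.m / (2 * sd.Λ)) (fr.c * s ^ 2 / (2 * sd.Λ)) * ‖a - b‖
        ≤ sd.m / (2 * sd.Λ) * ‖a - b‖ := by
      gcongr
      exact min_le_left _ _
    have h7 : sd.m / sd.Λ * ‖a - b‖
        = sd.m / (2 * sd.Λ) * ‖a - b‖ + sd.m / (2 * sd.Λ) * ‖a - b‖ := by
      field_simp
      ring
    linarith
  · push Not at hzs
    have h1 : fr.c * s ^ 2 ≤ ‖fr.supp p z‖ := by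
      refine le_trans ?_ ((ConvexFrame.le_supp_re hpB hga hz).trans (Complex.re_le_norm _))
      rw [norm_sub_rev] at hzs
      gcongr
    have h2 : ‖a - b‖ ≤ 2 * sd.Λ := (norm_sub_le _ _).trans (by linarith)
    calc min (sd.m / (2 * sd.Λ)) (fr.c * s ^ 2 / (2 * sd.Λ)) * ‖a - b‖
        ≤ fr.c * s ^ 2 / (2 * sd.Λ) * (2 * sd.Λ) := by
          gcongr
          exact min_le_right _ _
      _ = fr.c * s ^ 2 := by field_simp
      _ ≤ _ := by linarith [norm_nonneg (fr.supp q z)]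

/-- Along the segment from `i y` to `Λ / 2 + i y` the function `g` changes sign. Prescribing the
imaginary part makes equally spaced choices possible. -/
theorem SliceData.exists_zeros (sd : SliceData fr) :
    ∃ y₀ > 0, ∀ t ∈ Icc sd.τ (2 * sd.τ), ∀ y ∈ Icc 0 y₀, ∃ a : ℂ, a.im = y ∧
      ‖a‖ ≤ 3 / 4 * sd.Λ ∧ fr.g (fr.slice t a) = 0 := by
  have hm := sd.m_pos
  have hΛ := sd.Λ_pos
  have hL := sd.L_pos
  refine ⟨min (sd.m / (2 * sd.L)) (sd.Λ / 4), by positivity, fun t ht y hy => ?_⟩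
  have hy1 : y ≤ sd.m / (2 * sd.L) := hy.2.trans (min_le_left _ _)
  have hy2 : y ≤ sd.Λ / 4 := hy.2.trans (min_le_right _ _)
  rw [le_div_iff₀ (by positivity)] at hy1
  have hcont : Continuous fun x : ℝ => fr.g (fr.slice t (x + y * Complex.I)) :=
    fr.contDiff.continuous.comp ((fr.continuous_slice t).comp (by fun_prop))
  have hny : ‖(y * Complex.I : ℂ)‖ = y := by
    rw [norm_mul, Complex.norm_I, mul_one, Complex.norm_real, Real.norm_of_nonneg hy.1]
  have h0 : fr.g (fr.slice t ((0 : ℝ) + y * Complex.I)) ≤ 0 := by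
    have h1 := sd.abs_sub_le (sd.slice_mem t ht (y * Complex.I) (by rw [hny]; linarith))
      (sd.slice_mem t ht 0 (by simpa using hΛ.le))
    rw [fr.norm_slice_sub_slice, sub_zero, hny] at h1
    have h2 := sd.slice_zero_le t ht
    have h3 := (_root_.abs_le.1 h1).2
    rw [Complex.ofReal_zero, zero_add]
    linarith
  have hnx : ∀ x ∈ Icc 0 (sd.Λ / 2), ‖((x : ℝ) + y * Complex.I : ℂ)‖ ≤ 3 / 4 * sd.Λ := by
    intro x hx
    refine (norm_add_le _ _).trans ?_
    rw [hny, Complex.norm_real, Real.norm_of_nonneg hx.1]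
    linarith [hx.2]
  have h1 : 0 ≤ fr.g (fr.slice t ((sd.Λ / 2 : ℝ) + y * Complex.I)) := by
    refine (sd.slice_pos t ht _ ?_ ((hnx _ ⟨by positivity, le_rfl⟩).trans (by linarith))).le
    refine le_trans (le_of_eq ?_) (Complex.re_le_norm _)
    simp
  obtain ⟨x, hx, hgx⟩ := intermediate_value_Icc (by positivity : (0 : ℝ) ≤ sd.Λ / 2)
    hcont.continuousOn ⟨h0, h1⟩
  exact ⟨x + y * Complex.I, by simp, hnx x hx, hgx⟩

/-- The point `b = (1 - s) a` is found on the ray to the centre of the slice. Convexity at `b`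
towards `a` and towards the centre gives `s * m ≤ ε`. -/
theorem SliceData.exists_level (sd : SliceData fr) {t : ℝ} (ht : t ∈ Icc sd.τ (2 * sd.τ)) {a : ℂ}
    (ha : ‖a‖ ≤ sd.Λ) (hga : fr.g (fr.slice t a) = 0) {ε : ℝ} (hε : 0 ≤ ε) (hεm : ε ≤ sd.m) :
    ∃ b : ℂ, ‖b‖ ≤ ‖a‖ ∧ ‖b - a‖ ≤ sd.Λ / sd.m * ε ∧ fr.g (fr.slice t b) = -ε := by
  have hm := sd.m_pos
  have hcont : Continuous fun s : ℝ => fr.g (fr.slice t ((1 - s : ℝ) * a)) :=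
    fr.contDiff.continuous.comp ((fr.continuous_slice t).comp (by fun_prop))
  have h0 : -ε ≤ fr.g (fr.slice t ((1 - (0 : ℝ) : ℝ) * a)) := by simpa [hga] using hε
  have h1 : fr.g (fr.slice t ((1 - (1 : ℝ) : ℝ) * a)) ≤ -ε := by
    have := sd.slice_zero_le t ht
    simp only [sub_self, Complex.ofReal_zero, zero_mul]
    linarith
  obtain ⟨s, hs, hgs⟩ := intermediate_value_Icc' zero_le_one hcont.continuousOn ⟨h1, h0⟩
  simp only at hgs
  have hs1 : 0 ≤ 1 - s := by linarith [hs.2]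
  have hn : ‖((1 - s : ℝ) : ℂ) * a‖ = (1 - s) * ‖a‖ := by
    rw [norm_mul, Complex.norm_real, Real.norm_of_nonneg hs1]
  have hle : ‖((1 - s : ℝ) : ℂ) * a‖ ≤ ‖a‖ := by
    rw [hn]
    exact mul_le_of_le_one_left (norm_nonneg _) (by linarith [hs.1])
  refine ⟨(1 - s : ℝ) * a, hle, ?_, hgs⟩
  have h2 := fr.convex _ (sd.slice_mem t ht _ (hle.trans ha)) _ (sd.slice_mem t ht a ha)
  have h3 := sd.le_fderiv_smul_dir ht (hle.trans ha)
  set D := fderiv ℝ fr.g (fr.slice t ((1 - s : ℝ) * a)) (a • fr.dir) with hD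
  have h4 : fderiv ℝ fr.g (fr.slice t ((1 - s : ℝ) * a))
      (fr.slice t a - fr.slice t ((1 - s : ℝ) * a)) = s * D := by
    have : a - (1 - s : ℝ) * a = ((s : ℝ) : ℂ) * a := by push_cast; ring
    rw [fr.slice_sub_slice, this, mul_smul, Complex.coe_smul, map_smul, smul_eq_mul]
  have h5 : fderiv ℝ fr.g (fr.slice t ((1 - s : ℝ) * a)) (((1 - s : ℝ) * a) • fr.dir)
      = (1 - s) * D := by
    rw [mul_smul, Complex.coe_smul, map_smul, smul_eq_mul]
  rw [h4, hga, hgs] at h2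
  rw [h5, hgs] at h3
  have h6 : 0 ≤ fr.c * ‖fr.slice t a - fr.slice t ((1 - s : ℝ) * a)‖ ^ 2 := by
    have := fr.c_pos
    positivity
  have h7 : s * D ≤ ε := by linarith
  have h8 : s * sd.m ≤ ε := by
    have h9 := mul_le_mul_of_nonneg_left h3 hs.1
    have h10 := mul_le_mul_of_nonneg_left h7 hs1
    nlinarith
  have h9 : ((1 - s : ℝ) : ℂ) * a - a = -((s : ℝ) : ℂ) * a := by push_cast; ring
  rw [h9, norm_mul, norm_neg, Complex.norm_real, Real.norm_of_nonneg hs.1, div_mul_eq_mul_div,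
    le_div_iff₀ hm]
  calc s * ‖a‖ * sd.m = (s * sd.m) * ‖a‖ := by ring
    _ ≤ ε * sd.Λ := by gcongr
    _ = _ := mul_comm _ _

end PeakFunctions

end LumerHardy

namespace LumerHardy

open Filter Topology Metric

/-! ### Peak functions without small majorants -/

section PeakExistence

variable {n : ℕ} {Ω : Set (EuclideanSpace ℂ (Fin n))} {fr : ConvexFrame Ω}

theorem nsmul_le_setIntegral_of_pairwise_disjoint_ball {S : Set ℂ} {N : ℕ} {b : ℕ → ℂ} {δ β : ℝ}
    (hδ : 0 ≤ δ) {f : ℂ → ℝ} (hS : IsCompact S) (hf : ContinuousOn f S) (hf0 : ∀ x ∈ S, 0 ≤ f x)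
    (hball : ∀ k ∈ Finset.range N, ball (b k) δ ⊆ S)
    (hdisj : (Finset.range N : Set ℕ).PairwiseDisjoint fun k => ball (b k) δ)
    (hβ : ∀ k ∈ Finset.range N, ∀ x ∈ ball (b k) δ, β ≤ f x) :
    β * (N * (δ ^ 2 * Real.pi)) ≤ ∫ x in S, f x := by
  set V : Set ℂ := ⋃ k ∈ Finset.range N, ball (b k) δ with hV
  have hVS : V ⊆ S := iUnion₂_subset hball
  have hint : IntegrableOn f S := hf.integrableOn_compact hS
  have hVm : MeasurableSet V := (Finset.range N).measurableSet_biUnion fun k _ => measurableSet_ball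
  have hvol : volume.real V = N * (δ ^ 2 * Real.pi) := by
    rw [hV, measureReal_biUnion_finset hdisj fun k _ => measurableSet_ball]
    have : ∀ k ∈ Finset.range N, volume.real (ball (b k) δ) = δ ^ 2 * Real.pi := by
      intro k _
      rw [measureReal_def, Complex.volume_ball]
      simp [hδ]
    rw [Finset.sum_congr rfl this, Finset.sum_const, Finset.card_range, nsmul_eq_mul]
  have hVfin : volume V ≠ ∞ := ((measure_mono hVS).trans_lt hS.measure_lt_top).ne
  rw [← hvol]
  refine (setIntegral_ge_of_const_le_real hVm hVfin (fun x hx => ?_) (hint.mono_set hVS)).trans ?_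
  · obtain ⟨k, hk, hx⟩ := mem_iUnion₂.1 hx
    exact hβ k hk x hx
  · exact setIntegral_mono_set hint
      ((ae_restrict_mem hS.measurableSet).mono fun x hx => hf0 x hx) hVS.eventuallyLE

set_option maxHeartbeats 1000000 in
/-- Functions that are small off a slice of `Ω`, but so large on it that their square has no
small pluriharmonic majorant. -/
theorem SliceData.exists_peak (sd : SliceData fr) (hΩ : IsOpen Ω) (hc : IsPreconnected Ω)
    {P₀ : EuclideanSpace ℂ (Fin n)} (hP₀ : P₀ ∈ Ω) :
    ∃ C > 0, ∃ N₀ : ℕ, ∀ N ≥ N₀, ∀ t ∈ Icc sd.τ (2 * sd.τ), ∃ F : EuclideanSpace ℂ (Fin n) → ℂ,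
      DifferentiableOn ℂ F Ω ∧ (∀ z ∈ Ω, ‖F z‖ ≤ 5 / 4) ∧
      (∀ z ∈ Ω, ∀ d > 0, (∀ a : ℂ, ‖a‖ ≤ sd.Λ → fr.g (fr.slice t a) = 0 →
        d ≤ ‖z - fr.slice t a‖) → ‖F z‖ ≤ C / (N * d ^ 4)) ∧
      ∀ u, PluriharmonicOn u Ω → (∀ z ∈ Ω, 0 ≤ u z) → ∀ β,
        (∀ z ∈ Ω, inner ℝ fr.pt z = (1 - t) * ‖fr.pt‖ ^ 2 → 1 / 2 ≤ ‖F z‖ → β ≤ u z) →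
        β ≤ C * u P₀ := by
  have hm0 := sd.m_pos
  have hΛ0 := sd.Λ_pos
  have hL0 := sd.L_pos
  have hfc := fr.c_pos
  obtain ⟨c₃, hc₃, hsep⟩ := sd.exists_separation
  obtain ⟨y₀, hy₀, hzero⟩ := sd.exists_zeros
  obtain ⟨ε₀, hε₀, C₁, hC₁, hshell⟩ := sd.exists_shell_le hΩ hc hP₀
  set A := 8 / c₃ with hA
  have hA0 : 0 < A := by positivity
  set C₅ := sd.L * (sd.Λ / sd.m) + 1 / 2 with hC₅
  have hC₅0 : 0 < C₅ := by positivity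
  set e := y₀ / (10 * C₅ * A) with he
  have he0 : 0 < e := by positivity
  set C₇ := y₀ ^ 2 / (A * fr.c) ^ 2 with hC₇
  have hC₇0 : 0 < C₇ := by positivity
  set C₈ := 4 * sd.L ^ 2 * C₁ / (e * Real.pi) with hC₈
  have hC₈0 : 0 < C₈ := by positivity
  obtain ⟨N₀, hN₀⟩ := exists_nat_gt (max (e / ε₀) (max (e / sd.m) (e / (sd.L * sd.Λ / 2))))
  refine ⟨max C₇ C₈, by positivity, max N₀ 1, fun N hN t ht => ?_⟩
  have hN1 : 0 < (N : ℝ) := Nat.cast_pos.2 ((le_max_right N₀ 1).trans hN)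
  have hNN : (N₀ : ℝ) ≤ N := Nat.cast_le.2 ((le_max_left N₀ 1).trans hN)
  set ε := e / N with hε
  have hε0 : 0 < ε := by positivity
  have hεlt : ∀ x, 0 < x → e / x < N₀ → ε < x := fun x hx h => by
    rw [div_lt_iff₀ hx] at h
    rw [hε, div_lt_iff₀ hN1]
    nlinarith
  have hε1 : ε < ε₀ := hεlt _ hε₀ ((le_max_left _ _).trans_lt hN₀)
  have hε2 : ε < sd.m := hεlt _ hm0 (((le_max_left _ _).trans (le_max_right _ _)).trans_lt hN₀)
  have hε3 : ε < sd.L * sd.Λ / 2 :=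
    hεlt _ (by positivity) (((le_max_right _ _).trans (le_max_right _ _)).trans_lt hN₀)
  -- The points have imaginary parts spaced by `y₀ / N`, so their supporting functions are `c₃ * y₀
  -- / N` separated; this `M` rescales the separation to `8`.
  set M := A * N / y₀ with hM
  have hM0 : 0 < M := by positivity
  have hMε : M * (C₅ * ε) = 1 / 10 := by
    rw [hM, hε, he]
    field_simp
  have hlam : ∀ k : ℕ, ∃ a : ℂ, k < N → a.im = k * y₀ / N ∧ ‖a‖ ≤ 3 / 4 * sd.Λ ∧
      fr.g (fr.slice t a) = 0 := by
    intro k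
    by_cases hk : k < N
    · have hk' : (k : ℝ) ≤ N := Nat.cast_le.2 hk.le
      obtain ⟨a, ha⟩ := hzero t ht (k * y₀ / N) ⟨by positivity, by
        rw [div_le_iff₀ hN1, mul_comm]
        gcongr⟩
      exact ⟨a, fun _ => ha⟩
    · exact ⟨0, fun h => absurd h hk⟩
  choose a ha using hlam
  have haΛ : ∀ k < N, ‖a k‖ ≤ sd.Λ := fun k hk => (ha k hk).2.1.trans (by linarith)
  set p : ℕ → EuclideanSpace ℂ (Fin n) := fun k => fr.slice t (a k) with hp
  have hpB : ∀ k < N, p k ∈ closedBall fr.pt fr.r := fun k hk => sd.slice_mem t ht _ (haΛ k hk)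
  have hpg : ∀ k < N, fr.g (p k) = 0 := fun k hk => (ha k hk).2.2
  have hre' : ∀ z ∈ Ω, ∀ k ∈ Finset.range N, fr.c * ‖z - p k‖ ^ 2 ≤ (fr.supp (p k) z).re :=
    fun z hz k hk => ConvexFrame.le_supp_re (hpB k (Finset.mem_range.1 hk))
      (hpg k (Finset.mem_range.1 hk)) hz
  have hre : ∀ z ∈ Ω, ∀ k ∈ Finset.range N, 0 ≤ (fr.supp (p k) z).re := fun z hz k hk =>
    le_trans (by positivity) (hre' z hz k hk)
  have hsepz : ∀ z ∈ Ω, ∀ j ∈ Finset.range N, ∀ k ∈ Finset.range N,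
      8 * |(j : ℝ) - k| ≤ M * (‖fr.supp (p j) z‖ + ‖fr.supp (p k) z‖) := by
    intro z hz j hj k hk
    rw [Finset.mem_range] at hj hk
    have h1 := hsep t ht (a j) (a k) (haΛ j hj) (haΛ k hk) (hpg j hj) (hpg k hk) z hz
    have h2 : |(j : ℝ) - k| * (y₀ / N) ≤ ‖a j - a k‖ := by
      refine le_trans (le_of_eq ?_) (Complex.abs_im_le_norm _)
      rw [Complex.sub_im, (ha j hj).1, (ha k hk).1, ← abs_of_pos (div_pos hy₀ hN1), ← abs_mul]
      congr 1
      ring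
    calc 8 * |(j : ℝ) - k| = M * (c₃ * (|(j : ℝ) - k| * (y₀ / N))) := by
          rw [hM, hA]
          field_simp
      _ ≤ M * (c₃ * ‖a j - a k‖) := by gcongr
      _ ≤ _ := by gcongr
  refine ⟨fun z => peakSum M N fun k => fr.supp (p k) z, ?_, fun z hz =>
    norm_peakSum_le_five_quarters hM0.le (hre z hz) (hsepz z hz), ?_, ?_⟩
  · intro z hz
    refine DifferentiableAt.differentiableWithinAt ?_
    refine DifferentiableAt.fun_sum fun k hk => DifferentiableAt.fun_inv ?_ ?_
    · exact ((ConvexFrame.differentiable_supp (p k) z).const_mul _ |>.const_add _).pow 2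
    · refine pow_ne_zero 2 (norm_pos_iff.1 ?_)
      exact one_pos.trans_le (one_le_norm_one_add hM0.le (hre z hz k hk))
  · intro z hz d hd hdist
    have h1 := norm_peakSum_le_of_le_re (M := M) (N := N) (w := fun k => fr.supp (p k) z)
      (s := fr.c * d ^ 2) (by positivity) hM0 fun k hk => by
        refine le_trans ?_ (hre' z hz k hk)
        rw [Finset.mem_range] at hk
        have := hdist (a k) (haΛ k hk) (hpg k hk)
        gcongr
    refine h1.trans ?_
    calc (N : ℝ) / (M * (fr.c * d ^ 2)) ^ 2 = C₇ / (N * d ^ 4) := by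
          rw [hM, hC₇]
          field_simp
      _ ≤ _ := by
          gcongr
          exact le_max_left _ _
  · intro u hu hu0 β hβ
    have hlev : ∀ k : ℕ, ∃ b : ℂ, k < N → ‖b‖ ≤ ‖a k‖ ∧ ‖b - a k‖ ≤ sd.Λ / sd.m * ε ∧
        fr.g (fr.slice t b) = -ε := by
      intro k
      by_cases hk : k < N
      · obtain ⟨b, hb⟩ := sd.exists_level ht (haΛ k hk) (hpg k hk) hε0.le hε2.le
        exact ⟨b, fun _ => hb⟩
      · exact ⟨0, fun h => absurd h hk⟩
    choose b hb using hlev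
    -- A disc of radius `δ` about a point at level `-ε` stays in the shell.
    set δ := ε / (2 * sd.L) with hδ
    have hδ0 : 0 < δ := by positivity
    have hδΛ : δ ≤ sd.Λ / 4 := by
      rw [hδ, div_le_iff₀ (by positivity)]
      linarith
    set S : Set ℂ := {a : ℂ | ‖a‖ ≤ sd.Λ ∧ -(3 / 2 * ε) ≤ fr.g (fr.slice t a) ∧
        fr.g (fr.slice t a) ≤ -(ε / 2)} with hS
    have hgc : Continuous fun a : ℂ => fr.g (fr.slice t a) :=
      fr.contDiff.continuous.comp (fr.continuous_slice t)
    have hSc : IsCompact S := by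
      have : S = closedBall (0 : ℂ) sd.Λ ∩ {a | -(3 / 2 * ε) ≤ fr.g (fr.slice t a) ∧
          fr.g (fr.slice t a) ≤ -(ε / 2)} := by
        ext x
        simp [hS]
      rw [this]
      exact (isCompact_closedBall _ _).inter_right
        ((isClosed_le continuous_const hgc).inter (isClosed_le hgc continuous_const))
    have hSΩ : ∀ x ∈ S, fr.slice t x ∈ Ω := fun x hx =>
      (fr.neg_iff _ (sd.slice_mem t ht x hx.1)).1 (by linarith [hx.2.2])
    have hballS : ∀ k ∈ Finset.range N, ball (b k) δ ⊆ S := by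
      intro k hk x hx
      rw [Finset.mem_range] at hk
      obtain ⟨h1, h2, h3⟩ := hb k hk
      have hbΛ : ‖b k‖ ≤ 3 / 4 * sd.Λ := h1.trans (ha k hk).2.1
      have hxb : ‖x - b k‖ < δ := by simpa [dist_eq_norm] using hx
      have hx1 : ‖x‖ ≤ sd.Λ := by
        have := norm_le_norm_add_norm_sub (b k) x
        rw [norm_sub_rev] at this
        linarith
      have h4 := sd.abs_sub_le (sd.slice_mem t ht x hx1)
        (sd.slice_mem t ht (b k) (hbΛ.trans (by linarith)))
      rw [fr.norm_slice_sub_slice, h3] at h4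
      have h5 : sd.L * ‖x - b k‖ ≤ ε / 2 := by
        calc sd.L * ‖x - b k‖ ≤ sd.L * δ := by gcongr
          _ = ε / 2 := by rw [hδ]; field_simp
      have h6 := _root_.abs_le.1 (h4.trans h5)
      exact ⟨hx1, by linarith [h6.1], by linarith [h6.2]⟩
    have hnear : ∀ k ∈ Finset.range N, ∀ x ∈ ball (b k) δ,
        M * ‖fr.supp (p k) (fr.slice t x)‖ ≤ 1 / 10 := by
      intro k hk x hx
      rw [Finset.mem_range] at hk
      obtain ⟨h1, h2, h3⟩ := hb k hk
      have hxb : ‖x - b k‖ < δ := by simpa [dist_eq_norm] using hx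
      rw [← hMε]
      gcongr
      refine (ConvexFrame.norm_supp_le _ _).trans ?_
      have h4 : ‖p k - fr.slice t x‖ ≤ sd.Λ / sd.m * ε + δ := by
        rw [hp, fr.norm_slice_sub_slice, norm_sub_rev]
        calc ‖x - a k‖ = ‖(b k - a k) + (x - b k)‖ := by congr 1; ring
          _ ≤ _ := (norm_add_le _ _).trans (by gcongr)
      calc ‖fderiv ℝ fr.g (p k)‖ * ‖p k - fr.slice t x‖
          ≤ sd.L * (sd.Λ / sd.m * ε + δ) := by
            gcongr
            exact sd.norm_fderiv_le _ (hpB k hk)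
        _ = C₅ * ε := by
            rw [hC₅, hδ]
            field_simp
    -- A common point would make both terms at most `1 / 10`, against a separation of at least `8`.
    have hdisj : (Finset.range N : Set ℕ).PairwiseDisjoint fun k => ball (b k) δ := by
      intro j hj k hk hjk
      refine disjoint_left.2 fun x hxj hxk => ?_
      have hj' : j ∈ Finset.range N := hj
      have hk' : k ∈ Finset.range N := hk
      have h1 := hsepz _ (hSΩ x (hballS j hj' hxj)) j hj' k hk'
      have h2 := hnear j hj' x hxj
      have h3 := hnear k hk' x hxk
      have h4 : (1 : ℝ) ≤ |(j : ℝ) - k| := by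
        have h5 : (1 : ℤ) ≤ |(j : ℤ) - k| := Int.one_le_abs (by omega)
        exact_mod_cast h5
      linarith
    have hUc : ContinuousOn (fun x => u (fr.slice t x)) S :=
      hu.continuousOn.comp (fr.continuous_slice t).continuousOn hSΩ
    have h1 := nsmul_le_setIntegral_of_pairwise_disjoint_ball (β := β) hδ0.le hSc hUc
      (fun x hx => hu0 _ (hSΩ x hx)) hballS hdisj fun k hk x hx => by
        refine hβ _ (hSΩ x (hballS k hk hx)) (fr.inner_slice t x) ?_
        have hz := hSΩ x (hballS k hk hx)
        exact half_le_norm_peakSum hM0.le (hre _ hz) (hsepz _ hz) hk (hnear k hk x hx)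
    have h2 := h1.trans (hshell t ht u hu hu0 ε hε0 hε1)
    -- Because `N * ε = e`, the total area of the discs is proportional to `ε`, exactly like the
    -- shell bound, and `ε` cancels.
    have h3 : β * (N * (δ ^ 2 * Real.pi)) = β * (e * Real.pi / (4 * sd.L ^ 2)) * ε := by
      rw [hδ, hε]
      field_simp
      ring
    have h4 : C₁ * ε * u P₀ = C₁ * u P₀ * ε := by ring
    rw [h3, h4] at h2
    have h5 := le_of_mul_le_mul_right h2 hε0
    have hu00 := hu0 P₀ hP₀
    calc β = β * (e * Real.pi / (4 * sd.L ^ 2)) * (4 * sd.L ^ 2 / (e * Real.pi)) := by field_simp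
      _ ≤ C₁ * u P₀ * (4 * sd.L ^ 2 / (e * Real.pi)) := by gcongr
      _ = C₈ * u P₀ := by rw [hC₈]; ring
      _ ≤ _ := by
          gcongr
          exact le_max_right _ _

end PeakExistence

end LumerHardy

namespace LumerHardy

open Filter Topology Metric

/-! ### The embedding of bounded sequences -/

section Embedding

variable {n : ℕ} {Ω : Set (EuclideanSpace ℂ (Fin n))} {fr : ConvexFrame Ω}

theorem gap_le_sub {i j : ℕ} (hij : i < j) :
    1 / (((i : ℝ) + 1) * (i + 2)) ≤ 1 / ((i : ℝ) + 1) - 1 / ((j : ℝ) + 1) := by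
  have h : (i : ℝ) + 1 ≤ j := by exact_mod_cast hij
  have h1 : 1 / ((j : ℝ) + 1) ≤ 1 / ((i : ℝ) + 2) := by
    apply one_div_le_one_div_of_le (by positivity)
    linarith
  have h2 : 1 / (((i : ℝ) + 1) * (i + 2)) = 1 / ((i : ℝ) + 1) - 1 / ((i : ℝ) + 2) := by
    field_simp
    ring
  linarith

theorem gap_antitone {i j : ℕ} (hij : i ≤ j) :
    1 / (((j : ℝ) + 1) * (j + 2)) ≤ 1 / (((i : ℝ) + 1) * (i + 2)) := by
  have h : (i : ℝ) ≤ j := by exact_mod_cast hij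
  apply one_div_le_one_div_of_le (by positivity)
  gcongr

theorem gap_le_abs {i j : ℕ} (hij : j ≠ i) :
    1 / (((j : ℝ) + 1) * (j + 2)) ≤ |1 / ((i : ℝ) + 1) - 1 / ((j : ℝ) + 1)| := by
  rcases lt_or_gt_of_ne hij with h | h
  · rw [abs_sub_comm]
    exact (gap_le_sub h).trans (le_abs_self _)
  · exact (gap_antitone h.le).trans ((gap_le_sub h).trans (le_abs_self _))

/-- The slices accumulate only at `t = τ` and are pairwise separated, so each `N j` can be taken
large enough to make `F j` tiny off a thin slab around its own slice. The slabs are disjoint, so at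
most one function is large at any point. -/
theorem SliceData.exists_peak_sequence (sd : SliceData fr) (hΩ : IsOpen Ω) (hc : IsPreconnected Ω)
    {P₀ : EuclideanSpace ℂ (Fin n)} (hP₀ : P₀ ∈ Ω) :
    ∃ C > 0, ∃ F : ℕ → EuclideanSpace ℂ (Fin n) → ℂ, (∀ j, DifferentiableOn ℂ (F j) Ω) ∧
      (∀ j, ∀ z ∈ Ω, ‖F j z‖ ≤ 5 / 4) ∧
      (∀ z ∈ Ω, ∃ i, ∀ j, j ≠ i → ‖F j z‖ ≤ (1 / 2) ^ j / 16) ∧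
      (∀ z ∈ Ω, ∃ r > 0, ball z r ⊆ Ω ∧ ∃ B : ℝ, 0 ≤ B ∧
        ∀ j, ∀ w ∈ ball z r, ‖F j w‖ ≤ B * (1 / 2) ^ j) ∧
      ∀ i u, PluriharmonicOn u Ω → (∀ z ∈ Ω, 0 ≤ u z) → ∀ β,
        (∀ z ∈ Ω, (∀ j, j ≠ i → ‖F j z‖ ≤ (1 / 2) ^ j / 16) → 1 / 2 ≤ ‖F i z‖ → β ≤ u z) →
        β ≤ C * u P₀ := by
  obtain ⟨C, hC, N₀, hpeak⟩ := sd.exists_peak hΩ hc hP₀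
  have hτ := sd.τ_pos
  set R := ‖fr.pt‖ with hR
  have hR0 : 0 < R := norm_pos_iff.2 fr.pt_ne
  set t : ℕ → ℝ := fun j => sd.τ * (1 + 1 / ((j : ℝ) + 1)) with ht
  -- Half of the distance from `t j` to the nearest other slice parameter.
  set δ : ℕ → ℝ := fun j => sd.τ * (1 / (((j : ℝ) + 1) * (j + 2))) / 2 with hδ
  have hδ0 : ∀ j, 0 < δ j := fun j => by positivity
  have htmem : ∀ j, t j ∈ Icc sd.τ (2 * sd.τ) := fun j => by
    have h1 : 0 < 1 / ((j : ℝ) + 1) := by positivity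
    have h2 : 1 / ((j : ℝ) + 1) ≤ 1 := by
      rw [div_le_one (by positivity)]
      linarith [(Nat.cast_nonneg j : (0 : ℝ) ≤ j)]
    constructor <;> simp only [ht] <;> nlinarith
  have hgap : ∀ i j, j ≠ i → 2 * δ j ≤ |t i - t j| := by
    intro i j hij
    have h1 : t i - t j = sd.τ * (1 / ((i : ℝ) + 1) - 1 / ((j : ℝ) + 1)) := by
      simp only [ht]; ring
    rw [h1, abs_mul, abs_of_pos hτ, hδ]
    have := mul_le_mul_of_nonneg_left (gap_le_abs hij) hτ.le
    linarith
  -- The bound `2 ^ j` gives local summability inside `Ω`; the last one makes `F j` at most `(1 / 2)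
  -- ^ j / 16` at distance `R * δ j` from its slice.
  have hN : ∀ j : ℕ, ∃ N : ℕ, N₀ ≤ N ∧ (2 : ℝ) ^ j ≤ N ∧
      16 * 2 ^ j * C / (R * δ j) ^ 4 ≤ N := by
    intro j
    obtain ⟨N, hN⟩ := exists_nat_ge (max (N₀ : ℝ) (max (2 ^ j) (16 * 2 ^ j * C / (R * δ j) ^ 4)))
    refine ⟨N, ?_, ?_, ?_⟩
    · exact_mod_cast (le_max_left _ _).trans hN
    · exact ((le_max_left _ _).trans (le_max_right _ _)).trans hN
    · exact ((le_max_right _ _).trans (le_max_right _ _)).trans hN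
  choose N hNN₀ hN2 hNδ using hN
  have hN0 : ∀ j, 0 < (N j : ℝ) := fun j => lt_of_lt_of_le (by positivity) (hN2 j)
  choose F hF1 hF2 hF3 hF4 using fun j => hpeak (N j) (hNN₀ j) (t j) (htmem j)
  -- A real coordinate on the whole space that equals `t` on the slice with parameter `t`.
  set s : EuclideanSpace ℂ (Fin n) → ℝ := fun z => 1 - inner ℝ fr.pt z / R ^ 2 with hs
  have hfar : ∀ j, ∀ z ∈ Ω, δ j ≤ |s z - t j| → ‖F j z‖ ≤ (1 / 2) ^ j / 16 := by
    intro j z hz hsz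
    have hδj := hδ0 j
    have hd : ∀ a : ℂ, R * δ j ≤ ‖z - fr.slice (t j) a‖ := by
      intro a
      have h1 := abs_real_inner_le_norm fr.pt (z - fr.slice (t j) a)
      rw [inner_sub_right, fr.inner_slice] at h1
      have h2 : inner ℝ fr.pt z - (1 - t j) * ‖fr.pt‖ ^ 2 = -(R ^ 2 * (s z - t j)) := by
        simp only [hs, ← hR]
        field_simp
        ring
      rw [h2, abs_neg, abs_mul, abs_of_pos (by positivity : 0 < R ^ 2), ← hR] at h1
      have h3 : R * (R * |s z - t j|) ≤ R * ‖z - fr.slice (t j) a‖ := by linarith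
      refine le_trans ?_ (le_of_mul_le_mul_left h3 hR0)
      gcongr
    refine (hF3 j z hz (R * δ j) (by positivity) fun a _ _ => hd a).trans ?_
    have h1 := hNδ j
    have h2 := hN0 j
    rw [div_le_iff₀ (by positivity)] at h1
    rw [div_le_iff₀ (by positivity)]
    have h3 : C = (1 / 2 : ℝ) ^ j / 16 * (16 * 2 ^ j * C) := by
      have : (1 / 2 : ℝ) ^ j * 2 ^ j = 1 := by rw [← mul_pow]; norm_num
      linear_combination (-C) * this
    calc C = (1 / 2 : ℝ) ^ j / 16 * (16 * 2 ^ j * C) := h3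
      _ ≤ _ := by gcongr
  refine ⟨C, hC, F, hF1, hF2, ?_, ?_, ?_⟩
  · intro z hz
    by_cases h : ∃ i, |s z - t i| < δ i
    · obtain ⟨i, hi⟩ := h
      refine ⟨i, fun j hij => hfar j z hz ?_⟩
      by_contra! hj
      have h1 : |t i - t j| < δ i + δ j := by
        have h2 := _root_.abs_sub_le (t i) (s z) (t j)
        rw [abs_sub_comm (t i) (s z)] at h2
        linarith
      have h2 := hgap i j hij
      have h3 := hgap j i hij.symm
      rw [abs_sub_comm] at h3
      linarith
    · push Not at h
      exact ⟨0, fun j _ => hfar j z hz (h j)⟩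
  -- The zeros of `g` on the slices lie outside `Ω`, hence outside a ball about `z` contained in
  -- `Ω`, so the decay estimate applies with one fixed distance.
  · intro z hz
    obtain ⟨r, hr0, hr⟩ := Metric.isOpen_iff.1 hΩ z hz
    refine ⟨r / 2, by positivity, (ball_subset_ball (by linarith)).trans hr,
      C / (r / 2) ^ 4, by positivity, fun j w hw => ?_⟩
    have hwΩ : w ∈ Ω := hr (ball_subset_ball (by linarith) hw)
    have h1 := hF3 j w hwΩ (r / 2) (by positivity) fun a ha hga => by
      by_contra! hlt
      have h2 : fr.slice (t j) a ∈ ball z r := by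
        have h3 := dist_triangle (fr.slice (t j) a) w z
        rw [mem_ball]
        rw [mem_ball] at hw
        rw [← dist_eq_norm, dist_comm] at hlt
        linarith
      have h3 := (fr.neg_iff _ (sd.slice_mem _ (htmem j) a ha)).2 (hr h2)
      linarith
    refine h1.trans ?_
    have h2 := hN2 j
    have h3 : ((N j : ℝ))⁻¹ ≤ (1 / 2 : ℝ) ^ j := by
      rw [one_div, inv_pow]
      exact inv_anti₀ (by positivity) h2
    calc C / (N j * (r / 2) ^ 4) = C / (r / 2) ^ 4 * ((N j : ℝ))⁻¹ := by field_simp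
      _ ≤ _ := by gcongr
  · intro i u hu hu0 β hβ
    refine hF4 i u hu hu0 β fun z hz hzi hzF => hβ z hz (fun j hij => hfar j z hz ?_) hzF
    have h1 : s z = t i := by
      simp only [hs]
      rw [hzi]
      field_simp
      ring
    rw [h1]
    exact le_trans (by linarith [hδ0 j]) (hgap i j hij)

/-- The upper bound uses a constant majorant of the uniformly bounded sum. For the lower bound, a
coordinate `i` with `‖x i‖ > ‖x‖ / 2` makes the function at least `‖x‖ / 4 - ‖x‖ / 8` in modulus
where the `i`-th peak is large, so no majorant is small at `P₀`. -/
theorem IsC2DefiningFunction.exists_embedding (hn : 2 ≤ n) {ρ : EuclideanSpace ℂ (Fin n) → ℝ}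
    (hρ : IsC2DefiningFunction Ω ρ) (P₀ : Ω) :
    ∃ (T : lp (fun _ : ℕ => ℂ) ∞ →ₗ[ℂ] LumerSpace Ω P₀) (c C : ℝ), 0 < c ∧
      ∀ x, c * ‖x‖ ≤ ‖T x‖ ∧ ‖T x‖ ≤ C * ‖x‖ := by
  obtain ⟨fr⟩ := hρ.nonempty_convexFrame hn
  obtain ⟨sd⟩ := fr.nonempty_sliceData
  obtain ⟨C, hC, F, hF, hF2, hF3, hF4, hF5⟩ := sd.exists_peak_sequence hρ.isOpen
    hρ.isConnected.isPreconnected P₀.2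
  have hle : ∀ (x : lp (fun _ : ℕ => ℂ) ∞) j, ‖x j‖ ≤ ‖x‖ := fun x j =>
    lp.norm_apply_le_norm (by simp) x j
  have hsumm : ∀ (x : lp (fun _ : ℕ => ℂ) ∞), ∀ z ∈ Ω, Summable fun j => x j * F j z := by
    intro x z hz
    obtain ⟨r, hr0, -, B, hB, hFB⟩ := hF4 z hz
    refine Summable.of_norm_bounded (g := fun j => ‖x‖ * (B * (1 / 2) ^ j))
      ((summable_geometric_two.mul_left B).mul_left _) fun j => ?_
    rw [norm_mul]
    exact mul_le_mul (hle x j) (hFB j z (mem_ball_self hr0)) (norm_nonneg _) (norm_nonneg _)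
  set f : lp (fun _ : ℕ => ℂ) ∞ → Ω → ℂ := fun x z => ∑' j, x j * F j z with hf
  have hgeo : HasSum (fun j : ℕ => (1 / 2 : ℝ) ^ j / 16) (1 / 8) := by
    have := hasSum_geometric_two.div_const 16
    norm_num at this
    norm_num
    exact this
  have hrest : ∀ (x : lp (fun _ : ℕ => ℂ) ∞) (z : Ω) i,
      (∀ j, j ≠ i → ‖F j z‖ ≤ (1 / 2) ^ j / 16) → ‖f x z - x i * F i z‖ ≤ ‖x‖ * (1 / 8) := by
    intro x z i hi
    have h1 := (hsumm x z z.2).tsum_eq_add_tsum_ite i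
    have h2 : f x z - x i * F i z = ∑' j, ite (j = i) 0 (x j * F j z) := by
      rw [hf]
      simp only
      rw [h1, add_sub_cancel_left]
    rw [h2]
    refine tsum_of_norm_bounded (hgeo.mul_left ‖x‖) fun j => ?_
    split_ifs with hj
    · rw [norm_zero]; positivity
    · rw [norm_mul]
      exact mul_le_mul (hle x j) (hi j hj) (norm_nonneg _) (norm_nonneg _)
  have hbound : ∀ (x : lp (fun _ : ℕ => ℂ) ∞) (z : Ω), ‖f x z‖ ≤ 2 * ‖x‖ := by
    intro x z
    obtain ⟨i, hi⟩ := hF3 z z.2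
    have h1 := hrest x z i hi
    have h2 : ‖x i * F i z‖ ≤ ‖x‖ * (5 / 4) := by
      rw [norm_mul]
      exact mul_le_mul (hle x i) (hF2 i z z.2) (norm_nonneg _) (norm_nonneg _)
    have h3 := norm_sub_norm_le (f x z) (x i * F i z)
    linarith [norm_nonneg x]
  have hmaj : ∀ x, IsMajorant (f x) fun _ => (2 * ‖x‖) ^ 2 := fun x =>
    ⟨pluriharmonicOn_const _ Ω, fun z => pow_le_pow_left₀ (norm_nonneg _) (hbound x z) 2⟩
  have hmem : ∀ x, f x ∈ lumerHardy Ω := by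
    intro x
    refine ⟨?_, _, hmaj x⟩
    have h1 : DifferentiableOn ℂ (fun z => ∑' j, x j * F j z) Ω := by
      refine differentiableOn_tsum_of_locally_bounded hρ.isOpen (fun j => (hF j).const_mul _)
        fun z hz => ?_
      obtain ⟨r, hr0, hrΩ, B, hB, hFB⟩ := hF4 z hz
      refine ⟨r, hr0, hrΩ, fun j => ‖x‖ * (B * (1 / 2) ^ j),
        (summable_geometric_two.mul_left B).mul_left _, fun j w hw => ?_⟩
      rw [norm_mul]
      exact mul_le_mul (hle x j) (hFB j w hw) (norm_nonneg _) (norm_nonneg _)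
    exact h1.congr fun z hz => extZero_apply (f x) ⟨z, hz⟩
  refine ⟨{ toFun := fun x => LumerSpace.mk P₀ (f x) (hmem x)
            map_add' := fun x y => LumerSpace.ext (funext fun z => ?_)
            map_smul' := fun a x => LumerSpace.ext (funext fun z => ?_) },
    1 / (8 * √C), 2, by positivity, fun x => ⟨?_, ?_⟩⟩
  · simp only [LumerSpace.toFun_mk, LumerSpace.toFun_add, Pi.add_apply, hf]
    rw [← (hsumm x z z.2).tsum_add (hsumm y z z.2)]
    refine tsum_congr fun j => ?_
    rw [lp.coeFn_add, Pi.add_apply, add_mul]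
  · simp only [LumerSpace.toFun_mk, LumerSpace.toFun_smul, Pi.smul_apply, hf, smul_eq_mul,
      RingHom.id_apply]
    rw [← tsum_mul_left]
    refine tsum_congr fun j => ?_
    rw [lp.coeFn_smul, Pi.smul_apply, smul_eq_mul, mul_assoc]
  · change 1 / (8 * √C) * ‖x‖ ≤ ‖LumerSpace.mk P₀ (f x) (hmem x)‖
    rcases eq_or_ne x 0 with rfl | hx
    · rw [norm_zero, mul_zero]
      exact LumerSpace.norm_nonneg' _
    have hx0 : 0 < ‖x‖ := norm_pos_iff.2 hx
    refine le_of_forall_gt_imp_ge_of_dense fun r hr => ?_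
    have hr0 : 0 ≤ r := (LumerSpace.norm_nonneg' _).trans hr.le
    obtain ⟨u, hu, hur⟩ := LumerSpace.exists_majorant_le_sq hr
    obtain ⟨i, hi⟩ : ∃ i, ‖x‖ / 2 < ‖x i‖ := by
      have h1 : ‖x‖ / 2 < ⨆ i, ‖x i‖ := by
        rw [← lp.norm_eq_ciSup]
        linarith
      exact exists_lt_of_lt_ciSup h1
    have h1 : (‖x‖ / 8) ^ 2 ≤ C * u P₀ := by
      refine hF5 i u hu.1 hu.nonneg _ fun z hz hzj hzi => ?_
      refine le_trans ?_ (hu.2 ⟨z, hz⟩)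
      rw [LumerSpace.toFun_mk]
      have h2 := hrest x ⟨z, hz⟩ i hzj
      have h3 : ‖x‖ / 2 * (1 / 2) ≤ ‖x i * F i z‖ := by
        rw [norm_mul]
        gcongr
      have h4 := norm_sub_norm_le (x i * F i z) (f x ⟨z, hz⟩)
      rw [norm_sub_rev] at h4
      refine pow_le_pow_left₀ (by positivity) ?_ 2
      linarith
    have h2 : (‖x‖ / 8) ^ 2 ≤ (√C * r) ^ 2 := by
      rw [mul_pow, Real.sq_sqrt hC.le]
      exact h1.trans (by gcongr)
    have h3 : ‖x‖ / 8 ≤ √C * r := (abs_le_of_sq_le_sq' h2 (by positivity)).2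
    rw [div_mul_eq_mul_div, one_mul, div_le_iff₀ (by positivity)]
    linarith
  · exact LumerSpace.norm_le_of_majorant_sq (hmaj x) (by positivity) le_rfl

end Embedding

end LumerHardy

theorem proposition2p1 {n : ℕ} (hn : 2 ≤ n) {Ω : Set (EuclideanSpace ℂ (Fin n))}
    {ρ : EuclideanSpace ℂ (Fin n) → ℝ} (hρ : LumerHardy.IsC2DefiningFunction Ω ρ) (P₀ : Ω) :
    -- the Lumer Hardy space is a linear subspace of the Hardy space
    LumerHardy.lumerHardy Ω ≤ LumerHardy.hardy hρ ∧
    -- with continuous inclusion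
    (∃ ε₀ > (0 : ℝ), ∃ C : ℝ≥0, ∀ f : LumerHardy.LumerSpace Ω P₀,
      LumerHardy.hardyNorm ρ ε₀ f.toFun ≤ C * ENNReal.ofReal ‖f‖) ∧
    -- its norm is a norm
    ∃ core : NormedSpace.Core ℂ (LumerHardy.LumerSpace Ω P₀),
      letI : NormedAddCommGroup (LumerHardy.LumerSpace Ω P₀) := NormedAddCommGroup.ofCore core
      letI : NormedSpace ℂ (LumerHardy.LumerSpace Ω P₀) := NormedSpace.ofCore core
      -- which is complete
      CompleteSpace (LumerHardy.LumerSpace Ω P₀) ∧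
      -- it has a closed subspace isomorphic to the space of bounded sequences
      (∃ S : Submodule ℂ (LumerHardy.LumerSpace Ω P₀),
        IsClosed (S : Set (LumerHardy.LumerSpace Ω P₀)) ∧
        Nonempty (lp (fun _ : ℕ => ℂ) ∞ ≃L[ℂ] S)) ∧
      -- and it is not isomorphic to any Hilbert space
      ∀ (H : Type*) [NormedAddCommGroup H] [InnerProductSpace ℂ H] [CompleteSpace H],
        IsEmpty (LumerHardy.LumerSpace Ω P₀ ≃L[ℂ] H) := by
  have hΩ := hρ.isOpen
  have hc := hρ.isConnected.isPreconnected
  obtain ⟨ε₀, hε₀, C, hC⟩ := LumerHardy.exists_hardyNorm_le (by omega) hρ P₀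
  refine ⟨?_, ⟨ε₀, hε₀, C, hC⟩, LumerHardy.LumerSpace.core hΩ hc P₀, ?_⟩
  · intro f hf
    refine ⟨hf.1, ε₀, hε₀, (hC (LumerHardy.LumerSpace.mk P₀ f hf)).trans_lt ?_⟩
    exact ENNReal.mul_lt_top ENNReal.coe_lt_top ENNReal.ofReal_lt_top
  · letI : NormedAddCommGroup (LumerHardy.LumerSpace Ω P₀) :=
      NormedAddCommGroup.ofCore (LumerHardy.LumerSpace.core hΩ hc P₀)
    letI : NormedSpace ℂ (LumerHardy.LumerSpace Ω P₀) :=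
      NormedSpace.ofCore (LumerHardy.LumerSpace.core hΩ hc P₀)
    obtain ⟨T, c, D, hc0, hT⟩ := hρ.exists_embedding hn P₀
    obtain ⟨S, hS, ⟨φ⟩⟩ := LumerHardy.exists_closed_subspace_equiv T hc0 hT
    refine ⟨?_, ⟨S, hS, ⟨φ⟩⟩, fun H _ _ _ => LumerHardy.isEmpty_equiv_hilbert φ H⟩
    refine NormedAddCommGroup.completeSpace_of_summable_imp_tendsto fun g hg => ?_
    obtain ⟨f, hf⟩ := LumerHardy.LumerSpace.exists_tendsto_sum hΩ hc P₀ g hg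
    refine ⟨f, ?_⟩
    rw [tendsto_iff_norm_sub_tendsto_zero]
    simpa only [norm_sub_rev] using hf
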